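/- Let $0<q<1$, $\rho>0$, $\tau_0>0$. On $(0,\infty)_t\times\mathbb R^3_x$ put $r=|x|$, $v=\frac12\big(\frac{t^{1-q}}{1-q}+r\big)$, $u=\frac12\big(\frac{t^{1-q}}{1-q}-r\big)$, so that $\partial_v=t^q\partial_t+\partial_r$, and let $\mathring{\slashed\nabla}$ be the gradient on the unit sphere $\mathbb S^2$ with measure $d\omega$. Let $\tau=\frac{t^{1-q}}{2(1-q)}$ for $r\le\rho$ and $\tau=u+\frac\rho2$ for $r\ge\rho$; let $\Sigma_\tau=\mathcal S_\tau\cup\mathcal C_\tau$ be its level sets, where $\mathcal S_\tau=\Sigma_\tau\cap\{r\le\rho\}$ and $\mathcal C_\tau=\Sigma_\tau\cap\{r\ge\rho\}=\{u=\tau-\frac\rho2,\ r\ge\rho\}$; and let $\mathcal D^{\tau_2}_{\tau_1}=\{\tau_1\le\tau\le\tau_2,\ r>\rho\}$. Denote by $\int_{\mathcal I^{\tau_2}_{\tau_1}}(\cdot)\,du\,d\omega$ the flux through future null infinity, i.e. the upper limit as $V\to\infty$ of the integrals over $\{v=V,\ \tau_1-\frac\rho2\le u\le\tau_2-\frac\rho2\}$.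 Set $\mu_q=0$ if $q\le\frac12$, $\mu_q=4q-2$ if $q>\frac12$, $\sigma_q=2\Big(\frac{q|1-2q|}{(1-q)^2}\Big)^{1/2}$, and $$\mathcal E_q[\psi](\tau)=\int_{\mathcal S_\tau}t^{2q-\mu_q}\Big(|\partial_t(t^q\psi)|^2+|\partial_r\psi|^2+\tfrac1{r^2}|\partial_r(r\psi)|^2+\tfrac1{r^2}|\mathring{\slashed\nabla}\psi|^2+t^{2q-2}\psi^2+\tfrac{1}{1+r^2}\psi^2\Big)dx$$ $$\qquad+\int_{\mathcal C_\tau}t^{-\mu_q}\Big(\tfrac1{r^2}|\partial_v(rt^q\psi)|^2+|\partial_v(t^q\psi)|^2+\tfrac{t^{2q}}{r^2}|\mathring{\slashed\nabla}\psi|^2+t^{4q-2}\psi^2+\tfrac{t^{2q}}{r^2}\psi^2\Big)r^2\,dv\,d\omega .$$ Let $\psi$ be a smooth solution, on $\{\tau\ge\tau_0\}$ (up to and including the boundary $\Sigma_{\tau_0}$), of $-\partial_t^2\psi-\frac{3q}{t}\partial_t\psi+t^{-2q}\Delta_{\mathbb R^3}\psi=0$ whose data on $\Sigma_{\tau_0}$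 are compactly supported, and put $\varphi=r t^q\psi$. (i) For every $0<p<\max\{1,2-\sigma_q\}$ there is a constant $C=C(q,p,\rho,\tau_0)$, independent of $\psi,\tau_1,\tau_2$, such that for all $\tau_2>\tau_1\ge\tau_0$ $$\int_{\mathcal D^{\tau_2}_{\tau_1}}t^{-\mu_q}r^{p-1}\Big(|\partial_v\varphi|^2+r^2|\partial_v(t^q\psi)|^2+\tfrac1{r^2}|\mathring{\slashed\nabla}\varphi|^2+\tfrac1{r^2}\varphi^2\Big)du\,dv\,d\omega+\int_{\mathcal C_{\tau_2}}t^{-\mu_q}r^p|\partial_v\varphi|^2\,dv\,d\omega$$ $$\qquad+\int_{\mathcal I^{\tau_2}_{\tau_1}}t^{-\mu_q}r^{p-2}\big(|\mathring{\slashed\nabla}\varphi|^2+\varphi^2\big)du\,d\omega\ \le\ C\Big(\int_{\mathcal C_{\tau_1}}t^{-\mu_q}r^p|\partial_v\varphi|^2\,dv\,d\omega+\mathcal E_q[\psi](\tau_1)\Big).$$ (ii) If $q=\frac12$, there is a constant $C=C(\rho,\tau_0)$, independent of $\psi,\tau_1,\tau_2$, such that for all $\tau_2>\tau_1\ge\tau_0$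 $$\int_{\mathcal D^{\tau_2}_{\tau_1}}r|\partial_v\varphi|^2\,du\,dv\,d\omega+\int_{\mathcal C_{\tau_2}}r^2|\partial_v\varphi|^2\,dv\,d\omega+\int_{\mathcal I^{\tau_2}_{\tau_1}}|\mathring{\slashed\nabla}\varphi|^2\,du\,d\omega\ \le\ C\Big(\int_{\mathcal C_{\tau_1}}r^2|\partial_v\varphi|^2\,dv\,d\omega+\mathcal E_{1/2}[\psi](\tau_1)\Big).$$ -/

import Mathlib

open MeasureTheory Set Filter
open scoped ENNReal NNReal ContDiff

noncomputable section

namespace FLRW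

/-- Flat space `ℝ³` with its Euclidean norm; `volume` on it is Lebesgue measure `dx`. -/
abbrev Space : Type := EuclideanSpace ℝ (Fin 3)

/-- Coordinates `(t, x)`; the spacetime manifold is the part `t > 0`. -/
abbrev Spacetime : Type := ℝ × Space

/-- The unit sphere `𝕊²`. -/
abbrev Sphere : Type := Metric.sphere (0 : Space) 1

/-- The standard surface measure `dω` of the unit sphere (total mass `4π`). -/
def sphereMeasure : Measure Sphere := (volume : Measure Space).toSphere

/-! ### Coordinates and derivatives -/

/-- The radial coordinate `r = |x|`. -/
def radius (z : Spacetime) : ℝ := ‖z.2‖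

/-- The retarded null coordinate `u = ½ (t^(1-q)/(1-q) - r)`. -/
def uCoord (q : ℝ) (z : Spacetime) : ℝ := (z.1 ^ (1 - q) / (1 - q) - radius z) / 2

/-- The derivative `∂_t`. -/
def dt (f : Spacetime → ℝ) (z : Spacetime) : ℝ := fderiv ℝ f z (1, 0)

/-- The Cartesian derivative `∂_{x^i}`. -/
def dx (i : Fin 3) (f : Spacetime → ℝ) (z : Spacetime) : ℝ :=
  fderiv ℝ f z (0, EuclideanSpace.single i 1)

/-- The radial derivative `∂_r` (for `x ≠ 0`). -/
def dr (f : Spacetime → ℝ) (z : Spacetime) : ℝ := fderiv ℝ f z (0, (radius z)⁻¹ • z.2)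

/-- The outgoing null derivative `∂_v = t^q ∂_t + ∂_r`. -/
def dv (q : ℝ) (f : Spacetime → ℝ) (z : Spacetime) : ℝ := z.1 ^ q * dt f z + dr f z

/-- The squared norm `|∇̊ f|²` of the gradient on the unit sphere, which is the sum of the squares
of the three rotation fields `x²∂₃ - x³∂₂`, `x³∂₁ - x¹∂₃`, `x¹∂₂ - x²∂₁` applied to `f`. -/
def angularSq (f : Spacetime → ℝ) (z : Spacetime) : ℝ :=
  (z.2 1 * dx 2 f z - z.2 2 * dx 1 f z) ^ 2
    + (z.2 2 * dx 0 f z - z.2 0 * dx 2 f z) ^ 2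
    + (z.2 0 * dx 1 f z - z.2 1 * dx 0 f z) ^ 2

/-- The wave operator `□ψ = -∂_tt ψ - (3q/t) ∂_t ψ + t^(-2q) Δψ` of the metric
`-dt² + t^(2q) |dx|²`. -/
def box (q : ℝ) (ψ : Spacetime → ℝ) (z : Spacetime) : ℝ :=
  -dt (dt ψ) z - 3 * q / z.1 * dt ψ z + z.1 ^ (-(2 * q)) * ∑ i, dx i (dx i ψ) z

/-! ### The foliation -/

/-- The time function `τ`, equal to `½ t^(1-q)/(1-q)` for `r ≤ ρ` and to `u + ρ/2` for `r ≥ ρ`. -/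
def tau (q ρ : ℝ) (z : Spacetime) : ℝ :=
  if radius z ≤ ρ then z.1 ^ (1 - q) / (1 - q) / 2 else uCoord q z + ρ / 2

/-- The leaf `Σ_τ = 𝒮_τ ∪ 𝒞_τ`. -/
def leaf (q ρ τ : ℝ) : Set Spacetime := {z | 0 < z.1 ∧ tau q ρ z = τ}

/-- The future `{τ ≥ τ₀}` of the initial hypersurface `Σ_{τ₀}`. -/
def future (q ρ τ₀ : ℝ) : Set Spacetime := {z | 0 < z.1 ∧ τ₀ ≤ tau q ρ z}

/-- `ψ` is a smooth solution of the wave equation on `{τ ≥ τ₀}`, up to and including the boundary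
`Σ_{τ₀}`, whose data on `Σ_{τ₀}` have compact support. (The data are `ψ` on `Σ_{τ₀}` and `∂_t ψ`
on the spacelike piece `r ≤ ρ`; that piece is compact, so the support of `∂_t ψ` on it is compact
automatically.) Only the values of `ψ` on `{τ ≥ τ₀}` matter. -/
structure IsSolution (q ρ τ₀ : ℝ) (ψ : Spacetime → ℝ) : Prop where
  smooth : ∃ U : Set Spacetime, IsOpen U ∧ future q ρ τ₀ ⊆ U ∧ ContDiffOn ℝ ∞ ψ U
  wave : ∀ z ∈ future q ρ τ₀, box q ψ z = 0
  compactSupport : HasCompactSupport (fun z : leaf q ρ τ₀ => ψ z)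

/-! ### Integration

All integrands below are non-negative, so integrals take values in `[0, ∞]`. -/

/-- The point with double null coordinates `(u, v, θ)` (for `u + v > 0` and `v ≥ u`):
`t = ((1-q)(v+u))^(1/(1-q))` and `x = (v-u) θ`. -/
def nullPoint (q u v : ℝ) (θ : Sphere) : Spacetime :=
  (((1 - q) * (v + u)) ^ (1 / (1 - q)), (v - u) • (θ : Space))

/-- `∫_{𝒮_τ} F dx`, where `𝒮_τ` is the piece `r ≤ ρ` of `Σ_τ`, on which
`t^(1-q) = 2(1-q)τ`. -/
def integralS (q ρ τ : ℝ) (F : Spacetime → ℝ) : ℝ≥0∞ :=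
  ∫⁻ x in Metric.closedBall (0 : Space) ρ,
    ENNReal.ofReal (F ((2 * (1 - q) * τ) ^ (1 / (1 - q)), x))

/-- `∫_{𝒞_τ} F dv dω`, where `𝒞_τ` is the outgoing null cone piece `u = τ - ρ/2`, `r = v - u ≥ ρ`
of `Σ_τ`. -/
def integralC (q ρ τ : ℝ) (F : Spacetime → ℝ) : ℝ≥0∞ :=
  ∫⁻ v in Ici (τ - ρ / 2 + ρ), ∫⁻ θ, ENNReal.ofReal (F (nullPoint q (τ - ρ / 2) v θ))
    ∂sphereMeasure

/-- `∫_{𝒟} F du dv dω` over the far region `𝒟 = {τ₁ ≤ τ ≤ τ₂, r > ρ}`, that is,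
`τ₁ - ρ/2 ≤ u ≤ τ₂ - ρ/2` and `v - u > ρ`. -/
def integralD (q ρ τ₁ τ₂ : ℝ) (F : Spacetime → ℝ) : ℝ≥0∞ :=
  ∫⁻ u in Icc (τ₁ - ρ / 2) (τ₂ - ρ / 2), ∫⁻ v in Ioi (u + ρ), ∫⁻ θ,
    ENNReal.ofReal (F (nullPoint q u v θ)) ∂sphereMeasure

/-- `∫_{ℐ} F du dω` over the part `τ₁ - ρ/2 ≤ u ≤ τ₂ - ρ/2` of future null infinity, as the upper
limit for `V → ∞` of the integrals over the ingoing null cones `v = V`. -/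
def integralScri (q ρ τ₁ τ₂ : ℝ) (F : Spacetime → ℝ) : ℝ≥0∞ :=
  limsup (fun V : ℝ => ∫⁻ u in Icc (τ₁ - ρ / 2) (τ₂ - ρ / 2), ∫⁻ θ,
    ENNReal.ofReal (F (nullPoint q u V θ)) ∂sphereMeasure) atTop

/-! ### The quantities of the estimate -/

/-- `μ_q = 0` for `q ≤ ½` and `μ_q = 4q - 2` for `q > ½`. -/
def mu (q : ℝ) : ℝ := if q ≤ 1 / 2 then 0 else 4 * q - 2

/-- `σ_q = 2 (q |1-2q| / (1-q)²)^(1/2)`. -/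
def sigma (q : ℝ) : ℝ := 2 * √(q * |1 - 2 * q| / (1 - q) ^ 2)

/-- The twisted function `t^q ψ`. -/
def twist (q : ℝ) (ψ : Spacetime → ℝ) (z : Spacetime) : ℝ := z.1 ^ q * ψ z

/-- `φ = r t^q ψ`. -/
def phi (q : ℝ) (ψ : Spacetime → ℝ) (z : Spacetime) : ℝ := radius z * z.1 ^ q * ψ z

/-- Density of the energy on `𝒮_τ` with respect to `dx`. -/
def energyDensityS (q : ℝ) (ψ : Spacetime → ℝ) (z : Spacetime) : ℝ :=
  z.1 ^ (-mu q) * z.1 ^ (2 * q) *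
    (dt (twist q ψ) z ^ 2 + dr ψ z ^ 2
      + dr (fun w => radius w * ψ w) z ^ 2 / radius z ^ 2
      + angularSq ψ z / radius z ^ 2
      + z.1 ^ (2 * q - 2) * ψ z ^ 2
      + ψ z ^ 2 / (1 + radius z ^ 2))

/-- Density of the energy on `𝒞_τ` with respect to `dv dω`; the last factor `r²` comes from the
measure `r² dv dω`. -/
def energyDensityC (q : ℝ) (ψ : Spacetime → ℝ) (z : Spacetime) : ℝ :=
  z.1 ^ (-mu q) *
    (dv q (phi q ψ) z ^ 2 / radius z ^ 2 + dv q (twist q ψ) z ^ 2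
      + z.1 ^ (2 * q) * angularSq ψ z / radius z ^ 2
      + z.1 ^ (4 * q - 2) * ψ z ^ 2
      + z.1 ^ (2 * q) * ψ z ^ 2 / radius z ^ 2) * radius z ^ 2

/-- The twisted energy flux `ℰ_q[ψ](τ)` through `Σ_τ`. -/
def energy (q ρ : ℝ) (ψ : Spacetime → ℝ) (τ : ℝ) : ℝ≥0∞ :=
  integralS q ρ τ (energyDensityS q ψ) + integralC q ρ τ (energyDensityC q ψ)

/-- The `r^p` flux `∫_{𝒞_τ} t^(-μ_q) r^p |∂_v φ|² dv dω`. -/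
def rpFlux (q ρ p : ℝ) (ψ : Spacetime → ℝ) (τ : ℝ) : ℝ≥0∞ :=
  integralC q ρ τ (fun z => z.1 ^ (-mu q) * radius z ^ p * dv q (phi q ψ) z ^ 2)

/-- The weighted bulk integral over the far region:
`∫_𝒟 t^(-μ_q) r^(p-1) (|∂_v φ|² + r² |∂_v(t^q ψ)|² + |∇̊φ|²/r² + φ²/r²) du dv dω`. -/
def rpBulk (q ρ p : ℝ) (ψ : Spacetime → ℝ) (τ₁ τ₂ : ℝ) : ℝ≥0∞ :=
  integralD q ρ τ₁ τ₂ (fun z => z.1 ^ (-mu q) * radius z ^ (p - 1) *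
    (dv q (phi q ψ) z ^ 2 + radius z ^ 2 * dv q (twist q ψ) z ^ 2
      + angularSq (phi q ψ) z / radius z ^ 2 + phi q ψ z ^ 2 / radius z ^ 2))

/-- The flux `∫_ℐ t^(-μ_q) r^(p-2) (|∇̊φ|² + φ²) du dω` through null infinity. -/
def rpScri (q ρ p : ℝ) (ψ : Spacetime → ℝ) (τ₁ τ₂ : ℝ) : ℝ≥0∞ :=
  integralScri q ρ τ₁ τ₂ (fun z => z.1 ^ (-mu q) * radius z ^ (p - 2) *
    (angularSq (phi q ψ) z + phi q ψ z ^ 2))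

end FLRW

end

/-!
In conformal time `s = t^(1-q) / (1-q) = u + v`, with `r = v - u`, the function `f = r t^q ψ` solves
`∂_u ∂_v f = r⁻² Δ̊ f + κ s⁻² f` with `κ = q (2q - 1) / (1 - q)²` (`conformal_wave`,
`isPolarSolution_of_wave`). Put `m = μ_q / (2 (1 - q))`, so that the weight `w = t^(-μ_q)` is a
multiple of `s^(-2m)`. Then `m = 0` for `q ≤ 1/2` and `κ = m (m + 1)` for `q > 1/2`.

The estimate comes from a single current with the null components
`w r^p ∫ |∂_v f|² dω` and `w r^(p-2) ∫ (|∇̊ f|² + H(r/s) f²) dω`,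
where `H` is a quadratic polynomial with non-negative coefficients. Multiplying the equation by
`∂_v f` and integrating by parts on the spheres (`fderiv_outgoingSq_add_fderiv_angularInt`) shows
that its divergence is `-w r^(p-1)` times a non-negative angular term plus a quadratic form in `∂_v f`
and `f / r` whose coefficients depend on `r / s` only (`nullDiv_current`). For every admissible `p`
some `H` makes this form positive definite: this is a discriminant inequality, settled in three cases
by `exists_coercive_of_nonpos`, `exists_coercive_of_one_le` and `exists_coercive_of_lt_one`. The
condition `p < 2 - σ_q` enters as `4 |κ| < (2 - p)²`. For `q ≤ 1/2` it holds for `p < 1` too, as then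
`4 |κ| ≤ 1`; for `q > 1/2` and `p < 1` a linear term in `H` makes it unnecessary. For `q = 1/2` the
potential vanishes and `H = 0` allows `p = 2`.

Since the divergence has a sign down to the axis, the current is used in the near region `r ≤ ρ` as
well. There the flux through `r = ε` tends to zero with `ε`, because `f = r g` with `g` smooth, so that
the flux through `r = ρ` is bounded by the flux through the initial slice `𝒮_{τ₁}`, hence by the energy
(`IsPolarSolution.integral_timelike_le`, `Represents.slice_flux_le`). In the far region the flux
through `r = ρ` cancels against this one (`IsPolarSolution.truncated_estimate`). In this way no
separate energy or integrated local energy estimate is needed. The limit `V → ∞` of the estimates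
truncated at `v = V` gives the integrals over the far region, over the cone and at null infinity
(`Represents.estimate`).

On the angular side everything is phrased with the three rotation fields acting on functions of
`((s, r), y)` with `y ∈ ℝ³`; their integrals over the unit sphere vanish by rotation invariance of the
surface measure.
-/

open Topology

namespace FLRW

/-! ### Spherical integrals and rotation invariance -/

/-- Differentiation under the integral sign over a compact space. -/
theorem hasFDerivAt_integral_of_continuous {X Y : Type*} [NormedAddCommGroup X] [NormedSpace ℝ X]
    [FiniteDimensional ℝ X] [TopologicalSpace Y] [CompactSpace Y] [MeasurableSpace Y]
    [BorelSpace Y] [SecondCountableTopology Y] {μ : Measure Y} [IsFiniteMeasure μ] {F : X → Y → ℝ}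
    {F' : X → Y → X →L[ℝ] ℝ} (hF : Continuous F.uncurry) (hF' : Continuous F'.uncurry)
    (h : ∀ x y, HasFDerivAt (F · y) (F' x y) x) (x₀ : X) :
    HasFDerivAt (fun x => ∫ y, F x y ∂μ) (∫ y, F' x₀ y ∂μ) x₀ := by
  have : ProperSpace X := FiniteDimensional.proper ℝ X
  obtain ⟨K, hK, hKx⟩ := exists_compact_mem_nhds x₀
  obtain ⟨M, hM⟩ := (hK.prod (isCompact_univ (X := Y))).bddAbove_image hF'.norm.continuousOn
  have hc (x : X) : Continuous (F x) := hF.comp (by fun_prop : Continuous fun y => (x, y))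
  have hc' (x : X) : Continuous (F' x) := hF'.comp (by fun_prop : Continuous fun y => (x, y))
  refine hasFDerivAt_integral_of_dominated_of_fderiv_le (bound := fun _ => M) hKx
    (.of_forall fun x => (hc x).aestronglyMeasurable)
    ((hc x₀).integrable_of_hasCompactSupport (.of_compactSpace _))
    ((hc' x₀).aestronglyMeasurable) (.of_forall fun y x hx => ?_) (integrable_const _)
    (.of_forall fun y x _ => h x y)
  exact hM ⟨(x, y), ⟨hx, mem_univ _⟩, rfl⟩

/-- The one-variable case of `hasFDerivAt_integral_of_continuous`. -/
theorem hasDerivAt_integral_of_continuous {Y : Type*} [TopologicalSpace Y] [CompactSpace Y]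
    [MeasurableSpace Y] [BorelSpace Y] [SecondCountableTopology Y] {μ : Measure Y}
    [IsFiniteMeasure μ] {F F' : ℝ → Y → ℝ} (hF : Continuous F.uncurry)
    (hF' : Continuous F'.uncurry) (h : ∀ x y, HasDerivAt (F · y) (F' x y) x) (x₀ : ℝ) :
    HasDerivAt (fun x => ∫ y, F x y ∂μ) (∫ y, F' x₀ y ∂μ) x₀ := by
  have key := hasFDerivAt_integral_of_continuous (μ := μ) (F := F)
    (F' := fun x y => F' x y • (1 : ℝ →L[ℝ] ℝ)) hF
    (hF'.smul continuous_const)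
    (fun x y => (h x y).hasFDerivAt.congr_fderiv (by ext; simp)) x₀
  rw [integral_smul_const] at key
  simpa using key.hasDerivAt

instance : IsFiniteMeasure sphereMeasure := by
  unfold sphereMeasure
  infer_instance

/-- A linear isometry acting on the unit sphere. -/
noncomputable def sphereMap (R : Space ≃ₗᵢ[ℝ] Space) (θ : Sphere) : Sphere :=
  ⟨R θ, by simp⟩

open scoped Pointwise in
theorem measurePreserving_sphereMap (R : Space ≃ₗᵢ[ℝ] Space) :
    MeasurePreserving (sphereMap R) sphereMeasure sphereMeasure := by
  have hc : Continuous (sphereMap R) := by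
    unfold sphereMap
    exact Continuous.subtype_mk (R.continuous.comp continuous_subtype_val) _
  refine ⟨hc.measurable, ?_⟩
  ext s hs
  rw [Measure.map_apply hc.measurable hs, sphereMeasure, Measure.toSphere_apply' _ hs,
    Measure.toSphere_apply' _ (hc.measurable hs)]
  have : Ioo (0 : ℝ) 1 • ((↑) '' (sphereMap R ⁻¹' s) : Set Space)
      = R ⁻¹' (Ioo (0 : ℝ) 1 • ((↑) '' s)) := by
    ext y
    simp only [Set.mem_smul, mem_preimage]
    constructor
    · rintro ⟨a, ha, _, ⟨θ, hθ, rfl⟩, rfl⟩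
      exact ⟨a, ha, _, ⟨sphereMap R θ, hθ, rfl⟩, by simp [sphereMap]⟩
    · rintro ⟨a, ha, _, ⟨θ, hθ, rfl⟩, h⟩
      refine ⟨a, ha, _, ⟨sphereMap R.symm θ, ?_, rfl⟩, ?_⟩
      · simpa [sphereMap] using hθ
      · apply R.injective
        simpa [sphereMap] using h
  have hR := R.measurePreserving.measure_preimage_emb
    R.toHomeomorph.measurableEmbedding (Ioo (0 : ℝ) 1 • ((↑) '' s))
  rw [this, hR]

/-- The generator `x ↦ e_i × x` of the rotations about the `i`-th coordinate axis. -/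
noncomputable def rot (i : Fin 3) : Space →L[ℝ] Space :=
  (EuclideanSpace.proj (𝕜 := ℝ) (i + 1)).smulRight (EuclideanSpace.single (i + 2) (1 : ℝ))
    - (EuclideanSpace.proj (𝕜 := ℝ) (i + 2)).smulRight (EuclideanSpace.single (i + 1) (1 : ℝ))

theorem rot_apply (i : Fin 3) (x : Space) :
    rot i x = x (i + 1) • EuclideanSpace.single (i + 2) (1 : ℝ)
      - x (i + 2) • EuclideanSpace.single (i + 1) (1 : ℝ) := by
  simp [rot]

theorem norm_sq_eq_sum (x : Space) : ‖x‖ ^ 2 = x 0 ^ 2 + x 1 ^ 2 + x 2 ^ 2 := by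
  simp [EuclideanSpace.norm_sq_eq, Fin.sum_univ_three]

/-- The rotation by the angle `ε` about the `i`-th axis, by Rodrigues' formula. -/
noncomputable def rotation (i : Fin 3) (ε : ℝ) : Space ≃ₗᵢ[ℝ] Space :=
  LinearIsometry.toLinearIsometryEquiv
    { toLinearMap := (ContinuousLinearMap.id ℝ Space + Real.sin ε • rot i
        + (1 - Real.cos ε) • (rot i).comp (rot i)).toLinearMap
      norm_map' := by
        intro x
        have h : Real.sin ε ^ 2 = 1 - Real.cos ε ^ 2 := by
          linarith [Real.sin_sq_add_cos_sq ε]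
        rw [← sq_eq_sq₀ (norm_nonneg _) (norm_nonneg _), norm_sq_eq_sum, norm_sq_eq_sum]
        fin_cases i <;> simp [rot_apply] <;> ring_nf <;> rw [h] <;> ring } rfl

theorem rotation_apply (i : Fin 3) (ε : ℝ) (x : Space) :
    rotation i ε x = x + Real.sin ε • rot i x + (1 - Real.cos ε) • rot i (rot i x) := rfl

/-- The integral over the unit sphere of a derivative along a rotation field vanishes. -/
theorem integral_fderiv_rot_eq_zero (i : Fin 3) {G : Space → ℝ} (hG : ContDiff ℝ 1 G) :
    ∫ θ : Sphere, fderiv ℝ G θ (rot i θ) ∂sphereMeasure = 0 := by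
  have hd (ε : ℝ) (x : Space) : HasDerivAt (fun ε => rotation i ε x)
      (Real.cos ε • rot i x + Real.sin ε • rot i (rot i x)) ε := by
    simp only [rotation_apply]
    have h1 := (Real.hasDerivAt_sin ε).smul_const (rot i x)
    have h2 := ((Real.hasDerivAt_cos ε).const_sub 1).smul_const (rot i (rot i x))
    exact ((h1.const_add x).add h2).congr_deriv (by simp)
  have hcont : Continuous (fun p : ℝ × Sphere => rotation i p.1 (p.2 : Space)) := by
    simp only [rotation_apply]
    have := (rot i).continuous
    fun_prop
  have hcG' := hG.continuous_fderiv one_ne_zero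
  have key := hasDerivAt_integral_of_continuous (Y := Sphere) (μ := sphereMeasure)
    (F := fun ε θ => G (rotation i ε θ))
    (F' := fun ε θ =>
      fderiv ℝ G (rotation i ε θ) (Real.cos ε • rot i θ + Real.sin ε • rot i (rot i θ)))
    (hG.continuous.comp hcont) (by
      have h0 := (rot i).continuous
      exact (hcG'.comp hcont).clm_apply (by fun_prop))
    (fun ε θ => (hG.differentiable one_ne_zero _).hasFDerivAt.comp_hasDerivAt ε (hd ε θ)) 0
  have hconst : (fun ε => ∫ θ : Sphere, G (rotation i ε θ) ∂sphereMeasure)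
      = fun _ => ∫ θ : Sphere, G θ ∂sphereMeasure := by
    funext ε
    have hm := measurePreserving_sphereMap (rotation i ε)
    calc _ = ∫ θ : Sphere, (fun θ : Sphere => G θ) (sphereMap (rotation i ε) θ) ∂sphereMeasure :=
          rfl
      _ = ∫ θ : Sphere, G θ ∂(sphereMeasure.map (sphereMap (rotation i ε))) :=
          (integral_map hm.measurable.aemeasurable
            (by rw [hm.map_eq]; exact
              (hG.continuous.comp continuous_subtype_val).aestronglyMeasurable)).symm
      _ = _ := by rw [hm.map_eq]
  rw [hconst] at key
  simpa [rotation_apply] using key.unique (hasDerivAt_const _ _)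

/-! ### Spherical integrals depending on time and radius -/

/-- Points `((s, r), y)`: conformal time, radius and an angular variable `y`, restricted to the unit
sphere only when integrating. -/
abbrev Polar : Type := (ℝ × ℝ) × Space

/-- The integral of `G` over the unit sphere, as a function of `(s, r)`. -/
noncomputable def sphereInt (G : Polar → ℝ) (z : ℝ × ℝ) : ℝ := ∫ θ : Sphere, G (z, θ) ∂sphereMeasure

/-- The derivative along a constant direction of the `(s, r)` plane. -/
noncomputable def along (w : ℝ × ℝ) (G : Polar → ℝ) (p : Polar) : ℝ := fderiv ℝ G p (w, 0)

/-- The derivative along the `i`-th rotation field. -/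
noncomputable def rotDeriv (i : Fin 3) (G : Polar → ℝ) (p : Polar) : ℝ :=
  fderiv ℝ G p (0, rot i p.2)

section
variable {G H : Polar → ℝ}

theorem _root_.ContDiff.along (hG : ContDiff ℝ ∞ G) (w : ℝ × ℝ) : ContDiff ℝ ∞ (along w G) :=
  (hG.fderiv_right (m := ∞) (by simp)).clm_apply contDiff_const

theorem contDiff_rot_field (i : Fin 3) :
    ContDiff ℝ ∞ (fun p : Polar => ((0 : ℝ × ℝ), rot i p.2)) :=
  contDiff_const.prodMk ((rot i).contDiff.comp contDiff_snd)

theorem _root_.ContDiff.rotDeriv (hG : ContDiff ℝ ∞ G) (i : Fin 3) :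
    ContDiff ℝ ∞ (rotDeriv i G) :=
  (hG.fderiv_right (m := ∞) (by simp)).clm_apply (contDiff_rot_field i)

theorem along_mul (hG : ContDiff ℝ ∞ G) (hH : ContDiff ℝ ∞ H) (w : ℝ × ℝ) (p : Polar) :
    along w (fun p => G p * H p) p = G p * along w H p + along w G p * H p := by
  simp only [along]
  rw [fderiv_fun_mul (hG.differentiable (by simp) p) (hH.differentiable (by simp) p)]
  simp [mul_comm]

theorem rotDeriv_mul (hG : ContDiff ℝ ∞ G) (hH : ContDiff ℝ ∞ H) (i : Fin 3) (p : Polar) :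
    rotDeriv i (fun p => G p * H p) p = G p * rotDeriv i H p + rotDeriv i G p * H p := by
  simp only [rotDeriv]
  rw [fderiv_fun_mul (hG.differentiable (by simp) p) (hH.differentiable (by simp) p)]
  simp [mul_comm]

/-- The rotation fields commute with `∂_s` and `∂_r`. -/
theorem along_rotDeriv (hG : ContDiff ℝ ∞ G) (w : ℝ × ℝ) (i : Fin 3) (p : Polar) :
    along w (rotDeriv i G) p = rotDeriv i (along w G) p := by
  have h2 : ContDiff ℝ ∞ (fderiv ℝ G) := hG.fderiv_right (m := ∞) (by simp)
  have hd := h2.differentiable (by simp) p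
  have hr : HasFDerivAt (fun p : Polar => ((0 : ℝ × ℝ), rot i p.2))
      ((0 : Polar →L[ℝ] ℝ × ℝ).prod ((rot i).comp (ContinuousLinearMap.snd ℝ _ _))) p :=
    (hasFDerivAt_const _ _).prodMk ((rot i).hasFDerivAt.comp p hasFDerivAt_snd)
  have hsymm : IsSymmSndFDerivAt ℝ G p :=
    (hG.contDiffAt).isSymmSndFDerivAt (by
      simpa using (WithTop.coe_le_coe.2 le_top : ((2 : ℕ∞) : WithTop ℕ∞) ≤ ((⊤ : ℕ∞) : WithTop ℕ∞)))
  have e1 : along w (rotDeriv i G) p = fderiv ℝ (fderiv ℝ G) p (w, 0) (0, rot i p.2) := by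
    have : fderiv ℝ (rotDeriv i G) p = _ := (hd.hasFDerivAt.clm_apply hr).fderiv
    rw [along, this]
    simp [show ((0 : ℝ × ℝ), (0 : Space)) = 0 from rfl]
  have e2 : rotDeriv i (along w G) p = fderiv ℝ (fderiv ℝ G) p (0, rot i p.2) (w, 0) := by
    have : fderiv ℝ (along w G) p = _ :=
      (hd.hasFDerivAt.clm_apply (hasFDerivAt_const (w, (0 : Space)) p)).fderiv
    rw [rotDeriv, this]
    simp
  rw [e1, e2, hsymm.eq]

theorem continuous_sphere_slice (hG : Continuous G) (z : ℝ × ℝ) :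
    Continuous fun θ : Sphere => G (z, θ) := by fun_prop

theorem integrable_sphere {g : Sphere → ℝ} (hg : Continuous g) : Integrable g sphereMeasure :=
  hg.integrable_of_hasCompactSupport (.of_compactSpace _)

theorem sphereInt_add (hG : Continuous G) (hH : Continuous H) (z : ℝ × ℝ) :
    sphereInt (fun p => G p + H p) z = sphereInt G z + sphereInt H z :=
  integral_add (integrable_sphere (continuous_sphere_slice hG z))
    (integrable_sphere (continuous_sphere_slice hH z))

theorem hasFDerivAt_sphereInt (hG : ContDiff ℝ 1 G) (z : ℝ × ℝ) :
    HasFDerivAt (sphereInt G) (∫ θ : Sphere, (fderiv ℝ G (z, θ)).comp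
      (ContinuousLinearMap.inl ℝ (ℝ × ℝ) Space) ∂sphereMeasure) z := by
  have hc := hG.continuous_fderiv one_ne_zero
  refine hasFDerivAt_integral_of_continuous (F := fun z (θ : Sphere) => G (z, θ))
    (F' := fun z (θ : Sphere) => (fderiv ℝ G (z, θ)).comp
      (ContinuousLinearMap.inl ℝ (ℝ × ℝ) Space)) ?_ ?_ (fun z θ => ?_) z
  · have := hG.continuous
    fun_prop
  · exact (hc.comp (by fun_prop : Continuous fun p : (ℝ × ℝ) × Sphere =>
      ((p.1, (p.2 : Space)) : Polar))).clm_comp continuous_const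
  · exact (hG.differentiable one_ne_zero _).hasFDerivAt.comp z (hasFDerivAt_prodMk_left z _)

theorem contDiff_sphereInt (hG : ContDiff ℝ 1 G) : ContDiff ℝ 1 (sphereInt G) := by
  refine contDiff_one_iff_hasFDerivAt.2 ⟨_, ?_, hasFDerivAt_sphereInt hG⟩
  have hc := hG.continuous_fderiv one_ne_zero
  have := continuous_parametric_integral_of_continuous (μ := sphereMeasure)
    (f := fun (z : ℝ × ℝ) (θ : Sphere) => (fderiv ℝ G (z, θ)).comp
      (ContinuousLinearMap.inl ℝ (ℝ × ℝ) Space)) (by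
        exact (hc.comp (by fun_prop : Continuous fun p : (ℝ × ℝ) × Sphere =>
          ((p.1, (p.2 : Space)) : Polar))).clm_comp continuous_const) isCompact_univ
  simpa using this

theorem fderiv_sphereInt (hG : ContDiff ℝ ∞ G) (z w : ℝ × ℝ) :
    fderiv ℝ (sphereInt G) z w = sphereInt (along w G) z := by
  have hG1 : ContDiff ℝ 1 G := hG.of_le (by exact_mod_cast le_top)
  have hc := hG1.continuous_fderiv one_ne_zero
  rw [(hasFDerivAt_sphereInt hG1 z).fderiv, ContinuousLinearMap.integral_apply]
  · simp [sphereInt, along]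
  · exact ((hc.comp (by fun_prop : Continuous fun θ : Sphere =>
      ((z, (θ : Space)) : Polar))).clm_comp continuous_const).integrable_of_hasCompactSupport
        (.of_compactSpace _)

/-- Integration by parts on the sphere. -/
theorem sphereInt_rotDeriv (hG : ContDiff ℝ ∞ G) (i : Fin 3) (z : ℝ × ℝ) :
    sphereInt (rotDeriv i G) z = 0 := by
  have h := integral_fderiv_rot_eq_zero i (G := fun y => G (z, y))
    ((hG.of_le (by exact_mod_cast le_top)).comp (contDiff_const.prodMk contDiff_id))
  rw [← h]
  refine integral_congr_ae (.of_forall fun θ => ?_)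
  have : HasFDerivAt (fun y => G (z, y)) ((fderiv ℝ G (z, θ)).comp
      (ContinuousLinearMap.inr ℝ (ℝ × ℝ) Space)) (θ : Space) :=
    (hG.differentiable (by simp) _).hasFDerivAt.comp _ (hasFDerivAt_prodMk_right z _)
  simp [rotDeriv, this.fderiv]

/-- `∫ |∂_v f|² dω`. -/
noncomputable def outgoingSq (f : Polar → ℝ) : ℝ × ℝ → ℝ :=
  sphereInt fun p => along (1, 1) f p * along (1, 1) f p

/-- `∫ |∇̊ f|² dω`. -/
noncomputable def angularInt (f : Polar → ℝ) : ℝ × ℝ → ℝ :=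
  sphereInt fun p => ∑ i, rotDeriv i f p * rotDeriv i f p

/-- `∫ f² dω`. -/
noncomputable def massInt (f : Polar → ℝ) : ℝ × ℝ → ℝ := sphereInt fun p => f p * f p

/-- `∫ f ∂_v f dω`. -/
noncomputable def crossInt (f : Polar → ℝ) : ℝ × ℝ → ℝ := sphereInt fun p => f p * along (1, 1) f p

theorem sphereInt_const_mul (c : ℝ) (z : ℝ × ℝ) :
    sphereInt (fun p => c * G p) z = c * sphereInt G z := by
  simp [sphereInt, integral_const_mul]

theorem fderiv_massInt (hG : ContDiff ℝ ∞ G) (z : ℝ × ℝ) :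
    fderiv ℝ (massInt G) z (1, 1) = 2 * crossInt G z := by
  rw [massInt, fderiv_sphereInt (hG.mul hG), crossInt, ← sphereInt_const_mul]
  congr 1
  funext p
  rw [along_mul hG hG]
  ring

/-- The wave equation in spherical coordinates, integrated over the sphere against `2 ∂_v f`: the
angular Laplacian is integrated by parts with the rotation fields. -/
theorem fderiv_outgoingSq_add_fderiv_angularInt {f : Polar → ℝ} (hf : ContDiff ℝ ∞ f) (z : ℝ × ℝ)
    (a b : ℝ)
    (hwave : ∀ θ : Sphere, a * along (1, -1) (along (1, 1) f) (z, θ)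
      = ∑ i, rotDeriv i (rotDeriv i f) (z, θ) + b * f (z, θ)) :
    a * fderiv ℝ (outgoingSq f) z (1, -1) + fderiv ℝ (angularInt f) z (1, 1)
      = b * fderiv ℝ (massInt f) z (1, 1) := by
  have hv := hf.along (1, 1)
  have hR (i : Fin 3) := hf.rotDeriv i
  have hRR (i : Fin 3) := (hf.rotDeriv i).rotDeriv i
  have hRv (i : Fin 3) := hv.rotDeriv i
  have huv := hv.along (1, -1)
  have hN : ContDiff ℝ ∞ fun p => ∑ i, rotDeriv i f p * rotDeriv i f p :=
    ContDiff.sum fun i _ => (hR i).mul (hR i)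
  have hQ : ContDiff ℝ ∞ fun p => ∑ i, rotDeriv i (fun p => rotDeriv i f p * along (1, 1) f p) p :=
    ContDiff.sum fun i _ => ((hR i).mul hv).rotDeriv i
  have hzero : sphereInt (fun p => ∑ i, rotDeriv i (fun p => rotDeriv i f p * along (1, 1) f p) p) z
      = 0 := by
    have : ∀ i ∈ Finset.univ, Integrable (fun θ : Sphere =>
        rotDeriv i (fun p => rotDeriv i f p * along (1, 1) f p) (z, (θ : Space))) sphereMeasure :=
      fun i _ => integrable_sphere
        (continuous_sphere_slice (((hR i).mul hv).rotDeriv i).continuous z)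
    rw [sphereInt, integral_finsetSum _ this]
    exact Finset.sum_eq_zero fun i _ => sphereInt_rotDeriv ((hR i).mul hv) i z
  rw [fderiv_massInt hf, outgoingSq, angularInt, fderiv_sphereInt (hv.mul hv), fderiv_sphereInt hN,
    crossInt, ← sphereInt_const_mul, ← sphereInt_const_mul, ← sphereInt_const_mul]
  have hL : ContDiff ℝ ∞ fun p => a * along (1, -1)
      (fun p => along (1, 1) f p * along (1, 1) f p) p := contDiff_const.mul ((hv.mul hv).along _)
  rw [← sphereInt_add hL.continuous (hN.along _).continuous]
  -- total rotation derivatives may be added, their integrals over the sphere being zero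
  have hsub : sphereInt (fun p => a * along (1, -1) (fun p => along (1, 1) f p * along (1, 1) f p) p
      + along (1, 1) (fun p => ∑ i, rotDeriv i f p * rotDeriv i f p) p) z
      = sphereInt (fun p => a * along (1, -1) (fun p => along (1, 1) f p * along (1, 1) f p) p
        + along (1, 1) (fun p => ∑ i, rotDeriv i f p * rotDeriv i f p) p
        + -2 * ∑ i, rotDeriv i (fun p => rotDeriv i f p * along (1, 1) f p) p) z := by
    rw [sphereInt_add (G := fun p => a * along (1, -1)
        (fun p => along (1, 1) f p * along (1, 1) f p) p
        + along (1, 1) (fun p => ∑ i, rotDeriv i f p * rotDeriv i f p) p)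
      (hL.add (hN.along _)).continuous (contDiff_const.mul hQ).continuous,
      sphereInt_const_mul, hzero]
    ring
  rw [hsub]
  refine integral_congr_ae (.of_forall fun θ => ?_)
  have hsum : along (1, 1) (fun p => ∑ i, rotDeriv i f p * rotDeriv i f p) (z, (θ : Space))
      = ∑ i, 2 * (rotDeriv i f (z, θ) * rotDeriv i (along (1, 1) f) (z, θ)) := by
    simp only [along]
    rw [fderiv_fun_sum fun i _ => ((hR i).mul (hR i)).differentiable (by simp) _]
    rw [sum_apply]
    refine Finset.sum_congr rfl fun i _ => ?_
    have h1 := along_mul (hR i) (hR i) (1, 1) (z, (θ : Space))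
    rw [along_rotDeriv hf] at h1
    simp only [along] at h1
    rw [h1]
    ring
  have hw := hwave θ
  simp only [hsum, along_mul hv hv, fun i => rotDeriv_mul (hR i) hv i]
  rw [Finset.sum_add_distrib, ← Finset.sum_mul, ← Finset.mul_sum]
  have : ∑ i, rotDeriv i (rotDeriv i f) (z, (θ : Space))
      = a * along (1, -1) (along (1, 1) f) (z, θ) - b * f (z, θ) := by rw [hw]; ring
  rw [this]
  ring

end

/-! ### The divergence theorem in the `(s, r)` half-plane -/

/-- The quadrant `s > 0`, `r > 0` of the `(s, r)` plane. -/
def quadrant : Set (ℝ × ℝ) := Ioi 0 ×ˢ Ioi 0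

theorem isOpen_quadrant : IsOpen quadrant := isOpen_Ioi.prod isOpen_Ioi

/-- The divergence of the current with components `A`, `B` along the null directions `∂_u`, `∂_v`. -/
noncomputable def nullDiv (A B : ℝ × ℝ → ℝ) (z : ℝ × ℝ) : ℝ :=
  fderiv ℝ A z (1, -1) + fderiv ℝ B z (1, 1)

section
variable {A B : ℝ × ℝ → ℝ}

theorem continuousOn_nullDiv (hA : ContDiffOn ℝ 1 A quadrant) (hB : ContDiffOn ℝ 1 B quadrant) :
    ContinuousOn (nullDiv A B) quadrant :=
  ((hA.continuousOn_fderiv_of_isOpen isOpen_quadrant le_rfl).clm_apply continuousOn_const).add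
    ((hB.continuousOn_fderiv_of_isOpen isOpen_quadrant le_rfl).clm_apply continuousOn_const)

/-- The divergence theorem on a rectangle in `(s, r)`. -/
theorem integral_nullDiv_rectangle (hA : ContDiffOn ℝ 1 A quadrant)
    (hB : ContDiffOn ℝ 1 B quadrant) {s₁ s₂ ε ρ : ℝ} (hs : 0 < s₁) (hs' : s₁ ≤ s₂) (hε : 0 < ε)
    (hερ : ε ≤ ρ) :
    ∫ s in s₁..s₂, ∫ r in ε..ρ, nullDiv A B (s, r)
      = ((∫ s in s₁..s₂, (B (s, ρ) - A (s, ρ))) - ∫ s in s₁..s₂, (B (s, ε) - A (s, ε)))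
        + (∫ r in ε..ρ, (A (s₂, r) + B (s₂, r))) - ∫ r in ε..ρ, (A (s₁, r) + B (s₁, r)) := by
  have hsub : uIcc s₁ s₂ ×ˢ uIcc ε ρ ⊆ quadrant := by
    rw [uIcc_of_le hs', uIcc_of_le hερ]
    rintro ⟨a, b⟩ ⟨ha, hb⟩
    exact ⟨hs.trans_le ha.1, hε.trans_le hb.1⟩
  have hsub' : Ioo (min s₁ s₂) (max s₁ s₂) ×ˢ Ioo (min ε ρ) (max ε ρ) ⊆ quadrant := by
    refine Subset.trans (prod_mono ?_ ?_) hsub <;> exact Ioo_subset_Icc_self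
  have hdA (z) (hz : z ∈ quadrant) : HasFDerivAt A (fderiv ℝ A z) z :=
    ((hA.contDiffAt (isOpen_quadrant.mem_nhds hz)).differentiableAt one_ne_zero).hasFDerivAt
  have hdB (z) (hz : z ∈ quadrant) : HasFDerivAt B (fderiv ℝ B z) z :=
    ((hB.contDiffAt (isOpen_quadrant.mem_nhds hz)).differentiableAt one_ne_zero).hasFDerivAt
  have heq (z : ℝ × ℝ) : (fderiv ℝ A z + fderiv ℝ B z) (1, 0)
      + (fderiv ℝ B z - fderiv ℝ A z) (0, 1) = nullDiv A B z := by
    have e1 : ((1, -1) : ℝ × ℝ) = (1, 0) - (0, 1) := by simp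
    have e2 : ((1, 1) : ℝ × ℝ) = (1, 0) + (0, 1) := by simp
    simp only [nullDiv, add_apply, sub_apply, e1, e2, map_add, map_sub]
    ring
  have key := integral2_divergence_prod_of_hasFDerivAt (fun z => A z + B z) (fun z => B z - A z)
    (fun z => fderiv ℝ A z + fderiv ℝ B z) (fun z => fderiv ℝ B z - fderiv ℝ A z) s₁ ε s₂ ρ
    ((hA.continuousOn.add hB.continuousOn).mono hsub)
    ((hB.continuousOn.sub hA.continuousOn).mono hsub)
    (fun z hz => (hdA z (hsub' hz)).add (hdB z (hsub' hz)))
    (fun z hz => (hdB z (hsub' hz)).sub (hdA z (hsub' hz)))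
    (by
      simp only [heq]
      exact ((continuousOn_nullDiv hA hB).mono hsub).integrableOn_compact
        (isCompact_uIcc.prod isCompact_uIcc))
  simpa only [heq] using key

/-- The divergence theorem on the trapezoid `u₁ ≤ u ≤ u₂`, `u + ρ ≤ v ≤ V`, which is parametrised by
`v = u + ρ + l (V - u - ρ)` with `0 ≤ l ≤ 1`. -/
theorem integral_nullDiv_trapezoid (hA : ContDiffOn ℝ 1 A quadrant)
    (hB : ContDiffOn ℝ 1 B quadrant) {u₁ u₂ ρ V : ℝ} (hρ : 0 < ρ) (hu : u₁ ≤ u₂)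
    (hu₁ : 0 < 2 * u₁ + ρ) (hV : u₂ + ρ ≤ V) :
    ∫ u in u₁..u₂, ∫ v in (u + ρ)..V, nullDiv A B (u + v, v - u)
      = (∫ u in u₁..u₂, B (u + V, V - u))
        - (∫ u in u₁..u₂, (B (2 * u + ρ, ρ) - A (2 * u + ρ, ρ)))
        + (∫ v in (u₂ + ρ)..V, A (u₂ + v, v - u₂)) - ∫ v in (u₁ + ρ)..V, A (u₁ + v, v - u₁) := by
  set j : ℝ × ℝ → ℝ × ℝ := fun z => (2 * z.1 + ρ + z.2 * (V - z.1 - ρ), ρ + z.2 * (V - z.1 - ρ))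
    with hj
  have hjc : ContDiff ℝ 1 j := by rw [hj]; fun_prop
  have hsub : MapsTo j (uIcc u₁ u₂ ×ˢ uIcc (0 : ℝ) 1) quadrant := by
    rw [uIcc_of_le hu, uIcc_of_le zero_le_one]
    rintro ⟨a, b⟩ ⟨ha, hb⟩
    have : 0 ≤ b * (V - a - ρ) := mul_nonneg hb.1 (by linarith [ha.2])
    exact ⟨by show 0 < 2 * a + ρ + b * (V - a - ρ); linarith [ha.1],
      by show 0 < ρ + b * (V - a - ρ); linarith⟩
  have hsub' : Ioo (min u₁ u₂) (max u₁ u₂) ×ˢ Ioo (min (0 : ℝ) 1) (max 0 1)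
      ⊆ uIcc u₁ u₂ ×ˢ uIcc (0 : ℝ) 1 := prod_mono Ioo_subset_Icc_self Ioo_subset_Icc_self
  have hjd (z : ℝ × ℝ) (w : ℝ × ℝ) : HasDerivAt (fun h : ℝ => j (z + h • w))
      (2 * w.1 + w.2 * (V - z.1 - ρ) - z.2 * w.1, w.2 * (V - z.1 - ρ) - z.2 * w.1) 0 := by
    have h1 : HasDerivAt (fun h : ℝ => z.1 + h * w.1) w.1 0 := by
      simpa using ((hasDerivAt_id (0 : ℝ)).mul_const w.1).const_add z.1
    have h2 : HasDerivAt (fun h : ℝ => z.2 + h * w.2) w.2 0 := by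
      simpa using ((hasDerivAt_id (0 : ℝ)).mul_const w.2).const_add z.2
    have h3 := h2.mul ((h1.const_sub V).sub_const ρ)
    refine HasDerivAt.prodMk ?_ ?_
    · refine (((h1.const_mul 2).add_const ρ).add h3).congr_deriv ?_
      simp
      ring
    · refine (h3.const_add ρ).congr_deriv ?_
      simp
      ring
  have hjf (z w : ℝ × ℝ) : fderiv ℝ j z w
      = (2 * w.1 + w.2 * (V - z.1 - ρ) - z.2 * w.1, w.2 * (V - z.1 - ρ) - z.2 * w.1) := by
    have h1 : HasDerivAt (fun h : ℝ => z + h • w) w 0 := by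
      simpa using ((hasDerivAt_id (0 : ℝ)).smul_const w).const_add z
    have h2 : HasFDerivAt j (fderiv ℝ j z) (z + (0 : ℝ) • w) := by
      simpa using (hjc.differentiable one_ne_zero z).hasFDerivAt
    have h3 : HasDerivAt (fun h : ℝ => j (z + h • w)) (fderiv ℝ j z w) 0 :=
      h2.comp_hasDerivAt 0 h1
    exact h3.unique (hjd z w)
  have hdA (z) (hz : z ∈ quadrant) : HasFDerivAt A (fderiv ℝ A z) z :=
    ((hA.contDiffAt (isOpen_quadrant.mem_nhds hz)).differentiableAt one_ne_zero).hasFDerivAt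
  have hdB (z) (hz : z ∈ quadrant) : HasFDerivAt B (fderiv ℝ B z) z :=
    ((hB.contDiffAt (isOpen_quadrant.mem_nhds hz)).differentiableAt one_ne_zero).hasFDerivAt
  have hjA (z : ℝ × ℝ) (hz : j z ∈ quadrant) := (hdA _ hz).comp z
    (hjc.differentiable one_ne_zero z).hasFDerivAt
  have hjB (z : ℝ × ℝ) (hz : j z ∈ quadrant) := (hdB _ hz).comp z
    (hjc.differentiable one_ne_zero z).hasFDerivAt
  have hℓ' (z : ℝ × ℝ) : HasFDerivAt (fun z : ℝ × ℝ => V - z.1 - ρ)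
      (-ContinuousLinearMap.fst ℝ ℝ ℝ) z :=
    (hasFDerivAt_fst.const_sub V).sub_const ρ
  have hl' (z : ℝ × ℝ) : HasFDerivAt (fun z : ℝ × ℝ => 1 - z.2)
      (-ContinuousLinearMap.snd ℝ ℝ ℝ) z :=
    hasFDerivAt_snd.const_sub 1
  have heq (z : ℝ × ℝ) :
      ((V - z.1 - ρ) • (fderiv ℝ A (j z)).comp (fderiv ℝ j z)
        + A (j z) • (-ContinuousLinearMap.fst ℝ ℝ ℝ)) (1, 0)
      + ((fderiv ℝ B (j z)).comp (fderiv ℝ j z)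
        - ((1 - z.2) • (fderiv ℝ A (j z)).comp (fderiv ℝ j z)
        + A (j z) • (-ContinuousLinearMap.snd ℝ ℝ ℝ))) (0, 1)
      = (V - z.1 - ρ) * nullDiv A B (j z) := by
    have e1 : ((2 * 1 + 0 * (V - z.1 - ρ) - z.2 * 1, 0 * (V - z.1 - ρ) - z.2 * 1) : ℝ × ℝ)
        = (1, -1) + (1 - z.2) • (1, 1) := by
      ext <;> simp <;> ring
    have e2 : ((2 * 0 + 1 * (V - z.1 - ρ) - z.2 * 0, 1 * (V - z.1 - ρ) - z.2 * 0) : ℝ × ℝ)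
        = (V - z.1 - ρ) • (1, 1) := by
      ext <;> simp
    simp only [nullDiv, add_apply, sub_apply, smul_apply,
      ContinuousLinearMap.comp_apply, hjf, e1, e2, map_add, map_smul, neg_apply,
      ContinuousLinearMap.coe_fst', ContinuousLinearMap.coe_snd', smul_eq_mul]
    ring
  have hcA := hA.continuousOn.comp hjc.continuous.continuousOn hsub
  have hcB := hB.continuousOn.comp hjc.continuous.continuousOn hsub
  have hcD := (continuousOn_nullDiv hA hB).comp hjc.continuous.continuousOn hsub
  -- the current in the coordinates `(u, l)`, multiplied by the Jacobian `V - u - ρ`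
  have key := integral2_divergence_prod_of_hasFDerivAt
    (fun z => (V - z.1 - ρ) * A (j z)) (fun z => B (j z) - (1 - z.2) * A (j z))
    (fun z => (V - z.1 - ρ) • (fderiv ℝ A (j z)).comp (fderiv ℝ j z)
        + A (j z) • (-ContinuousLinearMap.fst ℝ ℝ ℝ))
    (fun z => (fderiv ℝ B (j z)).comp (fderiv ℝ j z)
        - ((1 - z.2) • (fderiv ℝ A (j z)).comp (fderiv ℝ j z)
        + A (j z) • (-ContinuousLinearMap.snd ℝ ℝ ℝ))) u₁ 0 u₂ 1
    ((by fun_prop : Continuous fun z : ℝ × ℝ => V - z.1 - ρ).continuousOn.mul hcA)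
    (hcB.sub ((by fun_prop : Continuous fun z : ℝ × ℝ => 1 - z.2).continuousOn.mul hcA))
    (fun z hz => (hℓ' z).mul (hjA z (hsub (hsub' hz))))
    (fun z hz => (hjB z (hsub (hsub' hz))).sub ((hl' z).mul (hjA z (hsub (hsub' hz)))))
    (by
      simp only [heq]
      exact ((by fun_prop : Continuous fun z : ℝ × ℝ => V - z.1 - ρ).continuousOn.mul
        hcD).integrableOn_compact (isCompact_uIcc.prod isCompact_uIcc))
  replace key := (intervalIntegral.integral_congr fun u _ =>
    intervalIntegral.integral_congr fun l _ => (heq (u, l)).symm).trans key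
  have hsubst (u : ℝ) (g : ℝ × ℝ → ℝ) : ∫ l in (0 : ℝ)..1, (V - u - ρ) * g (j (u, l))
      = ∫ v in (u + ρ)..V, g (u + v, v - u) := by
    rw [intervalIntegral.integral_const_mul]
    have := intervalIntegral.mul_integral_comp_add_mul (a := 0) (b := 1)
      (f := fun v => g (u + v, v - u)) (V - u - ρ) (u + ρ)
    rw [show u + ρ + (V - u - ρ) * 0 = u + ρ by ring,
      show u + ρ + (V - u - ρ) * 1 = V by ring] at this
    rw [← this]
    congr 2
    funext l
    congr 1
    refine Prod.ext ?_ ?_ <;>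
    · simp [hj]
      ring
  simp only [hsubst] at key
  rw [key]
  have e3 (u : ℝ) : j (u, 1) = (u + V, V - u) := by
    refine Prod.ext ?_ (by simp [hj])
    simp only [hj]
    ring
  have e4 (u : ℝ) : j (u, 0) = (2 * u + ρ, ρ) := by ext <;> simp [hj]
  simp [e3, e4]

end

/-! ### The weighted current and its divergence -/

/-- The quadratic weight `H(x) = α x² + β x + γ` of the zeroth order term of the current, where
`x = r / s`. -/
def hardyWeight (α β γ x : ℝ) : ℝ := α * x ^ 2 + β * x + γ

/-- The coefficient of `f² / r²` in the divergence of the current. -/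
def massCoeff (m p α β γ x : ℝ) : ℝ :=
  (2 - p + 2 * m * x) * hardyWeight α β γ x - x * (1 - x) * (2 * α * x + β)

/-- The `u`-component `w r^p ∫ |∂_v f|²` of the current, with `w = (c s)^(-2m)`. -/
noncomputable def currentU (c m p : ℝ) (P : ℝ × ℝ → ℝ) (z : ℝ × ℝ) : ℝ :=
  (c * z.1) ^ (-(2 * m)) * z.2 ^ p * P z

/-- The `v`-component `w r^(p-2) ∫ (|∇̊ f|² + H(r/s) f²)` of the current. -/
noncomputable def currentV (c m p α β γ : ℝ) (N M : ℝ × ℝ → ℝ) (z : ℝ × ℝ) : ℝ :=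
  (c * z.1) ^ (-(2 * m)) * z.2 ^ (p - 2) * (N z + hardyWeight α β γ (z.2 / z.1) * M z)

section
variable {c m p α β γ κ : ℝ} {P N M Y : ℝ × ℝ → ℝ}

theorem contDiffOn_weight (hc : 0 < c) (m p : ℝ) :
    ContDiffOn ℝ 1 (fun z : ℝ × ℝ => (c * z.1) ^ (-(2 * m)) * z.2 ^ p) quadrant := by
  intro z hz
  have h1 : c * z.1 ≠ 0 := (mul_pos hc hz.1).ne'
  have h2 : z.2 ≠ 0 := ne_of_gt hz.2
  exact (((contDiffAt_const.mul contDiffAt_fst).rpow_const_of_ne h1).mul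
    (contDiffAt_snd.rpow_const_of_ne h2)).contDiffWithinAt

theorem contDiffOn_currentU (hc : 0 < c) (hP : ContDiff ℝ 1 P) :
    ContDiffOn ℝ 1 (currentU c m p P) quadrant :=
  (contDiffOn_weight hc m p).mul hP.contDiffOn

theorem contDiffOn_currentV (hc : 0 < c) (hN : ContDiff ℝ 1 N) (hM : ContDiff ℝ 1 M) :
    ContDiffOn ℝ 1 (currentV c m p α β γ N M) quadrant := by
  have hx : ContDiffOn ℝ 1 (fun z : ℝ × ℝ => z.2 / z.1) quadrant :=
    contDiff_snd.contDiffOn.div contDiff_fst.contDiffOn fun z hz => ne_of_gt hz.1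
  have hH : ContDiffOn ℝ 1 (fun z : ℝ × ℝ => hardyWeight α β γ (z.2 / z.1)) quadrant :=
    ((contDiffOn_const.mul (hx.pow 2)).add (contDiffOn_const.mul hx)).add contDiffOn_const
  exact (contDiffOn_weight hc m _).mul (hN.contDiffOn.add (hH.mul hM.contDiffOn))

theorem hasDerivAt_weight (hc : 0 < c) (m p : ℝ) {s r : ℝ} (hs : 0 < s) (hr : 0 < r) (σ : ℝ) :
    HasDerivAt (fun h : ℝ => (c * (s + h)) ^ (-(2 * m)) * (r + σ * h) ^ p)
      ((c * s) ^ (-(2 * m)) * r ^ p * (-(2 * m) / s + σ * p / r)) 0 := by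
  have h1 : HasDerivAt (fun h : ℝ => c * (s + h)) c 0 := by
    simpa using ((hasDerivAt_id (0 : ℝ)).const_add s).const_mul c
  have h2 : HasDerivAt (fun h : ℝ => r + σ * h) σ 0 := by
    simpa using ((hasDerivAt_id (0 : ℝ)).const_mul σ).const_add r
  have h3 := h1.rpow_const (p := -(2 * m)) (Or.inl (by simpa using ⟨hc.ne', hs.ne'⟩))
  have h4 := h2.rpow_const (p := p) (Or.inl (by simpa using hr.ne'))
  refine (h3.mul h4).congr_deriv ?_
  simp only [add_zero, mul_zero]
  rw [Real.rpow_sub_one (mul_pos hc hs).ne', Real.rpow_sub_one hr.ne']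
  field_simp

theorem hasDerivAt_line {F : ℝ × ℝ → ℝ} {z : ℝ × ℝ} (hF : DifferentiableAt ℝ F z) (σ : ℝ) :
    HasDerivAt (fun h : ℝ => F (z.1 + h, z.2 + σ * h)) (fderiv ℝ F z (1, σ)) 0 := by
  have h1 : HasDerivAt (fun h : ℝ => (z.1 + h, z.2 + σ * h)) ((1 : ℝ), σ) 0 := by
    refine HasDerivAt.prodMk ?_ ?_
    · simpa using (hasDerivAt_id (0 : ℝ)).const_add z.1
    · simpa using ((hasDerivAt_id (0 : ℝ)).const_mul σ).const_add z.2
  have h2 : HasFDerivAt F (fderiv ℝ F z) (z.1 + 0, z.2 + σ * 0) := by simpa using hF.hasFDerivAt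
  exact h2.comp_hasDerivAt 0 h1

/-- The divergence of the weighted current. The term `N` of the two components cancels, by
`hrel`, the integrated wave equation. -/
theorem nullDiv_current (hc : 0 < c) (hP : ContDiff ℝ 1 P) (hN : ContDiff ℝ 1 N)
    (hM : ContDiff ℝ 1 M) {z : ℝ × ℝ} (hz : z ∈ quadrant)
    (hrel : z.2 ^ 2 * fderiv ℝ P z (1, -1) + fderiv ℝ N z (1, 1)
      = κ * (z.2 / z.1) ^ 2 * fderiv ℝ M z (1, 1))
    (hY : fderiv ℝ M z (1, 1) = 2 * Y z) :
    nullDiv (currentU c m p P) (currentV c m p α β γ N M) z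
      = -((c * z.1) ^ (-(2 * m)) * z.2 ^ (p - 1) *
        ((p + 2 * m * (z.2 / z.1)) * P z
          - 2 * (hardyWeight α β γ (z.2 / z.1) + κ * (z.2 / z.1) ^ 2) * (Y z / z.2)
          + massCoeff m p α β γ (z.2 / z.1) * (M z / z.2 ^ 2)
          + (2 - p + 2 * m * (z.2 / z.1)) * (N z / z.2 ^ 2))) := by
  obtain ⟨s, r⟩ := z
  have hs : 0 < s := hz.1
  have hr : 0 < r := hz.2
  have dP := hasDerivAt_line (hP.differentiable one_ne_zero (s, r)) (-1)
  have dN := hasDerivAt_line (hN.differentiable one_ne_zero (s, r)) 1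
  have dM := hasDerivAt_line (hM.differentiable one_ne_zero (s, r)) 1
  have eA : fderiv ℝ (currentU c m p P) (s, r) (1, -1) = (c * s) ^ (-(2 * m)) * r ^ p *
      ((-(2 * m) / s - p / r) * P (s, r) + fderiv ℝ P (s, r) (1, -1)) := by
    have hA := hasDerivAt_line (((contDiffOn_currentU (m := m) (p := p) hc hP).contDiffAt
      (isOpen_quadrant.mem_nhds hz)).differentiableAt one_ne_zero) (-1)
    refine hA.unique (((hasDerivAt_weight hc m p hs hr (-1)).mul dP).congr_deriv ?_)
    simp only [add_zero, mul_zero]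
    ring
  have dx : HasDerivAt (fun h : ℝ => (r + 1 * h) / (s + h)) (1 / s - r / s ^ 2) 0 := by
    have h1 : HasDerivAt (fun h : ℝ => s + h) 1 0 := by
      simpa using (hasDerivAt_id (0 : ℝ)).const_add s
    have h2 : HasDerivAt (fun h : ℝ => r + 1 * h) 1 0 := by
      simpa using (hasDerivAt_id (0 : ℝ)).const_add r
    refine (h2.div h1 (by simpa using hs.ne')).congr_deriv ?_
    simp only [add_zero, mul_zero]
    field_simp
  have dH : HasDerivAt (fun h : ℝ => hardyWeight α β γ ((r + 1 * h) / (s + h)))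
      ((2 * α * (r / s) + β) * (1 / s - r / s ^ 2)) 0 := by
    refine ((((dx.pow 2).const_mul α).add (dx.const_mul β)).add_const γ).congr_deriv ?_
    simp only [add_zero, mul_zero]
    ring
  have eB : fderiv ℝ (currentV c m p α β γ N M) (s, r) (1, 1) =
      (c * s) ^ (-(2 * m)) * r ^ (p - 2) *
      ((-(2 * m) / s + (p - 2) / r) * (N (s, r) + hardyWeight α β γ (r / s) * M (s, r))
        + fderiv ℝ N (s, r) (1, 1)
        + (2 * α * (r / s) + β) * (1 / s - r / s ^ 2) * M (s, r)
        + hardyWeight α β γ (r / s) * fderiv ℝ M (s, r) (1, 1)) := by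
    have hB := hasDerivAt_line (((contDiffOn_currentV (m := m) (p := p) (α := α) (β := β)
      (γ := γ) hc hN hM).contDiffAt (isOpen_quadrant.mem_nhds hz)).differentiableAt one_ne_zero) 1
    refine hB.unique (((hasDerivAt_weight hc m (p - 2) hs hr 1).mul
      (dN.add (dH.mul dM))).congr_deriv ?_)
    simp only [add_zero, mul_zero, Pi.add_apply, Pi.mul_apply]
    ring
  simp only at hrel hY
  have hN' : fderiv ℝ N (s, r) (1, 1)
      = κ * (r / s) ^ 2 * (2 * Y (s, r)) - r ^ 2 * fderiv ℝ P (s, r) (1, -1) := by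
    rw [← hY]; linarith
  have e1 : r ^ p = r ^ (p - 1) * r := by rw [Real.rpow_sub_one hr.ne']; field_simp
  have e2 : r ^ (p - 2) = r ^ (p - 1) / r := by
    rw [show p - 2 = p - 1 - 1 by ring, Real.rpow_sub_one hr.ne']
  simp only [nullDiv, eA, eB, hN', hY, e1, e2, massCoeff]
  field_simp
  ring

end

/-! ### Coercivity of the divergence -/

/-- The part of the divergence that is quadratic in `a = ∂_v f` and `b = f / r` dominates
`c₀ a² + c₁ b²` for `0 ≤ r / s ≤ X`. -/
def Coercive (m κ p α β γ X c₀ c₁ : ℝ) : Prop :=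
  ∀ x ∈ Icc 0 X, ∀ a b : ℝ, c₀ * a ^ 2 + c₁ * b ^ 2 ≤
    (p + 2 * m * x) * a ^ 2 - 2 * (hardyWeight α β γ x + κ * x ^ 2) * (a * b)
      + massCoeff m p α β γ x * b ^ 2

/-- Positivity of the discriminant makes the divergence coercive, by compactness. -/
theorem exists_coercive {m κ p α β γ X : ℝ} (hm : 0 ≤ m) (hp : 0 < p) (hX : 0 ≤ X)
    (hdet : ∀ x, 0 ≤ x → (hardyWeight α β γ x + κ * x ^ 2) ^ 2
      < (p + 2 * m * x) * massCoeff m p α β γ x) :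
    ∃ c₀ > 0, Coercive m κ p α β γ X c₀ c₀ := by
  set D : ℝ → ℝ := fun x => (p + 2 * m * x) * massCoeff m p α β γ x
    - (hardyWeight α β γ x + κ * x ^ 2) ^ 2 with hD
  set T : ℝ → ℝ := fun x => p + 2 * m * x + massCoeff m p α β γ x with hT
  have hfirst (x : ℝ) (hx : 0 ≤ x) : 0 < p + 2 * m * x := by positivity
  have hsecond (x : ℝ) (hx : 0 ≤ x) : 0 < massCoeff m p α β γ x :=
    pos_of_mul_pos_right ((sq_nonneg _).trans_lt (hdet x hx)) (hfirst x hx).le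
  have hTpos (x : ℝ) (hx : 0 ≤ x) : 0 < T x := add_pos (hfirst x hx) (hsecond x hx)
  have hcont : ContinuousOn (fun x => D x / T x) (Icc 0 X) := by
    refine ContinuousOn.div ?_ ?_ fun x hx => (hTpos x hx.1).ne'
    · simp only [hD, massCoeff, hardyWeight]; fun_prop
    · simp only [hT, massCoeff, hardyWeight]; fun_prop
  obtain ⟨x₀, hx₀, hmin⟩ := isCompact_Icc.exists_isMinOn (nonempty_Icc.2 hX) hcont
  have hDpos (x : ℝ) (hx : 0 ≤ x) : 0 < D x := sub_pos.2 (hdet x hx)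
  refine ⟨D x₀ / T x₀, div_pos (hDpos _ hx₀.1) (hTpos _ hx₀.1), fun x hx a b => ?_⟩
  set e := D x₀ / T x₀
  have he : 0 < e := div_pos (hDpos _ hx₀.1) (hTpos _ hx₀.1)
  have hle : e * T x ≤ D x := (le_div_iff₀ (hTpos x hx.1)).1 (hmin hx)
  have h1 := hfirst x hx.1
  have h2 := hsecond x hx.1
  simp only [hD, hT] at hle
  set p' := p + 2 * m * x
  set R := massCoeff m p α β γ x
  set n := hardyWeight α β γ x + κ * x ^ 2
  have h3 : 0 < p' - e := by
    by_contra! h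
    nlinarith [mul_le_mul_of_nonneg_right h h2.le, mul_pos he h1, sq_nonneg n]
  have h4 : n ^ 2 ≤ (p' - e) * (R - e) := by nlinarith [sq_nonneg e]
  have h5 : 0 ≤ (p' - e) * ((p' - e) * a ^ 2 - 2 * n * (a * b) + (R - e) * b ^ 2) := by
    have : (p' - e) * ((p' - e) * a ^ 2 - 2 * n * (a * b) + (R - e) * b ^ 2)
        = ((p' - e) * a - n * b) ^ 2 + ((p' - e) * (R - e) - n ^ 2) * b ^ 2 := by ring
    rw [this]
    have := mul_nonneg (sub_nonneg.2 h4) (sq_nonneg b)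
    positivity
  have h6 := nonneg_of_mul_nonneg_right h5 h3
  linarith

/-- For `q ≤ 1/2` the potential is repulsive, `κ = -l ≤ 0`, and no time weight is needed.
The discriminant is quadratic in the constant term of the weight, with maximum at `p (2 - p) / 2`. -/
theorem exists_coercive_of_nonpos {l p X : ℝ} (hl : 0 ≤ l) (hp : 0 < p) (hp2 : p < 2)
    (hX : 0 ≤ X) (hlp : 4 * l < (2 - p) ^ 2) :
    ∃ c₀ > 0, Coercive 0 (-l) p l 0 (p * (2 - p) / 2) X c₀ c₀ := by
  refine exists_coercive le_rfl hp hX fun x hx => ?_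
  simp only [hardyWeight, massCoeff]
  have hx3 : x ^ 2 * (p - 2 * x) ≤ p := by
    rcases le_total x 1 with h | h
    · nlinarith [mul_nonneg hx hx, mul_nonneg (mul_nonneg hx hx) hx, mul_le_one₀ h hx h]
    · nlinarith [mul_nonneg hx hx]
  nlinarith [mul_le_mul_of_nonneg_left hx3 (mul_nonneg hp.le hl),
    mul_lt_mul_of_pos_left hlp (mul_pos hp hp)]

/-- For `q > 1/2` and `1 ≤ p`, with `κ = m (m + 1)`. The weight `H = κ x²` alone makes the
discriminant vanish to leading order; the constant compensates the loss for small `x`. -/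
theorem exists_coercive_of_one_le {m p X : ℝ} (hm : 0 < m) (hp : 1 ≤ p) (hp2 : p < 2)
    (hX : 0 ≤ X) (hlp : 4 * (m * (m + 1)) < (2 - p) ^ 2) :
    ∃ c₀ > 0, Coercive m (m * (m + 1)) p (m * (m + 1)) 0 (p * (2 - p) / 2) X c₀ c₀ := by
  have hp0 : 0 < p := by linarith
  refine exists_coercive hm.le hp0 hX fun x hx => ?_
  simp only [hardyWeight, massCoeff]
  -- the difference of the two sides, with `η` the constant term of the weight
  have key : 0 < m * (m + 1) * p * x ^ 2 * (2 * x - p)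
      + p * (2 - p) / 2 * (p * (2 - p) / 2 + 4 * m * x * (1 - x)) := by
    have hκ : 0 < m * (m + 1) := by positivity
    rcases le_total x 1 with h | h
    · have h1 : x ^ 2 * (p - 2 * x) ≤ p := by
        nlinarith [mul_nonneg hx hx, mul_nonneg (mul_nonneg hx hx) hx, mul_le_one₀ h hx h]
      have h2 : 0 ≤ p * (2 - p) / 2 * (4 * m * x * (1 - x)) := by
        have : 0 ≤ 2 - p := by linarith
        have : 0 ≤ 1 - x := by linarith
        positivity
      nlinarith [mul_le_mul_of_nonneg_left h1 (mul_nonneg hp0.le hκ.le),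
        mul_lt_mul_of_pos_left hlp (mul_pos hp0 hp0)]
    · have h1 : 0 < p * (2 - p) / 2 * (p * (2 - p) / 2) := by
        have : 0 < 2 - p := by linarith
        positivity
      have h2 : 0 ≤ m * p * x * (x - 1) * ((m + 1) * x * 2 - 2 * (2 - p)) := by
        refine mul_nonneg (mul_nonneg (by positivity) (by linarith)) ?_
        nlinarith [mul_nonneg hm.le hx]
      have h3 : 0 ≤ m * (m + 1) * p * x ^ 2 * (2 - p) := by
        have : 0 ≤ 2 - p := by linarith
        positivity
      nlinarith
  nlinarith

/-- For `q > 1/2` and `p < 1`, with `κ = m (m + 1)` of any size: the weight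
`H = κ x² + m p x + η` with small `η > 0` works. -/
theorem exists_coercive_of_lt_one {m p X : ℝ} (hm : 0 < m) (hp : 0 < p) (hp1 : p < 1)
    (hX : 0 ≤ X) :
    ∃ γ > 0, ∃ c₀ > 0, Coercive m (m * (m + 1)) p (m * (m + 1)) (m * p) γ X c₀ c₀ := by
  set η := min (p / 2) (m * p * (1 - p) / 2) with hη
  have h1p : 0 < 1 - p := by linarith
  have hpos : 0 < η := lt_min (by positivity) (by positivity)
  have hη1 : η ≤ p / 2 := min_le_left _ _
  have hη2 : η ≤ m * p * (1 - p) / 2 := min_le_right _ _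
  refine ⟨η, hpos, exists_coercive hm.le hp hX fun x hx => ?_⟩
  simp only [hardyWeight, massCoeff]
  have e1 : 0 ≤ m * p ^ 2 * (1 - p) * x := by positivity
  have e2 : 0 ≤ m * p * x ^ 3 := by positivity
  have e3 : 0 < η * (p * (2 - p) - η) := mul_pos hpos (by nlinarith)
  have e4 : 0 ≤ η * m * x * (4 - 2 * p) :=
    mul_nonneg (by positivity) (by linarith)
  have e5 : 4 * m * η * x ^ 2 ≤ 2 * m ^ 2 * p * (1 - p) * x ^ 2 := by
    have := mul_le_mul_of_nonneg_left hη2 (by positivity : 0 ≤ 4 * m * x ^ 2)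
    linarith
  nlinarith

/-- At the endpoint `q = 1/2`, `p = 2` the potential vanishes. -/
theorem coercive_endpoint (X : ℝ) : Coercive 0 0 2 0 0 0 X 2 0 := by
  intro x _ a b
  simp [hardyWeight, massCoeff]

/-! ### The weighted estimate for solutions in spherical coordinates -/

/-- The part `r > 0`, `s ≥ 2 τ₀`, `s - r ≥ 2 τ₀ - ρ` of the `(s, r)` plane, which is the future of the
initial leaf. -/
def polarFuture (ρ τ₀ : ℝ) : Set (ℝ × ℝ) :=
  {z | 0 < z.2 ∧ 2 * τ₀ ≤ z.1 ∧ 2 * τ₀ - ρ + z.2 ≤ z.1}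

/-- `g` is smooth and `f = r g` solves the wave equation `∂_u ∂_v f = r⁻² Δ̊ f + κ s⁻² f`, where
`Δ̊` is the sum of the squares of the rotation fields. -/
structure IsPolarSolution (κ ρ τ₀ : ℝ) (g f : Polar → ℝ) : Prop where
  smooth : ContDiff ℝ ∞ g
  eq_mul : ∀ p, f p = p.1.2 * g p
  wave : ∀ z ∈ polarFuture ρ τ₀, ∀ θ : Sphere,
    z.2 ^ 2 * along (1, -1) (along (1, 1) f) (z, θ)
      = ∑ i, rotDeriv i (rotDeriv i f) (z, θ) + κ * (z.2 / z.1) ^ 2 * f (z, θ)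

/-- The density of the weighted bulk integral, integrated over the sphere. -/
noncomputable def bulkDensity (c m p c₀ c₁ : ℝ) (f : Polar → ℝ) (z : ℝ × ℝ) : ℝ :=
  (c * z.1) ^ (-(2 * m)) * z.2 ^ (p - 1) * (c₀ * outgoingSq f z + c₁ * (massInt f z / z.2 ^ 2)
    + (2 - p) * (angularInt f z / z.2 ^ 2))

theorem polarFuture_subset {ρ τ₀ : ℝ} (hτ₀ : 0 < τ₀) : polarFuture ρ τ₀ ⊆ quadrant :=
  fun _ hz => ⟨mem_Ioi.2 (by linarith [hz.2.1]), hz.1⟩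

theorem div_mem_of_mem_polarFuture {ρ τ₀ : ℝ} (hρ : 0 < ρ) (hτ₀ : 0 < τ₀) {z : ℝ × ℝ}
    (hz : z ∈ polarFuture ρ τ₀) : z.2 / z.1 ∈ Icc 0 (1 + ρ / (2 * τ₀)) := by
  obtain ⟨h1, h2, h3⟩ := hz
  have hs : 0 < z.1 := by linarith
  refine ⟨by positivity, ?_⟩
  rw [div_le_iff₀ hs]
  have h4 : ρ ≤ ρ / (2 * τ₀) * z.1 := by
    rw [div_mul_eq_mul_div, le_div_iff₀ (by positivity)]
    exact mul_le_mul_of_nonneg_left h2 hρ.le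
  linarith

section
variable {c m p α β γ κ ρ τ₀ c₀ c₁ : ℝ} {g f : Polar → ℝ}

theorem sphereInt_nonneg {G : Polar → ℝ} (hG : ∀ p, 0 ≤ G p) (z : ℝ × ℝ) : 0 ≤ sphereInt G z :=
  integral_nonneg fun _ => hG _

theorem outgoingSq_nonneg (f : Polar → ℝ) (z : ℝ × ℝ) : 0 ≤ outgoingSq f z :=
  sphereInt_nonneg (fun _ => mul_self_nonneg _) z

theorem angularInt_nonneg (f : Polar → ℝ) (z : ℝ × ℝ) : 0 ≤ angularInt f z :=
  sphereInt_nonneg (fun _ => Finset.sum_nonneg fun _ _ => mul_self_nonneg _) z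

theorem massInt_nonneg (f : Polar → ℝ) (z : ℝ × ℝ) : 0 ≤ massInt f z :=
  sphereInt_nonneg (fun _ => mul_self_nonneg _) z

theorem contDiff_outgoingSq (hf : ContDiff ℝ ∞ f) : ContDiff ℝ 1 (outgoingSq f) :=
  contDiff_sphereInt (((hf.along _).mul (hf.along _)).of_le (by exact_mod_cast le_top))

theorem contDiff_angularInt (hf : ContDiff ℝ ∞ f) : ContDiff ℝ 1 (angularInt f) :=
  contDiff_sphereInt ((ContDiff.sum fun i _ => (hf.rotDeriv i).mul (hf.rotDeriv i)).of_le
    (by exact_mod_cast le_top))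

theorem contDiff_massInt (hf : ContDiff ℝ ∞ f) : ContDiff ℝ 1 (massInt f) :=
  contDiff_sphereInt ((hf.mul hf).of_le (by exact_mod_cast le_top))

theorem contDiff_radial : ContDiff ℝ ∞ fun p : Polar => p.1.2 := contDiff_snd.comp contDiff_fst

theorem IsPolarSolution.contDiff (h : IsPolarSolution κ ρ τ₀ g f) : ContDiff ℝ ∞ f := by
  have : f = fun p => p.1.2 * g p := funext h.eq_mul
  rw [this]
  exact contDiff_radial.mul h.smooth

theorem IsPolarSolution.massInt_eq (h : IsPolarSolution κ ρ τ₀ g f) (z : ℝ × ℝ) :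
    massInt f z = z.2 ^ 2 * massInt g z := by
  simp only [massInt, sphereInt, ← integral_const_mul, h.eq_mul]
  congr 1
  funext θ
  ring

theorem IsPolarSolution.angularInt_eq (h : IsPolarSolution κ ρ τ₀ g f) (z : ℝ × ℝ) :
    angularInt f z = z.2 ^ 2 * angularInt g z := by
  have hR (i : Fin 3) (p : Polar) : rotDeriv i f p = p.1.2 * rotDeriv i g p := by
    have : f = fun p => p.1.2 * g p := funext h.eq_mul
    rw [this, rotDeriv_mul contDiff_radial h.smooth]
    have : rotDeriv i (fun p : Polar => p.1.2) p = 0 := by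
      have h1 : HasFDerivAt (fun p : Polar => p.1.2) ((ContinuousLinearMap.snd ℝ ℝ ℝ).comp
        (ContinuousLinearMap.fst ℝ (ℝ × ℝ) Space)) p :=
        hasFDerivAt_snd.comp p hasFDerivAt_fst
      simp [rotDeriv, h1.fderiv]
    rw [this, zero_mul, add_zero]
  simp only [angularInt, sphereInt, ← integral_const_mul, hR, Finset.mul_sum]
  congr 1
  funext θ
  refine Finset.sum_congr rfl fun i _ => ?_
  ring

theorem crossInt_form (hf : ContDiff ℝ ∞ f) (a b d : ℝ) (z : ℝ × ℝ) :
    sphereInt (fun p => a * (along (1, 1) f p * along (1, 1) f p)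
      + (b * (f p * along (1, 1) f p) + d * (f p * f p))) z
      = a * outgoingSq f z + (b * crossInt f z + d * massInt f z) := by
  have hv := (hf.along (1, 1)).continuous
  have hc := hf.continuous
  rw [sphereInt_add (by fun_prop) (by fun_prop), sphereInt_add (by fun_prop) (by fun_prop),
    sphereInt_const_mul, sphereInt_const_mul, sphereInt_const_mul]
  rfl

theorem continuousOn_bulkDensity (hc : 0 < c) (hf : ContDiff ℝ ∞ f) :
    ContinuousOn (bulkDensity c m p c₀ c₁ f) quadrant := by
  have h1 := (contDiff_outgoingSq hf).continuous.continuousOn (s := quadrant)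
  have h2 := (contDiff_massInt hf).continuous.continuousOn (s := quadrant)
  have h3 := (contDiff_angularInt hf).continuous.continuousOn (s := quadrant)
  have h4 : ContinuousOn (fun z : ℝ × ℝ => z.2 ^ 2) quadrant := by fun_prop
  have h5 : ∀ z ∈ quadrant, z.2 ^ 2 ≠ 0 := fun z hz => pow_ne_zero 2 (ne_of_gt hz.2)
  exact (contDiffOn_weight hc m (p - 1)).continuousOn.mul
    (((continuousOn_const.mul h1).add (continuousOn_const.mul (h2.div h4 h5))).add
      (continuousOn_const.mul (h3.div h4 h5)))

theorem bulkDensity_nonneg (hc : 0 < c) (hp2 : p ≤ 2) (h₀ : 0 ≤ c₀) (h₁ : 0 ≤ c₁)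
    {z : ℝ × ℝ} (hz : z ∈ quadrant) : 0 ≤ bulkDensity c m p c₀ c₁ f z := by
  have h1 := outgoingSq_nonneg f z
  have h2 := massInt_nonneg f z
  have h3 := angularInt_nonneg f z
  have h4 : 0 < z.1 := hz.1
  have h5 : 0 < z.2 := hz.2
  have h6 : 0 ≤ 2 - p := by linarith
  unfold bulkDensity
  positivity

theorem currentU_nonneg (hc : 0 < c) {z : ℝ × ℝ} (hz : z ∈ quadrant) :
    0 ≤ currentU c m p (outgoingSq f) z := by
  have h1 := outgoingSq_nonneg f z
  have h4 : 0 < z.1 := hz.1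
  have h5 : 0 < z.2 := hz.2
  unfold currentU
  positivity

theorem currentV_nonneg (hc : 0 < c) (hα : 0 ≤ α) (hβ : 0 ≤ β) (hγ : 0 ≤ γ) {z : ℝ × ℝ}
    (hz : z ∈ quadrant) : 0 ≤ currentV c m p α β γ (angularInt f) (massInt f) z := by
  have h2 := massInt_nonneg f z
  have h3 := angularInt_nonneg f z
  have h4 : 0 < z.1 := hz.1
  have h5 : 0 < z.2 := hz.2
  unfold currentV hardyWeight
  positivity

/-- The divergence of the current controls the bulk density from above (with a sign). -/
theorem IsPolarSolution.nullDiv_le (h : IsPolarSolution κ ρ τ₀ g f) (hc : 0 < c) (hm : 0 ≤ m)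
    (hρ : 0 < ρ) (hτ₀ : 0 < τ₀)
    (hco : Coercive m κ p α β γ (1 + ρ / (2 * τ₀)) c₀ c₁) {z : ℝ × ℝ}
    (hz : z ∈ polarFuture ρ τ₀) :
    nullDiv (currentU c m p (outgoingSq f)) (currentV c m p α β γ (angularInt f) (massInt f)) z
      ≤ -bulkDensity c m p c₀ c₁ f z := by
  have hf := h.contDiff
  have hzq := polarFuture_subset hτ₀ hz
  rw [nullDiv_current hc (contDiff_outgoingSq hf) (contDiff_angularInt hf) (contDiff_massInt hf) hzq
    (fderiv_outgoingSq_add_fderiv_angularInt hf z _ _ (h.wave z hz)) (fderiv_massInt hf z),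
    bulkDensity, neg_le_neg_iff]
  have hs : 0 < z.1 := hzq.1
  have hr : 0 < z.2 := hzq.2
  refine mul_le_mul_of_nonneg_left ?_ (by positivity)
  set x := z.2 / z.1
  have hx := div_mem_of_mem_polarFuture hρ hτ₀ hz
  have key : 0 ≤ sphereInt (fun q => (p + 2 * m * x - c₀) * (along (1, 1) f q * along (1, 1) f q)
      + ((-2 * (hardyWeight α β γ x + κ * x ^ 2) / z.2) * (f q * along (1, 1) f q)
        + ((massCoeff m p α β γ x - c₁) / z.2 ^ 2) * (f q * f q))) z := by
    refine sphereInt_nonneg (fun q => ?_) z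
    have := hco x hx (along (1, 1) f q) (f q / z.2)
    have e : (p + 2 * m * x - c₀) * (along (1, 1) f q * along (1, 1) f q)
      + ((-2 * (hardyWeight α β γ x + κ * x ^ 2) / z.2) * (f q * along (1, 1) f q)
        + ((massCoeff m p α β γ x - c₁) / z.2 ^ 2) * (f q * f q))
      = (p + 2 * m * x) * along (1, 1) f q ^ 2
        - 2 * (hardyWeight α β γ x + κ * x ^ 2) * (along (1, 1) f q * (f q / z.2))
        + massCoeff m p α β γ x * (f q / z.2) ^ 2
        - (c₀ * along (1, 1) f q ^ 2 + c₁ * (f q / z.2) ^ 2) := by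
      ring
    linarith
  rw [crossInt_form hf] at key
  have hang : 0 ≤ 2 * m * x * (angularInt f z / z.2 ^ 2) := by
    have := angularInt_nonneg f z
    have := hx.1
    positivity
  have e : (p + 2 * m * x - c₀) * outgoingSq f z
      + ((-2 * (hardyWeight α β γ x + κ * x ^ 2) / z.2) * crossInt f z
        + ((massCoeff m p α β γ x - c₁) / z.2 ^ 2) * massInt f z)
      = (p + 2 * m * x) * outgoingSq f z
        - 2 * (hardyWeight α β γ x + κ * x ^ 2) * (crossInt f z / z.2)
        + massCoeff m p α β γ x * (massInt f z / z.2 ^ 2)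
        - (c₀ * outgoingSq f z + c₁ * (massInt f z / z.2 ^ 2)) := by ring
  linarith

/-- Iterated integrals over the trapezoid `u₁ ≤ u ≤ u₂`, `u + ρ ≤ v ≤ V` of continuous functions
exist. -/
theorem intervalIntegrable_trapezoid {F : ℝ × ℝ → ℝ} (hF : ContinuousOn F quadrant)
    {u₁ u₂ ρ V : ℝ} (hρ : 0 < ρ) (hu : u₁ ≤ u₂) (hu₁ : 0 < 2 * u₁ + ρ) (hV : u₂ + ρ ≤ V) :
    IntervalIntegrable (fun u => ∫ v in (u + ρ)..V, F (u + v, v - u)) volume u₁ u₂ := by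
  have hcont : ContinuousOn (fun z : ℝ × ℝ => (V - z.1 - ρ) *
      F (2 * z.1 + ρ + (V - z.1 - ρ) * z.2, ρ + (V - z.1 - ρ) * z.2))
      (Icc u₁ u₂ ×ˢ Icc (0 : ℝ) 1) := by
    refine ContinuousOn.mul (by fun_prop) (hF.comp (by fun_prop) ?_)
    rintro ⟨a, b⟩ ⟨ha, hb⟩
    have : 0 ≤ (V - a - ρ) * b := mul_nonneg (by linarith [ha.2]) hb.1
    exact ⟨by show 0 < 2 * a + ρ + (V - a - ρ) * b; linarith [ha.1],
      by show 0 < ρ + (V - a - ρ) * b; linarith⟩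
  have hint := hcont.integrableOn_compact (μ := volume) (isCompact_Icc.prod isCompact_Icc)
  rw [IntegrableOn, Measure.volume_eq_prod, ← Measure.prod_restrict] at hint
  have h2 := hint.integral_prod_left
  rw [intervalIntegrable_iff_integrableOn_Icc_of_le hu]
  refine h2.congr (.of_forall fun u => ?_)
  have := intervalIntegral.mul_integral_comp_add_mul (a := 0) (b := 1)
    (f := fun v => F (u + v, v - u)) (V - u - ρ) (u + ρ)
  rw [show u + ρ + (V - u - ρ) * 0 = u + ρ by ring,
    show u + ρ + (V - u - ρ) * 1 = V by ring] at this
  simp only [← this, integral_const_mul]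
  rw [intervalIntegral.integral_of_le zero_le_one, integral_Icc_eq_integral_Ioc]
  congr 3
  funext l
  congr 2 <;> ring

theorem continuousOn_cone_slice {F : ℝ × ℝ → ℝ} (hF : ContinuousOn F quadrant) {u ρ V : ℝ}
    (hρ : 0 < ρ) (hu : 0 < 2 * u + ρ) :
    ContinuousOn (fun v => F (u + v, v - u)) (Icc (u + ρ) V) :=
  hF.comp (by fun_prop) fun v hv =>
    ⟨by show 0 < u + v; linarith [hv.1], by show 0 < v - u; linarith [hv.1]⟩

/-- Contribution of the near region `r ≤ ρ`: the flux through `r = ρ` is controlled by a bound `D`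
for the flux through the initial time slice. The flux through `r = ε` tends to `0` as `ε → 0`
since `f = r g` vanishes on the axis. -/
theorem IsPolarSolution.integral_timelike_le (h : IsPolarSolution κ ρ τ₀ g f) (hc : 0 < c)
    (hm : 0 ≤ m) (hρ : 0 < ρ) (hτ₀ : 0 < τ₀) (hp : 0 < p) (hp2 : p ≤ 2)
    (hα : 0 ≤ α) (hβ : 0 ≤ β) (hγ : 0 ≤ γ) (h₀ : 0 ≤ c₀) (h₁ : 0 ≤ c₁)
    (hco : Coercive m κ p α β γ (1 + ρ / (2 * τ₀)) c₀ c₁) {s₁ s₂ D : ℝ} (hs₁ : 2 * τ₀ ≤ s₁)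
    (hs : s₁ ≤ s₂)
    (hD : ∀ ε ∈ Ioc 0 ρ, ∫ r in ε..ρ, (currentU c m p (outgoingSq f) (s₁, r)
      + currentV c m p α β γ (angularInt f) (massInt f) (s₁, r)) ≤ D) :
    ∫ s in s₁..s₂, (currentV c m p α β γ (angularInt f) (massInt f) (s, ρ)
      - currentU c m p (outgoingSq f) (s, ρ)) ≤ D := by
  have hf := h.contDiff
  set A := currentU c m p (outgoingSq f) with hAdef
  set B := currentV c m p α β γ (angularInt f) (massInt f) with hBdef
  have hA : ContDiffOn ℝ 1 A quadrant := contDiffOn_currentU hc (contDiff_outgoingSq hf)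
  have hB : ContDiffOn ℝ 1 B quadrant :=
    contDiffOn_currentV hc (contDiff_angularInt hf) (contDiff_massInt hf)
  have hs₁0 : 0 < s₁ := by linarith
  -- after dividing by `ε ^ p`, the flux through `r = ε` is continuous up to the axis
  set b : ℝ × ℝ → ℝ := fun z => (c * z.1) ^ (-(2 * m)) *
    (angularInt g z + hardyWeight α β γ (z.2 / z.1) * massInt g z) with hb
  have hbc : ContinuousOn b (Icc s₁ s₂ ×ˢ Icc 0 ρ) := by
    have h1 := (contDiff_massInt h.smooth).continuous
    have h2 := (contDiff_angularInt h.smooth).continuous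
    have h3 : ∀ z ∈ Icc s₁ s₂ ×ˢ Icc 0 ρ, z.1 ≠ 0 := fun z hz => by
      have := hz.1.1
      linarith
    have h4 : ContinuousOn (fun z : ℝ × ℝ => z.2 / z.1) (Icc s₁ s₂ ×ˢ Icc 0 ρ) :=
      continuousOn_snd.div continuousOn_fst h3
    have h5 : ContinuousOn (fun z : ℝ × ℝ => (c * z.1) ^ (-(2 * m))) (Icc s₁ s₂ ×ˢ Icc 0 ρ) :=
      (continuousOn_const.mul continuousOn_fst).rpow_const
        fun z hz => Or.inl (mul_ne_zero hc.ne' (h3 z hz))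
    simp only [hb, hardyWeight]
    exact h5.mul (h2.continuousOn.add
      ((((continuousOn_const.mul (h4.pow 2)).add (continuousOn_const.mul h4)).add
        continuousOn_const).mul h1.continuousOn))
  obtain ⟨K, hK⟩ := (isCompact_Icc.prod isCompact_Icc).bddAbove_image hbc
  have hBb (s ε : ℝ) (hε : 0 < ε) : B (s, ε) = ε ^ p * b (s, ε) := by
    simp only [hBdef, hb, currentV, h.angularInt_eq, h.massInt_eq]
    rw [show p - 2 = p - (2 : ℕ) by norm_num, Real.rpow_sub_natCast hε.ne']
    field_simp
  have hmem (s r : ℝ) (hs' : s ∈ Icc s₁ s₂) (hr : 0 < r) (hrρ : r ≤ ρ) :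
      (s, r) ∈ polarFuture ρ τ₀ :=
    ⟨hr, hs₁.trans hs'.1, by show 2 * τ₀ - ρ + r ≤ s; linarith [hs'.1]⟩
  have hbound : ∀ ε ∈ Ioc 0 ρ, ∫ s in s₁..s₂, (B (s, ρ) - A (s, ρ))
      ≤ ε ^ p * ((s₂ - s₁) * K) + D := by
    intro ε hε
    have hdiv := integral_nullDiv_rectangle hA hB hs₁0 hs hε.1 hε.2
    have hneg : ∫ s in s₁..s₂, ∫ r in ε..ρ, nullDiv A B (s, r) ≤ 0 := by
      rw [← neg_nonneg, ← intervalIntegral.integral_neg]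
      refine intervalIntegral.integral_nonneg hs fun s hs' => ?_
      rw [← intervalIntegral.integral_neg]
      refine intervalIntegral.integral_nonneg hε.2 fun r hr => ?_
      have hz := hmem s r hs' (hε.1.trans_le hr.1) hr.2
      have := h.nullDiv_le hc hm hρ hτ₀ hco hz
      have := bulkDensity_nonneg (m := m) (f := f) hc hp2 h₀ h₁ (polarFuture_subset hτ₀ hz)
      linarith
    have hfin : 0 ≤ ∫ r in ε..ρ, (A (s₂, r) + B (s₂, r)) := by
      refine intervalIntegral.integral_nonneg hε.2 fun r hr => ?_
      have hz := polarFuture_subset hτ₀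
        (hmem s₂ r (right_mem_Icc.2 hs) (hε.1.trans_le hr.1) hr.2)
      exact add_nonneg (currentU_nonneg hc hz) (currentV_nonneg hc hα hβ hγ hz)
    have hslice : ∀ s ∈ Icc s₁ s₂, (s, ε) ∈ quadrant := fun s hs' =>
      polarFuture_subset hτ₀ (hmem s ε hs' hε.1 hε.2)
    have hi : IntervalIntegrable (fun s => B (s, ε) - A (s, ε)) volume s₁ s₂ := by
      refine ContinuousOn.intervalIntegrable ?_
      rw [uIcc_of_le hs]
      exact (hB.continuousOn.sub hA.continuousOn).comp
        (f := fun s : ℝ => (s, ε)) (by fun_prop) hslice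
    have haxis : ∫ s in s₁..s₂, (B (s, ε) - A (s, ε)) ≤ ε ^ p * ((s₂ - s₁) * K) := by
      have h1 := intervalIntegral.integral_mono_on hs hi
        (intervalIntegrable_const (c := ε ^ p * K)) (fun s hs' => by
          have hA0 := currentU_nonneg (m := m) (p := p) (f := f) hc (hslice s hs')
          have hb' : b (s, ε) ≤ K := hK ⟨(s, ε), ⟨hs', hε.1.le, hε.2⟩, rfl⟩
          have := mul_le_mul_of_nonneg_left hb' (Real.rpow_nonneg hε.1.le p)
          rw [hBb s ε hε.1]
          linarith)
      rw [intervalIntegral.integral_const, smul_eq_mul] at h1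
      linarith
    have := hD ε hε
    linarith
  have hlim : Tendsto (fun ε : ℝ => ε ^ p * ((s₂ - s₁) * K) + D) (nhdsWithin 0 (Ioi 0)) (nhds D) := by
    have h1 : Tendsto (fun ε : ℝ => ε ^ p) (nhdsWithin 0 (Ioi 0)) (nhds 0) := by
      have := (Real.continuousAt_rpow_const 0 p (Or.inr hp.le)).tendsto
      rw [Real.zero_rpow hp.ne'] at this
      exact this.mono_left nhdsWithin_le_nhds
    simpa using (h1.mul_const ((s₂ - s₁) * K)).add_const D
  exact ge_of_tendsto hlim (by
    filter_upwards [Ioc_mem_nhdsGT hρ] with ε hε using hbound ε hε)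

/-- The weighted estimate on the region `τ₁ ≤ τ ≤ τ₂`, `v ≤ V`. -/
theorem IsPolarSolution.truncated_estimate (h : IsPolarSolution κ ρ τ₀ g f) (hc : 0 < c)
    (hm : 0 ≤ m) (hρ : 0 < ρ) (hτ₀ : 0 < τ₀) (hp : 0 < p) (hp2 : p ≤ 2)
    (hα : 0 ≤ α) (hβ : 0 ≤ β) (hγ : 0 ≤ γ) (h₀ : 0 ≤ c₀) (h₁ : 0 ≤ c₁)
    (hco : Coercive m κ p α β γ (1 + ρ / (2 * τ₀)) c₀ c₁) {τ₁ τ₂ D V : ℝ} (hτ₁ : τ₀ ≤ τ₁)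
    (hτ : τ₁ ≤ τ₂) (hV : τ₂ - ρ / 2 + ρ ≤ V)
    (hD : ∀ ε ∈ Ioc 0 ρ, ∫ r in ε..ρ, (currentU c m p (outgoingSq f) (2 * τ₁, r)
      + currentV c m p α β γ (angularInt f) (massInt f) (2 * τ₁, r)) ≤ D) :
    (∫ u in (τ₁ - ρ / 2)..(τ₂ - ρ / 2), ∫ v in (u + ρ)..V,
        bulkDensity c m p c₀ c₁ f (u + v, v - u))
      + (∫ v in (τ₂ - ρ / 2 + ρ)..V, currentU c m p (outgoingSq f)
          (τ₂ - ρ / 2 + v, v - (τ₂ - ρ / 2)))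
      + (∫ u in (τ₁ - ρ / 2)..(τ₂ - ρ / 2),
          currentV c m p α β γ (angularInt f) (massInt f) (u + V, V - u))
      ≤ (∫ v in (τ₁ - ρ / 2 + ρ)..V, currentU c m p (outgoingSq f)
          (τ₁ - ρ / 2 + v, v - (τ₁ - ρ / 2))) + D / 2 := by
  have hf := h.contDiff
  have htime := h.integral_timelike_le hc hm hρ hτ₀ hp hp2 hα hβ hγ h₀ h₁ hco
    (s₁ := 2 * τ₁) (s₂ := 2 * τ₂) (by linarith) (by linarith) hD
  set A := currentU c m p (outgoingSq f) with hAdef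
  set B := currentV c m p α β γ (angularInt f) (massInt f) with hBdef
  have hA : ContDiffOn ℝ 1 A quadrant := contDiffOn_currentU hc (contDiff_outgoingSq hf)
  have hB : ContDiffOn ℝ 1 B quadrant :=
    contDiffOn_currentV hc (contDiff_angularInt hf) (contDiff_massInt hf)
  set u₁ := τ₁ - ρ / 2 with hu₁
  set u₂ := τ₂ - ρ / 2 with hu₂
  have hu : u₁ ≤ u₂ := by linarith
  have hu₁0 : 0 < 2 * u₁ + ρ := by linarith
  have hdiv := integral_nullDiv_trapezoid hA hB hρ hu hu₁0 hV
  have hsubst : ∫ u in u₁..u₂, (B (2 * u + ρ, ρ) - A (2 * u + ρ, ρ))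
      = 2⁻¹ * ∫ s in (2 * τ₁)..(2 * τ₂), (B (s, ρ) - A (s, ρ)) := by
    have := intervalIntegral.mul_integral_comp_mul_add (a := u₁) (b := u₂)
      (f := fun s => B (s, ρ) - A (s, ρ)) 2 ρ
    rw [show 2 * u₁ + ρ = 2 * τ₁ by rw [hu₁]; ring, show 2 * u₂ + ρ = 2 * τ₂ by rw [hu₂]; ring]
      at this
    rw [← this]
    ring
  have hbulk : ∫ u in u₁..u₂, ∫ v in (u + ρ)..V, nullDiv A B (u + v, v - u)
      ≤ -∫ u in u₁..u₂, ∫ v in (u + ρ)..V, bulkDensity c m p c₀ c₁ f (u + v, v - u) := by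
    have hcd := continuousOn_nullDiv hA hB
    have hcb := continuousOn_bulkDensity (m := m) (p := p) (c₀ := c₀) (c₁ := c₁) hc hf
    rw [← intervalIntegral.integral_neg]
    refine intervalIntegral.integral_mono_on hu (intervalIntegrable_trapezoid hcd hρ hu hu₁0 hV)
      (intervalIntegrable_trapezoid hcb hρ hu hu₁0 hV).neg fun u huu => ?_
    have huV : u + ρ ≤ V := by linarith [huu.2]
    have hu0 : 0 < 2 * u + ρ := by linarith [huu.1]
    rw [← intervalIntegral.integral_neg]
    have hii {F : ℝ × ℝ → ℝ} (hF : ContinuousOn F quadrant) :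
        IntervalIntegrable (fun v => F (u + v, v - u)) volume (u + ρ) V := by
      refine ContinuousOn.intervalIntegrable ?_
      rw [uIcc_of_le huV]
      exact continuousOn_cone_slice hF hρ hu0
    refine intervalIntegral.integral_mono_on huV (hii hcd) (hii hcb).neg fun v hv => ?_
    refine h.nullDiv_le hc hm hρ hτ₀ hco ⟨?_, ?_, ?_⟩
    · show 0 < v - u
      linarith [hv.1]
    · show 2 * τ₀ ≤ u + v
      linarith [hv.1, huu.1]
    · show 2 * τ₀ - ρ + (v - u) ≤ u + v
      linarith [huu.1]
  rw [hsubst] at hdiv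
  linarith

end

/-! ### The wave equation in spherical coordinates -/

/-- The polar coordinate map `((s, r), y) ↦ (s, r y)`. -/
def polarMap (p : Polar) : ℝ × Space := (p.1.1, p.1.2 • p.2)

/-- The partial derivative `∂_s` on `ℝ × ℝ³`. -/
noncomputable def partialS (h : ℝ × Space → ℝ) (z : ℝ × Space) : ℝ := fderiv ℝ h z (1, 0)

/-- The Cartesian derivative `∂_i` on `ℝ × ℝ³`. -/
noncomputable def partialX (i : Fin 3) (h : ℝ × Space → ℝ) (z : ℝ × Space) : ℝ :=
  fderiv ℝ h z (0, EuclideanSpace.single i 1)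

section
variable {h : ℝ × Space → ℝ} {G H : Polar → ℝ}

theorem _root_.ContDiff.partialS (hh : ContDiff ℝ ∞ h) : ContDiff ℝ ∞ (partialS h) :=
  (hh.fderiv_right (m := ∞) (by simp)).clm_apply contDiff_const

theorem _root_.ContDiff.partialX (hh : ContDiff ℝ ∞ h) (i : Fin 3) : ContDiff ℝ ∞ (partialX i h) :=
  (hh.fderiv_right (m := ∞) (by simp)).clm_apply contDiff_const

theorem contDiff_polarMap : ContDiff ℝ ∞ polarMap := by
  unfold polarMap
  fun_prop

theorem fderiv_comm (hh : ContDiff ℝ ∞ h) (v w : ℝ × Space) (z : ℝ × Space) :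
    fderiv ℝ (fun z => fderiv ℝ h z v) z w = fderiv ℝ (fun z => fderiv ℝ h z w) z v := by
  have h2 : ContDiff ℝ ∞ (fderiv ℝ h) := hh.fderiv_right (m := ∞) (by simp)
  have hsymm : IsSymmSndFDerivAt ℝ h z := (hh.contDiffAt).isSymmSndFDerivAt (by
    simpa using (WithTop.coe_le_coe.2 le_top : ((2 : ℕ∞) : WithTop ℕ∞) ≤ ((⊤ : ℕ∞) : WithTop ℕ∞)))
  have e (v : ℝ × Space) := ((h2.differentiable (by simp) z).hasFDerivAt.clm_apply
    (hasFDerivAt_const v z)).fderiv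
  rw [e v, e w]
  simp [hsymm.eq w v]

theorem partialX_comm (hh : ContDiff ℝ ∞ h) (i k : Fin 3) (z : ℝ × Space) :
    partialX i (partialX k h) z = partialX k (partialX i h) z :=
  fderiv_comm hh _ _ z

theorem partialX_partialS (hh : ContDiff ℝ ∞ h) (i : Fin 3) (z : ℝ × Space) :
    partialX i (partialS h) z = partialS (partialX i h) z :=
  fderiv_comm hh _ _ z

theorem fderiv_apply_eq (z : ℝ × Space) (a : ℝ) (y : Space) :
    fderiv ℝ h z (a, y) = a * partialS h z
      + (y 0 * partialX 0 h z + y 1 * partialX 1 h z + y 2 * partialX 2 h z) := by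
  have hy : y = y 0 • EuclideanSpace.single 0 (1 : ℝ) + y 1 • EuclideanSpace.single 1 (1 : ℝ)
      + y 2 • EuclideanSpace.single 2 (1 : ℝ) := by
    ext k
    fin_cases k <;> simp
  have e : ((a, y) : ℝ × Space) = a • ((1 : ℝ), (0 : Space))
      + (y 0 • ((0 : ℝ), EuclideanSpace.single 0 (1 : ℝ))
        + y 1 • ((0 : ℝ), EuclideanSpace.single 1 (1 : ℝ))
        + y 2 • ((0 : ℝ), EuclideanSpace.single 2 (1 : ℝ))) := by
    refine Prod.ext ?_ ?_
    · simp
    · simpa using hy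
  rw [e]
  simp only [map_add, map_smul, smul_eq_mul, partialS, partialX]

theorem fderiv_comp_polarMap (hh : ContDiff ℝ ∞ h) (p : Polar) (w : ℝ × ℝ) (y : Space) :
    fderiv ℝ (fun p => h (polarMap p)) p (w, y)
      = fderiv ℝ h (polarMap p) (w.1, p.1.2 • y + w.2 • p.2) := by
  have h1 : HasFDerivAt (fun p : Polar => p.1.1) ((ContinuousLinearMap.fst ℝ ℝ ℝ).comp
      (ContinuousLinearMap.fst ℝ (ℝ × ℝ) Space)) p := hasFDerivAt_fst.comp p hasFDerivAt_fst
  have h2 : HasFDerivAt (fun p : Polar => p.1.2) ((ContinuousLinearMap.snd ℝ ℝ ℝ).comp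
      (ContinuousLinearMap.fst ℝ (ℝ × ℝ) Space)) p := hasFDerivAt_snd.comp p hasFDerivAt_fst
  have h3 : HasFDerivAt polarMap _ p := h1.prodMk (h2.smul hasFDerivAt_snd)
  have := ((hh.differentiable (by simp) _).hasFDerivAt.comp p h3).fderiv
  rw [show (fun p => h (polarMap p)) = h ∘ polarMap from rfl, this]
  simp

theorem along_comp_polarMap (hh : ContDiff ℝ ∞ h) (w : ℝ × ℝ) (p : Polar) :
    along w (fun p => h (polarMap p)) p = w.1 * partialS h (polarMap p)
      + w.2 * (p.2 0 * partialX 0 h (polarMap p) + p.2 1 * partialX 1 h (polarMap p)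
        + p.2 2 * partialX 2 h (polarMap p)) := by
  rw [along, fderiv_comp_polarMap hh, fderiv_apply_eq]
  simp
  ring

theorem rotDeriv_comp_polarMap (hh : ContDiff ℝ ∞ h) (i : Fin 3) (p : Polar) :
    rotDeriv i (fun p => h (polarMap p)) p = p.1.2 * (p.2 (i + 1) * partialX (i + 2) h (polarMap p)
      - p.2 (i + 2) * partialX (i + 1) h (polarMap p)) := by
  rw [rotDeriv, fderiv_comp_polarMap hh, fderiv_apply_eq]
  fin_cases i <;> simp [rot_apply] <;> ring

theorem along_add (hG : ContDiff ℝ ∞ G) (hH : ContDiff ℝ ∞ H) (w : ℝ × ℝ) (p : Polar) :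
    along w (fun p => G p + H p) p = along w G p + along w H p := by
  simp only [along]
  rw [fderiv_fun_add (hG.differentiable (by simp) p) (hH.differentiable (by simp) p)]
  simp

theorem rotDeriv_sub (hG : ContDiff ℝ ∞ G) (hH : ContDiff ℝ ∞ H) (i : Fin 3) (p : Polar) :
    rotDeriv i (fun p => G p - H p) p = rotDeriv i G p - rotDeriv i H p := by
  simp only [rotDeriv]
  rw [fderiv_fun_sub (hG.differentiable (by simp) p) (hH.differentiable (by simp) p)]
  simp

theorem hasFDerivAt_radial (p : Polar) : HasFDerivAt (fun p : Polar => p.1.2)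
    ((ContinuousLinearMap.snd ℝ ℝ ℝ).comp (ContinuousLinearMap.fst ℝ (ℝ × ℝ) Space)) p :=
  hasFDerivAt_snd.comp p hasFDerivAt_fst

theorem hasFDerivAt_coord (i : Fin 3) (p : Polar) : HasFDerivAt (fun p : Polar => p.2 i)
    ((EuclideanSpace.proj (𝕜 := ℝ) i).comp (ContinuousLinearMap.snd ℝ (ℝ × ℝ) Space)) p :=
  (EuclideanSpace.proj (𝕜 := ℝ) i : Space →L[ℝ] ℝ).hasFDerivAt.comp p hasFDerivAt_snd

theorem contDiff_coord (i : Fin 3) : ContDiff ℝ ∞ fun p : Polar => p.2 i :=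
  (EuclideanSpace.proj (𝕜 := ℝ) i : Space →L[ℝ] ℝ).contDiff.comp contDiff_snd

theorem along_radial_mul (hG : ContDiff ℝ ∞ G) (w : ℝ × ℝ) (p : Polar) :
    along w (fun p => p.1.2 * G p) p = p.1.2 * along w G p + w.2 * G p := by
  rw [along_mul contDiff_radial hG]
  simp [along, (hasFDerivAt_radial p).fderiv]

theorem along_coord_mul (hG : ContDiff ℝ ∞ G) (w : ℝ × ℝ) (i : Fin 3) (p : Polar) :
    along w (fun p => p.2 i * G p) p = p.2 i * along w G p := by
  rw [along_mul (contDiff_coord i) hG]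
  simp [along, (hasFDerivAt_coord i p).fderiv]

theorem rotDeriv_radial_mul (hG : ContDiff ℝ ∞ G) (i : Fin 3) (p : Polar) :
    rotDeriv i (fun p => p.1.2 * G p) p = p.1.2 * rotDeriv i G p := by
  rw [rotDeriv_mul contDiff_radial hG]
  simp [rotDeriv, (hasFDerivAt_radial p).fderiv]

theorem rotDeriv_coord_mul (hG : ContDiff ℝ ∞ G) (i k : Fin 3) (p : Polar) :
    rotDeriv i (fun p => p.2 k * G p) p = p.2 k * rotDeriv i G p + rot i p.2 k * G p := by
  rw [rotDeriv_mul (contDiff_coord k) hG]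
  simp [rotDeriv, (hasFDerivAt_coord k p).fderiv]

/-- The null form of `∂_s² - ∂_r²` applied to `r h(s, r y)`. -/
theorem along_along_radial (hh : ContDiff ℝ ∞ h) (p : Polar) :
    along (1, -1) (along (1, 1) fun p => p.1.2 * h (polarMap p)) p
      = p.1.2 * partialS (partialS h) (polarMap p)
        - 2 * ∑ i, p.2 i * partialX i h (polarMap p)
        - p.1.2 * ∑ i, ∑ k, p.2 i * p.2 k * partialX i (partialX k h) (polarMap p) := by
  have hc {k : ℝ × Space → ℝ} (hk : ContDiff ℝ ∞ k) : ContDiff ℝ ∞ fun p => k (polarMap p) :=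
    hk.comp contDiff_polarMap
  have hs := hh.partialS
  have hx (i : Fin 3) := hh.partialX i
  have hyx (i : Fin 3) : ContDiff ℝ ∞ fun p : Polar => p.2 i * partialX i h (polarMap p) :=
    (contDiff_coord i).mul (hc (hx i))
  have hfirst : (along (1, 1) fun p => p.1.2 * h (polarMap p)) = fun p =>
      h (polarMap p) + p.1.2 * (partialS h (polarMap p) + ((p.2 0 * partialX 0 h (polarMap p)
        + p.2 1 * partialX 1 h (polarMap p)) + p.2 2 * partialX 2 h (polarMap p))) := by
    funext p
    rw [along_radial_mul (hc hh), along_comp_polarMap hh]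
    ring
  have h01 := (hyx 0).add (hyx 1)
  have h012 := h01.add (hyx 2)
  rw [hfirst, along_add (hc hh) (contDiff_radial.mul ((hc hs).add h012)),
    along_radial_mul ((hc hs).add h012), along_add (hc hs) h012, along_add h01 (hyx 2),
    along_add (hyx 0) (hyx 1), along_coord_mul (hc (hx 0)), along_coord_mul (hc (hx 1)),
    along_coord_mul (hc (hx 2)), along_comp_polarMap hh, along_comp_polarMap hs,
    along_comp_polarMap (hx 0), along_comp_polarMap (hx 1), along_comp_polarMap (hx 2)]
  simp only [Fin.sum_univ_three, partialX_partialS hh]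
  ring

/-- The sum of the squares of the rotation fields applied to `r h(s, r y)`, for `|y| = 1`. -/
theorem sum_rotDeriv_rotDeriv_radial (hh : ContDiff ℝ ∞ h) (p : Polar) (hp : ‖p.2‖ = 1) :
    ∑ i, rotDeriv i (rotDeriv i fun p => p.1.2 * h (polarMap p)) p
      = p.1.2 ^ 3 * ∑ i, partialX i (partialX i h) (polarMap p)
        - 2 * p.1.2 ^ 2 * ∑ i, p.2 i * partialX i h (polarMap p)
        - p.1.2 ^ 3 * ∑ i, ∑ k, p.2 i * p.2 k * partialX i (partialX k h) (polarMap p) := by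
  have hc {k : ℝ × Space → ℝ} (hk : ContDiff ℝ ∞ k) : ContDiff ℝ ∞ fun p => k (polarMap p) :=
    hk.comp contDiff_polarMap
  have hx (i : Fin 3) := hh.partialX i
  have hyx (i k : Fin 3) : ContDiff ℝ ∞ fun p : Polar => p.2 i * partialX k h (polarMap p) :=
    (contDiff_coord i).mul (hc (hx k))
  have hfirst (i : Fin 3) : (rotDeriv i fun p => p.1.2 * h (polarMap p)) = fun p =>
      p.1.2 * (p.1.2 * (p.2 (i + 1) * partialX (i + 2) h (polarMap p)
        - p.2 (i + 2) * partialX (i + 1) h (polarMap p))) := by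
    funext p
    rw [rotDeriv_radial_mul (hc hh), rotDeriv_comp_polarMap hh]
  have hsecond (i : Fin 3) : rotDeriv i (rotDeriv i fun p => p.1.2 * h (polarMap p)) p
      = p.1.2 * (p.1.2 * (p.2 (i + 1) * rotDeriv i (fun p => partialX (i + 2) h (polarMap p)) p
        + rot i p.2 (i + 1) * partialX (i + 2) h (polarMap p)
        - (p.2 (i + 2) * rotDeriv i (fun p => partialX (i + 1) h (polarMap p)) p
        + rot i p.2 (i + 2) * partialX (i + 1) h (polarMap p)))) := by
    have hsub := (hyx (i + 1) (i + 2)).sub (hyx (i + 2) (i + 1))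
    rw [hfirst, rotDeriv_radial_mul (contDiff_radial.mul hsub), rotDeriv_radial_mul hsub,
      rotDeriv_sub (hyx _ _) (hyx _ _), rotDeriv_coord_mul (hc (hx _)),
      rotDeriv_coord_mul (hc (hx _))]
  have hnorm : p.2 0 ^ 2 = 1 - p.2 1 ^ 2 - p.2 2 ^ 2 := by
    have := norm_sq_eq_sum p.2
    rw [hp] at this
    linarith
  simp only [hsecond, rotDeriv_comp_polarMap (hx _), Fin.sum_univ_three, rot_apply]
  simp only [Fin.isValue, zero_add, Fin.reduceAdd, PiLp.sub_apply, PiLp.smul_apply,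
    PiLp.single_apply, smul_eq_mul]
  rw [partialX_comm hh 1 0, partialX_comm hh 2 0, partialX_comm hh 2 1]
  simp
  ring_nf
  rw [hnorm]
  ring

end

/-! ### Conformal time -/

/-- The cosmic time `t = ((1-q) s)^(1/(1-q))` at conformal time `s = t^(1-q) / (1-q)`. -/
noncomputable def cosmicTime (q s : ℝ) : ℝ := ((1 - q) * s) ^ (1 / (1 - q))

/-- The constant `κ` in the potential `κ / s²` of the rescaled wave equation. -/
noncomputable def potentialConst (q : ℝ) : ℝ := q * (2 * q - 1) / (1 - q) ^ 2

/-- The change of variables from conformal to cosmic time. -/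
noncomputable def timeMap (q : ℝ) (z : ℝ × Space) : Spacetime := (cosmicTime q z.1, z.2)

section
variable {q : ℝ}

theorem cosmicTime_pos (hq : q < 1) {s : ℝ} (hs : 0 < s) : 0 < cosmicTime q s :=
  Real.rpow_pos_of_pos (mul_pos (by linarith) hs) _

theorem cosmicTime_rpow (hq : q < 1) {s : ℝ} (hs : 0 < s) (a : ℝ) :
    cosmicTime q s ^ a = ((1 - q) * s) ^ (a / (1 - q)) := by
  rw [cosmicTime, ← Real.rpow_mul (mul_pos (by linarith) hs).le]
  congr 1
  ring

theorem cosmicTime_rpow_one_sub (hq : q < 1) {s : ℝ} (hs : 0 < s) :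
    cosmicTime q s ^ (1 - q) = (1 - q) * s := by
  rw [cosmicTime_rpow hq hs, div_self (by linarith), Real.rpow_one]

theorem hasDerivAt_cosmicTime (hq : q < 1) {s : ℝ} (hs : 0 < s) :
    HasDerivAt (cosmicTime q) (cosmicTime q s ^ q) s := by
  have h1 : HasDerivAt (fun s : ℝ => (1 - q) * s) (1 - q) s := by
    simpa using (hasDerivAt_id s).const_mul (1 - q)
  have hpos : 0 < (1 - q) * s := mul_pos (by linarith) hs
  refine (h1.rpow_const (Or.inl hpos.ne')).congr_deriv ?_
  rw [cosmicTime_rpow hq hs, show 1 / (1 - q) - 1 = q / (1 - q) by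
    have : (1 - q) ≠ 0 := by linarith
    field_simp
    ring]
  have : (1 - q) ≠ 0 := by linarith
  field_simp

theorem hasDerivAt_cosmicTime_rpow (hq : q < 1) {s : ℝ} (hs : 0 < s) (a : ℝ) :
    HasDerivAt (fun s => cosmicTime q s ^ a) (a * cosmicTime q s ^ (a - 1 + q)) s := by
  have ht := cosmicTime_pos hq hs
  refine ((hasDerivAt_cosmicTime hq hs).rpow_const (p := a) (Or.inl ht.ne')).congr_deriv ?_
  rw [Real.rpow_add ht]
  ring

theorem contDiffOn_cosmicTime (hq : q < 1) : ContDiffOn ℝ ∞ (cosmicTime q) (Ioi 0) := by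
  intro s hs
  have hpos : 0 < (1 - q) * s := mul_pos (by linarith) hs
  exact ((contDiffAt_const.mul contDiffAt_id).rpow_const_of_ne hpos.ne').contDiffWithinAt

theorem hasFDerivAt_timeMap (hq : q < 1) {z : ℝ × Space} (hz : 0 < z.1) :
    HasFDerivAt (timeMap q) (((cosmicTime q z.1 ^ q) • ContinuousLinearMap.fst ℝ ℝ Space).prod
      (ContinuousLinearMap.snd ℝ ℝ Space)) z :=
  ((hasDerivAt_cosmicTime hq hz).comp_hasFDerivAt z hasFDerivAt_fst).prodMk hasFDerivAt_snd

/-- Derivatives of `t^a F` expressed through conformal time. -/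
theorem hasFDerivAt_cosmicTime_mul (hq : q < 1) {z : ℝ × Space} (hz : 0 < z.1) (a : ℝ)
    {F : Spacetime → ℝ} (hF : DifferentiableAt ℝ F (timeMap q z)) :
    DifferentiableAt ℝ (fun z => cosmicTime q z.1 ^ a * F (timeMap q z)) z ∧
    partialS (fun z => cosmicTime q z.1 ^ a * F (timeMap q z)) z
      = a * cosmicTime q z.1 ^ (a - 1 + q) * F (timeMap q z)
        + cosmicTime q z.1 ^ (a + q) * dt F (timeMap q z) ∧
    ∀ i, partialX i (fun z => cosmicTime q z.1 ^ a * F (timeMap q z)) z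
      = cosmicTime q z.1 ^ a * dx i F (timeMap q z) := by
  have ht := cosmicTime_pos hq hz
  have h1 : HasFDerivAt (fun z : ℝ × Space => cosmicTime q z.1 ^ a)
      ((a * cosmicTime q z.1 ^ (a - 1 + q)) • ContinuousLinearMap.fst ℝ ℝ Space) z :=
    (hasDerivAt_cosmicTime_rpow hq hz a).comp_hasFDerivAt z hasFDerivAt_fst
  have h2 := h1.mul (hF.hasFDerivAt.comp z (hasFDerivAt_timeMap hq hz))
  have h3 : HasFDerivAt (fun z => cosmicTime q z.1 ^ a * F (timeMap q z)) _ z := h2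
  have e0 : fderiv ℝ F (timeMap q z) (cosmicTime q z.1 ^ q, 0)
      = cosmicTime q z.1 ^ q * dt F (timeMap q z) := by
    rw [dt, ← smul_eq_mul, ← map_smul]
    congr 1
    ext <;> simp
  refine ⟨h3.differentiableAt, ?_, fun i => ?_⟩
  · rw [partialS, h3.fderiv]
    simp [Real.rpow_add ht, e0]
    ring
  · rw [partialX, h3.fderiv]
    simp [dx]

/-- The wave equation for `χ = t^q ψ` in conformal time, at a point of an open set where
`ψ` is smooth. -/
theorem conformal_wave (hq : q < 1) {O : Set (ℝ × Space)} (hO : IsOpen O) (hpos : ∀ z ∈ O, 0 < z.1)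
    {U : Set Spacetime} (hU : IsOpen U) {ψ : Spacetime → ℝ} (hψ : ContDiffOn ℝ ∞ ψ U)
    (hOU : MapsTo (timeMap q) O U) {χ : ℝ × Space → ℝ}
    (hχ : ∀ z ∈ O, χ z = cosmicTime q z.1 ^ q * ψ (timeMap q z)) {z : ℝ × Space} (hz : z ∈ O)
    (hbox : box q ψ (timeMap q z) = 0) :
    partialS (partialS χ) z = ∑ i, partialX i (partialX i χ) z
      + potentialConst q / z.1 ^ 2 * χ z := by
  have hfd : ContDiffOn ℝ ∞ (fderiv ℝ ψ) U := hψ.fderiv_of_isOpen hU (by simp)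
  have hdt : ContDiffOn ℝ ∞ (dt ψ) U := hfd.clm_apply contDiffOn_const
  have hdx (i : Fin 3) : ContDiffOn ℝ ∞ (dx i ψ) U := hfd.clm_apply contDiffOn_const
  have hdiff {F : Spacetime → ℝ} (hF : ContDiffOn ℝ ∞ F U) (z) (hz : z ∈ O) :
      DifferentiableAt ℝ F (timeMap q z) :=
    (hF.contDiffAt (hU.mem_nhds (hOU hz))).differentiableAt (by simp)
  have hev {F G : ℝ × Space → ℝ} (h : ∀ z ∈ O, F z = G z) (z) (hz : z ∈ O) :
      fderiv ℝ F z = fderiv ℝ G z :=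
    Filter.EventuallyEq.fderiv_eq (by filter_upwards [hO.mem_nhds hz] with w hw using h w hw)
  have hS (z) (hz : z ∈ O) : partialS χ z = q * (cosmicTime q z.1 ^ (2 * q - 1) * ψ (timeMap q z))
      + cosmicTime q z.1 ^ (2 * q) * dt ψ (timeMap q z) := by
    rw [partialS, hev hχ z hz]
    refine (hasFDerivAt_cosmicTime_mul hq (hpos z hz) q (hdiff hψ z hz)).2.1.trans ?_
    rw [show q - 1 + q = 2 * q - 1 by ring, show q + q = 2 * q by ring]
    ring
  have hX (i) (z) (hz : z ∈ O) : partialX i χ z = cosmicTime q z.1 ^ q * dx i ψ (timeMap q z) := by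
    rw [partialX, hev hχ z hz]
    exact (hasFDerivAt_cosmicTime_mul hq (hpos z hz) q (hdiff hψ z hz)).2.2 i
  have hXX (i) : partialX i (partialX i χ) z
      = cosmicTime q z.1 ^ q * dx i (dx i ψ) (timeMap q z) := by
    rw [partialX, hev (hX i) z hz]
    exact (hasFDerivAt_cosmicTime_mul hq (hpos z hz) q (hdiff (hdx i) z hz)).2.2 i
  have h1 := hasFDerivAt_cosmicTime_mul hq (hpos z hz) (2 * q - 1) (hdiff hψ z hz)
  have h2 := hasFDerivAt_cosmicTime_mul hq (hpos z hz) (2 * q) (hdiff hdt z hz)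
  have hs := hpos z hz
  have ht := cosmicTime_pos hq hs
  have hSS : partialS (partialS χ) z = q * ((2 * q - 1) * cosmicTime q z.1 ^ (2 * q - 1 - 1 + q)
        * ψ (timeMap q z) + cosmicTime q z.1 ^ (2 * q - 1 + q) * dt ψ (timeMap q z))
      + (2 * q * cosmicTime q z.1 ^ (2 * q - 1 + q) * dt ψ (timeMap q z)
        + cosmicTime q z.1 ^ (2 * q + q) * dt (dt ψ) (timeMap q z)) := by
    rw [partialS, hev hS z hz, fderiv_fun_add (h1.1.const_mul q) h2.1, fderiv_const_mul h1.1]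
    rw [add_apply, smul_apply, smul_eq_mul]
    exact congrArg₂ _ (congrArg _ h1.2.1) h2.2.1
  rw [hSS, hχ z hz]
  simp only [hXX, ← Finset.mul_sum]
  set t := cosmicTime q z.1 with htdef
  have hbox' : ∑ i, dx i (dx i ψ) (timeMap q z)
      = t ^ (2 * q) * (dt (dt ψ) (timeMap q z) + 3 * q / t * dt ψ (timeMap q z)) := by
    have h0 : t ^ (2 * q) * t ^ (-(2 * q)) = 1 := by
      rw [← Real.rpow_add ht]
      simp
    have h3 := congrArg (t ^ (2 * q) * ·) hbox
    simp only [box, timeMap, mul_zero] at h3 ⊢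
    rw [← htdef] at h3 ⊢
    linear_combination h3 - (∑ i, dx i (dx i ψ) (t, z.2)) * h0
  have hpot : potentialConst q / z.1 ^ 2 = q * (2 * q - 1) * t ^ (2 * q - 2) := by
    rw [show 2 * q - 2 = -((1 - q) * (2 : ℕ)) by push_cast; ring, Real.rpow_neg ht.le,
      Real.rpow_mul ht.le, cosmicTime_rpow_one_sub hq hs, Real.rpow_natCast, potentialConst]
    have : (1 - q) ≠ 0 := by linarith
    field_simp
  rw [hbox', hpot]
  have e1 : t ^ (2 * q - 1 - 1 + q) = t ^ (2 * q - 2) * t ^ q := by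
    rw [← Real.rpow_add ht]
    congr 1
    ring
  have e2 : t ^ (2 * q - 1 + q) = t ^ q * t ^ (2 * q) / t := by
    rw [← Real.rpow_add ht, ← Real.rpow_sub_one ht.ne']
    congr 1
    ring
  have e3 : t ^ (2 * q + q) = t ^ q * t ^ (2 * q) := by
    rw [← Real.rpow_add ht]
    congr 1
    ring
  rw [e1, e2, e3]
  field_simp
  ring

end

/-! ### Extension of the rescaled solution to a smooth function on `ℝ × ℝ³` -/

/-- The future of the initial leaf in conformal time. -/
def conformalFuture (ρ τ₀ : ℝ) : Set (ℝ × Space) :=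
  {z | 2 * τ₀ ≤ z.1 ∧ 2 * τ₀ - ρ + ‖z.2‖ ≤ z.1}

theorem timeMap_mem_future {q ρ τ₀ : ℝ} (hq : q < 1) (hτ₀ : 0 < τ₀) {z : ℝ × Space}
    (hz : z ∈ conformalFuture ρ τ₀) : timeMap q z ∈ future q ρ τ₀ := by
  have hs : 0 < z.1 := by linarith [hz.1]
  have h1q : (1 - q) ≠ 0 := by linarith
  refine ⟨cosmicTime_pos hq hs, ?_⟩
  simp only [tau, uCoord, timeMap, radius, cosmicTime_rpow_one_sub hq hs]
  rw [mul_div_cancel_left₀ _ h1q]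
  split_ifs
  · linarith [hz.1]
  · linarith [hz.2]

/-- Near the future of the initial leaf, `t^q ψ` agrees with a smooth function on all of
`ℝ × ℝ³`, as a function of conformal time. -/
theorem exists_smooth_extension {q ρ τ₀ : ℝ} (hq : q < 1) (hτ₀ : 0 < τ₀) {U : Set Spacetime}
    (hU : IsOpen U) (hFU : future q ρ τ₀ ⊆ U) {ψ : Spacetime → ℝ} (hψ : ContDiffOn ℝ ∞ ψ U) :
    ∃ χ : ℝ × Space → ℝ, ContDiff ℝ ∞ χ ∧ ∃ O : Set (ℝ × Space), IsOpen O ∧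
      conformalFuture ρ τ₀ ⊆ O ∧ (∀ z ∈ O, 0 < z.1) ∧ MapsTo (timeMap q) O U ∧
      ∀ z ∈ O, χ z = cosmicTime q z.1 ^ q * ψ (timeMap q z) := by
  set H : Set (ℝ × Space) := Ioi 0 ×ˢ univ with hH
  have hHo : IsOpen H := isOpen_Ioi.prod isOpen_univ
  have hTc : ContDiffOn ℝ ∞ (fun z : ℝ × Space => cosmicTime q z.1) H :=
    (contDiffOn_cosmicTime hq).comp contDiff_fst.contDiffOn fun z hz => hz.1
  have hmap : ContDiffOn ℝ ∞ (timeMap q) H := hTc.prodMk contDiff_snd.contDiffOn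
  set W : Set (ℝ × Space) := H ∩ timeMap q ⁻¹' U with hW
  have hWo : IsOpen W := hmap.continuousOn.isOpen_inter_preimage hHo hU
  have hZ : IsClosed (conformalFuture ρ τ₀) :=
    (isClosed_le continuous_const continuous_fst).inter
      (isClosed_le (continuous_const.add continuous_snd.norm) continuous_fst)
  have hZW : conformalFuture ρ τ₀ ⊆ W := fun z hz =>
    ⟨⟨mem_Ioi.2 (by linarith [hz.1]), mem_univ _⟩, hFU (timeMap_mem_future hq hτ₀ hz)⟩
  have hχ₀ : ContDiffOn ℝ ∞ (fun z => cosmicTime q z.1 ^ q * ψ (timeMap q z)) W := by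
    refine ContDiffOn.mul ?_ (hψ.comp (hmap.mono inter_subset_left) inter_subset_right)
    exact (hTc.mono inter_subset_left).rpow_const_of_ne
      fun z hz => (cosmicTime_pos hq hz.1.1).ne'
  obtain ⟨η, hη0, hη1, -⟩ := exists_contMDiffMap_zero_one_nhds_of_isClosed
    (modelWithCornersSelf ℝ (ℝ × Space)) (n := ⊤) hWo.isClosed_compl hZ
    (disjoint_compl_left_iff_subset.2 hZW)
  have hηs : ContDiff ℝ ∞ η := η.contMDiff.contDiff
  obtain ⟨O', hO'o, hZO', hO'⟩ := mem_nhdsSet_iff_exists.1 hη1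
  refine ⟨fun z => η z * (cosmicTime q z.1 ^ q * ψ (timeMap q z)), ?_, O' ∩ W, hO'o.inter hWo,
    subset_inter hZO' hZW, fun z hz => hz.2.1.1, fun z hz => hz.2.2, fun z hz => ?_⟩
  · rw [contDiff_iff_contDiffAt]
    intro z
    by_cases hz : z ∈ W
    · exact hηs.contDiffAt.mul (hχ₀.contDiffAt (hWo.mem_nhds hz))
    · have h1 : ∀ᶠ w in 𝓝 z, η w = 0 := hη0.filter_mono (nhds_le_nhdsSet hz)
      refine (contDiffAt_const (c := (0 : ℝ))).congr_of_eventuallyEq ?_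
      filter_upwards [h1] with w hw
      rw [hw, zero_mul]
  · have : η z = 1 := hO' hz.1
    simp [this]

/-! ### Dictionary between spacetime and polar coordinates -/

/-- The spacetime point with conformal time `z.1`, radius `z.2` and direction `θ`. -/
noncomputable def polarPoint (q : ℝ) (z : ℝ × ℝ) (θ : Sphere) : Spacetime :=
  (cosmicTime q z.1, z.2 • (θ : Space))

theorem nullPoint_eq (q u v : ℝ) (θ : Sphere) :
    nullPoint q u v θ = polarPoint q (u + v, v - u) θ := by
  simp only [nullPoint, polarPoint, cosmicTime, add_comm u v]

theorem norm_sphere (θ : Sphere) : ‖(θ : Space)‖ = 1 := by simp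

theorem angularSq_eq (F : Spacetime → ℝ) (z : Spacetime) :
    angularSq F z = ∑ i, fderiv ℝ F z (0, rot i z.2) ^ 2 := by
  have h (i : Fin 3) : fderiv ℝ F z (0, rot i z.2)
      = z.2 (i + 1) * dx (i + 2) F z - z.2 (i + 2) * dx (i + 1) F z := by
    have : ((0 : ℝ), rot i z.2) = z.2 (i + 1) • ((0 : ℝ), EuclideanSpace.single (i + 2) (1 : ℝ))
        - z.2 (i + 2) • ((0 : ℝ), EuclideanSpace.single (i + 1) (1 : ℝ)) := by
      rw [rot_apply]
      refine Prod.ext ?_ ?_ <;> simp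
    rw [this, map_sub, map_smul, map_smul]
    rfl
  simp only [h, Fin.sum_univ_three, angularSq]
  simp

section
variable {q : ℝ} {F : Spacetime → ℝ} {G : Polar → ℝ} {z : ℝ × ℝ} {θ : Sphere}

theorem hasDerivAt_polarPoint (hq : q < 1) (hz : 0 < z.1) (w : ℝ × ℝ) :
    HasDerivAt (fun h : ℝ => polarPoint q (z + h • w) θ)
      (w.1 * cosmicTime q z.1 ^ q, w.2 • (θ : Space)) 0 := by
  have h1 : HasDerivAt (fun h : ℝ => z.1 + h * w.1) w.1 0 := by
    simpa using ((hasDerivAt_id (0 : ℝ)).mul_const w.1).const_add z.1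
  have h2 : HasDerivAt (fun h : ℝ => z.2 + h * w.2) w.2 0 := by
    simpa using ((hasDerivAt_id (0 : ℝ)).mul_const w.2).const_add z.2
  have h3 : HasDerivAt (cosmicTime q) (cosmicTime q z.1 ^ q) (z.1 + 0 * w.1) := by
    simpa using hasDerivAt_cosmicTime hq hz
  refine HasDerivAt.prodMk ?_ (h2.smul_const _)
  exact (h3.comp 0 h1).congr_deriv (mul_comm _ _)

/-- Derivatives in the `(s, r)` plane as spacetime derivatives. -/
theorem along_eq_fderiv (hq : q < 1) (hz : 0 < z.1) (hG : ContDiff ℝ ∞ G)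
    (hF : DifferentiableAt ℝ F (polarPoint q z θ))
    (hFG : ∀ᶠ z' in 𝓝 z, F (polarPoint q z' θ) = G (z', θ)) (a b : ℝ) :
    along (a, b) G (z, θ)
      = fderiv ℝ F (polarPoint q z θ) (a * cosmicTime q z.1 ^ q, b • (θ : Space)) := by
  set w : ℝ × ℝ := (a, b)
  have hline : HasDerivAt (fun h : ℝ => z + h • w) w 0 := by
    simpa using ((hasDerivAt_id (0 : ℝ)).smul_const w).const_add z
  have h1 : HasDerivAt (fun h : ℝ => G (z + h • w, (θ : Space))) (along w G (z, θ)) 0 := by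
    have h2 : HasFDerivAt G (fderiv ℝ G (z, (θ : Space))) (z + (0 : ℝ) • w, (θ : Space)) := by
      simpa using (hG.differentiable (by simp) _).hasFDerivAt
    exact h2.comp_hasDerivAt 0 (hline.prodMk (hasDerivAt_const 0 (θ : Space)))
  have h3 : HasDerivAt (fun h : ℝ => F (polarPoint q (z + h • w) θ))
      (fderiv ℝ F (polarPoint q z θ) (w.1 * cosmicTime q z.1 ^ q, w.2 • (θ : Space))) 0 := by
    have h2 : HasFDerivAt F (fderiv ℝ F (polarPoint q z θ)) (polarPoint q (z + (0 : ℝ) • w) θ) := by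
      simpa using hF.hasFDerivAt
    exact h2.comp_hasDerivAt 0 (hasDerivAt_polarPoint hq hz w)
  refine h1.unique (h3.congr_of_eventuallyEq ?_)
  have hc : Tendsto (fun h : ℝ => z + h • w) (𝓝 0) (𝓝 z) := by
    simpa using hline.continuousAt.tendsto
  filter_upwards [hc.eventually hFG] with h hh using hh.symm

/-- The rotation fields on spacetime and in polar coordinates. -/
theorem rotDeriv_eq_fderiv (hG : ContDiff ℝ ∞ G) (hF : DifferentiableAt ℝ F (polarPoint q z θ))
    (hFG : ∀ θ' : Sphere, F (polarPoint q z θ') = G (z, θ')) (i : Fin 3) :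
    rotDeriv i G (z, θ) = fderiv ℝ F (polarPoint q z θ) (0, rot i (polarPoint q z θ).2) := by
  have hd : HasDerivAt (fun ε => rotation i ε θ) (rot i θ) 0 := by
    simp only [rotation_apply]
    have h1 := (Real.hasDerivAt_sin 0).smul_const (rot i (θ : Space))
    have h2 := ((Real.hasDerivAt_cos 0).const_sub 1).smul_const (rot i (rot i (θ : Space)))
    exact ((h1.const_add (θ : Space)).add h2).congr_deriv (by simp)
  have hrot0 : rotation i 0 (θ : Space) = θ := by simp [rotation_apply]
  have h1 : HasDerivAt (fun ε => G (z, rotation i ε θ)) (rotDeriv i G (z, θ)) 0 := by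
    have h2 : HasFDerivAt G (fderiv ℝ G (z, (θ : Space))) (z, rotation i 0 θ) := by
      rw [hrot0]
      exact (hG.differentiable (by simp) _).hasFDerivAt
    exact h2.comp_hasDerivAt 0 ((hasDerivAt_const 0 z).prodMk hd)
  have h3 : HasDerivAt (fun ε => F (cosmicTime q z.1, z.2 • rotation i ε (θ : Space)))
      (fderiv ℝ F (polarPoint q z θ) (0, z.2 • rot i θ)) 0 := by
    have h2 : HasFDerivAt F (fderiv ℝ F (polarPoint q z θ))
        (cosmicTime q z.1, z.2 • rotation i 0 (θ : Space)) := by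
      rw [hrot0]
      exact hF.hasFDerivAt
    exact h2.comp_hasDerivAt 0 ((hasDerivAt_const 0 _).prodMk (hd.const_smul z.2))
  have h4 : (fun ε => G (z, rotation i ε (θ : Space)))
      = fun ε => F (cosmicTime q z.1, z.2 • rotation i ε (θ : Space)) := by
    funext ε
    exact (hFG (sphereMap (rotation i ε) θ)).symm
  rw [h4] at h1
  rw [h1.unique h3]
  simp [polarPoint]

/-- A factor depending only on `t` commutes with spatial derivatives. -/
theorem fderiv_time_mul {H : Spacetime → ℝ} {x : Spacetime} (hx : 0 < x.1)
    (hH : DifferentiableAt ℝ H x) (y : Space) :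
    fderiv ℝ (fun w : Spacetime => w.1 ^ q * H w) x (0, y) = x.1 ^ q * fderiv ℝ H x (0, y) := by
  have h1 : DifferentiableAt ℝ (fun t : ℝ => t ^ q) x.1 :=
    Real.differentiableAt_rpow_const_of_ne q hx.ne'
  have h2 : HasFDerivAt (fun w : Spacetime => w.1 ^ q)
      (deriv (fun t : ℝ => t ^ q) x.1 • ContinuousLinearMap.fst ℝ ℝ Space) x :=
    h1.hasDerivAt.comp_hasFDerivAt x hasFDerivAt_fst
  have h3 : HasFDerivAt (fun w : Spacetime => w.1 ^ q * H w) _ x := h2.mul hH.hasFDerivAt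
  rw [h3.fderiv]
  simp

end

theorem polarMap_mem_conformalFuture {ρ τ₀ : ℝ} {z : ℝ × ℝ} (hz : z ∈ polarFuture ρ τ₀)
    (θ : Sphere) : polarMap (z, θ) ∈ conformalFuture ρ τ₀ := by
  refine ⟨hz.2.1, ?_⟩
  simp only [polarMap, norm_smul, norm_sphere, mul_one, Real.norm_eq_abs, abs_of_pos hz.1]
  exact hz.2.2

/-- The wave equation in Cartesian coordinates and conformal time gives the one for `r χ` in polar
coordinates. -/
theorem isPolarSolution_of_wave {κ ρ τ₀ : ℝ} {χ : ℝ × Space → ℝ} (hχ : ContDiff ℝ ∞ χ)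
    (hw : ∀ z ∈ conformalFuture ρ τ₀, partialS (partialS χ) z
      = ∑ i, partialX i (partialX i χ) z + κ / z.1 ^ 2 * χ z) :
    IsPolarSolution κ ρ τ₀ (fun p => χ (polarMap p)) (fun p => p.1.2 * χ (polarMap p)) := by
  refine ⟨hχ.comp contDiff_polarMap, fun _ => rfl, fun z hz θ => ?_⟩
  rw [along_along_radial hχ (z, (θ : Space)),
    sum_rotDeriv_rotDeriv_radial hχ (z, (θ : Space)) (norm_sphere θ),
    hw _ (polarMap_mem_conformalFuture hz θ)]
  simp only [polarMap]
  ring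

/-- The function `f = r g` on polar coordinates represents `r t^q ψ` on the future of the initial leaf,
and the quantities of the estimate are expressed by `f` there. In `energy_bound` the summands on the
left are `∂_v f = r ∂_s g + ∂_r f`, the angular gradient, and `f / r = ∂_r f - r ∂_r g`; all of them
are controlled by the energy density, whose spatial measure contributes the factor `r²`. -/
structure Represents (q ρ τ₀ : ℝ) (ψ : Spacetime → ℝ) (g f : Polar → ℝ) : Prop where
  solution : IsPolarSolution (potentialConst q) ρ τ₀ g f
  phi_eq : ∀ z ∈ polarFuture ρ τ₀, ∀ θ : Sphere, phi q ψ (polarPoint q z θ) = f (z, θ)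
  dv_phi : ∀ z ∈ polarFuture ρ τ₀, ∀ θ : Sphere,
    dv q (phi q ψ) (polarPoint q z θ) = along (1, 1) f (z, θ)
  dv_twist : ∀ z ∈ polarFuture ρ τ₀, ∀ θ : Sphere,
    z.2 * dv q (twist q ψ) (polarPoint q z θ) = along (1, 1) f (z, θ) - f (z, θ) / z.2
  angularSq_phi : ∀ z ∈ polarFuture ρ τ₀, ∀ θ : Sphere,
    angularSq (phi q ψ) (polarPoint q z θ) = ∑ i, rotDeriv i f (z, θ) * rotDeriv i f (z, θ)
  energy_bound : ∀ z ∈ polarFuture ρ τ₀, ∀ θ : Sphere,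
    cosmicTime q z.1 ^ (-mu q) * (along (1, 1) f (z, θ) * along (1, 1) f (z, θ)
      + (∑ i, rotDeriv i f (z, θ) * rotDeriv i f (z, θ)) / z.2 ^ 2 + (f (z, θ) / z.2) ^ 2)
      ≤ 4 * (z.2 ^ 2 * energyDensityS q ψ (polarPoint q z θ))

set_option maxHeartbeats 400000 in
/-- Every solution is represented by a solution in polar coordinates. -/
theorem exists_represents {q ρ τ₀ : ℝ} (hq : q < 1) (hτ₀ : 0 < τ₀) {ψ : Spacetime → ℝ}
    (hψ : IsSolution q ρ τ₀ ψ) : ∃ g f : Polar → ℝ, Represents q ρ τ₀ ψ g f := by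
  obtain ⟨U, hU, hFU, hψU⟩ := hψ.smooth
  obtain ⟨χ, hχ, O, hO, hZO, hpos, hOU, hχψ⟩ := exists_smooth_extension hq hτ₀ hU hFU hψU
  set g : Polar → ℝ := fun p => χ (polarMap p) with hg
  set f : Polar → ℝ := fun p => p.1.2 * χ (polarMap p) with hf
  have hgs : ContDiff ℝ ∞ g := hχ.comp contDiff_polarMap
  have hfs : ContDiff ℝ ∞ f := contDiff_radial.mul hgs
  have hmemZ {z : ℝ × ℝ} (hz : z ∈ polarFuture ρ τ₀) (θ : Sphere) :
      polarMap (z, θ) ∈ conformalFuture ρ τ₀ := polarMap_mem_conformalFuture hz θ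
  have hdψ {z : ℝ × ℝ} (hz : z ∈ polarFuture ρ τ₀) (θ : Sphere) :
      DifferentiableAt ℝ ψ (polarPoint q z θ) :=
    (hψU.contDiffAt (hU.mem_nhds (hOU (hZO (hmemZ hz θ))))).differentiableAt (by simp)
  have htpos {z : ℝ × ℝ} (hz : z ∈ polarFuture ρ τ₀) : 0 < cosmicTime q z.1 :=
    cosmicTime_pos hq (polarFuture_subset hτ₀ hz).1
  have hdr {z : ℝ × ℝ} (hz : z ∈ polarFuture ρ τ₀) (θ : Sphere) :
      DifferentiableAt ℝ radius (polarPoint q z θ) := by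
    refine DifferentiableAt.norm ℝ differentiableAt_snd ?_
    have : (θ : Space) ≠ 0 := norm_ne_zero_iff.1 (by simp)
    exact smul_ne_zero hz.1.ne' this
  have hdpow {z : ℝ × ℝ} (hz : z ∈ polarFuture ρ τ₀) (θ : Sphere) :
      DifferentiableAt ℝ (fun w : Spacetime => w.1 ^ q) (polarPoint q z θ) :=
    DifferentiableAt.rpow_const differentiableAt_fst (Or.inl (htpos hz).ne')
  have hdtwist {z : ℝ × ℝ} (hz : z ∈ polarFuture ρ τ₀) (θ : Sphere) :
      DifferentiableAt ℝ (twist q ψ) (polarPoint q z θ) :=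
    (hdpow hz θ).mul (hdψ hz θ)
  have hdphi {z : ℝ × ℝ} (hz : z ∈ polarFuture ρ τ₀) (θ : Sphere) :
      DifferentiableAt ℝ (phi q ψ) (polarPoint q z θ) :=
    ((hdr hz θ).mul (hdpow hz θ)).mul (hdψ hz θ)
  have hradius {z : ℝ × ℝ} (hz : 0 < z.2) (θ : Sphere) : radius (polarPoint q z θ) = z.2 := by
    simp [radius, polarPoint, norm_smul, abs_of_pos hz]
  have htw {z : ℝ × ℝ} {θ : Sphere} (hz : polarMap (z, θ) ∈ O) :
      twist q ψ (polarPoint q z θ) = g (z, θ) := (hχψ _ hz).symm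
  have hph {z : ℝ × ℝ} {θ : Sphere} (hz : polarMap (z, θ) ∈ O) (hr : 0 < z.2) :
      phi q ψ (polarPoint q z θ) = f (z, θ) := by
    have := htw hz
    simp only [phi, hradius hr, hf, twist, hg] at this ⊢
    rw [← this]
    ring
  have hnear {z : ℝ × ℝ} (hz : z ∈ polarFuture ρ τ₀) (θ : Sphere) :
      ∀ᶠ z' in 𝓝 z, polarMap (z', θ) ∈ O ∧ 0 < z'.2 := by
    have hc : Continuous fun z' : ℝ × ℝ => polarMap (z', (θ : Space)) :=
      contDiff_polarMap.continuous.comp (by fun_prop)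
    have h1 : ∀ᶠ z' in 𝓝 z, polarMap (z', θ) ∈ O :=
      (hO.preimage hc).mem_nhds (hZO (hmemZ hz θ))
    have h2 : ∀ᶠ z' : ℝ × ℝ in 𝓝 z, 0 < z'.2 :=
      (isOpen_lt continuous_const continuous_snd).mem_nhds hz.1
    exact h1.and h2
  have halong_tw {z : ℝ × ℝ} (hz : z ∈ polarFuture ρ τ₀) (θ : Sphere) (a b : ℝ) :=
    along_eq_fderiv (θ := θ) hq (polarFuture_subset hτ₀ hz).1 hgs (hdtwist hz θ)
      ((hnear hz θ).mono fun z' h => htw h.1) a b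
  have halong_ph {z : ℝ × ℝ} (hz : z ∈ polarFuture ρ τ₀) (θ : Sphere) (a b : ℝ) :=
    along_eq_fderiv (θ := θ) hq (polarFuture_subset hτ₀ hz).1 hfs (hdphi hz θ)
      ((hnear hz θ).mono fun z' h => hph h.1 h.2) a b
  have hdr_eq {z : ℝ × ℝ} (hz : z ∈ polarFuture ρ τ₀) (θ : Sphere) (F : Spacetime → ℝ) :
      dr F (polarPoint q z θ) = fderiv ℝ F (polarPoint q z θ) (0, (θ : Space)) := by
    rw [dr, hradius hz.1]
    simp [polarPoint, smul_smul, hz.1.ne']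
  have hdv_eq {z : ℝ × ℝ} (hz : z ∈ polarFuture ρ τ₀) (θ : Sphere) (F : Spacetime → ℝ) :
      dv q F (polarPoint q z θ)
        = fderiv ℝ F (polarPoint q z θ) (1 * cosmicTime q z.1 ^ q, (1 : ℝ) • (θ : Space)) := by
    have e : ((1 * cosmicTime q z.1 ^ q, (1 : ℝ) • (θ : Space)) : Spacetime)
        = cosmicTime q z.1 ^ q • ((1 : ℝ), (0 : Space)) + ((0 : ℝ), (θ : Space)) := by
      refine Prod.ext ?_ ?_ <;> simp
    rw [dv, hdr_eq hz, e, map_add, map_smul, dt]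
    rfl
  have hgf : ∀ p : Polar, f p = p.1.2 * g p := fun _ => rfl
  have hpolar : IsPolarSolution (potentialConst q) ρ τ₀ g f :=
    isPolarSolution_of_wave hχ fun z hz => conformal_wave hq hO hpos hU hψU hOU hχψ (hZO hz)
      (hψ.wave _ (timeMap_mem_future hq hτ₀ hz))
  refine ⟨g, f, hpolar, fun z hz θ => hph (hZO (hmemZ hz θ)) hz.1,
    fun z hz θ => ?_, fun z hz θ => ?_, fun z hz θ => ?_, fun z hz θ => ?_⟩
  · rw [hdv_eq hz, halong_ph hz θ 1 1]
  · have e : dv q (twist q ψ) (polarPoint q z θ) = along (1, 1) g (z, θ) := by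
      rw [hdv_eq hz, halong_tw hz θ 1 1]
    rw [e, show f = fun p => p.1.2 * g p from rfl, along_radial_mul hgs]
    have hr : z.2 ≠ 0 := hz.1.ne'
    simp only
    field_simp
    ring
  · rw [angularSq_eq]
    refine Finset.sum_congr rfl fun i _ => ?_
    rw [rotDeriv_eq_fderiv hfs (hdphi hz θ) (fun θ' => hph (hZO (hmemZ hz θ')) hz.1) i]
    ring
  · have hr := hz.1
    have ht := htpos hz
    set x := polarPoint q z θ with hx
    have hx1 : x.1 = cosmicTime q z.1 := rfl
    have hxr : radius x = z.2 := hradius hr θ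
    set T := cosmicTime q z.1 ^ q with hT
    have hT2 : cosmicTime q z.1 ^ (2 * q) = T ^ 2 := by
      rw [hT, ← Real.rpow_natCast, ← Real.rpow_mul ht.le]
      congr 1
      push_cast
      ring
    -- the derivatives entering the energy density
    have h1 : along (1, 0) g (z, θ) = T * dt (twist q ψ) x := by
      have e : ((1 * T, (0 : ℝ) • (θ : Space)) : Spacetime) = T • ((1 : ℝ), (0 : Space)) := by
        refine Prod.ext ?_ ?_ <;> simp
      rw [halong_tw hz, ← hT, e, map_smul, smul_eq_mul, ← hx, dt]
    have h2 : along (0, 1) g (z, θ) = T * dr ψ x := by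
      rw [halong_tw hz, hdr_eq hz, ← hx]
      have := fderiv_time_mul (q := q) (x := x) ht (hdψ hz θ) (θ : Space)
      rw [hx1] at this
      rw [← this]
      congr 1
      refine Prod.ext ?_ ?_ <;> simp
    have h3 : along (0, 1) f (z, θ) = T * dr (fun w => radius w * ψ w) x := by
      rw [halong_ph hz, hdr_eq hz, ← hx]
      have := fderiv_time_mul (q := q) (x := x) ht ((hdr hz θ).mul (hdψ hz θ)) (θ : Space)
      rw [hx1] at this
      have e : phi q ψ = fun w : Spacetime => w.1 ^ q * (radius * ψ) w := by
        funext w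
        simp only [phi, Pi.mul_apply]
        ring
      rw [e]
      refine Eq.trans ?_ this
      congr 1
      refine Prod.ext ?_ ?_ <;> simp
    have h4 : ∑ i, rotDeriv i f (z, θ) * rotDeriv i f (z, θ)
        = z.2 ^ 2 * (T ^ 2 * angularSq ψ x) := by
      rw [angularSq_eq, Finset.mul_sum, Finset.mul_sum]
      refine Finset.sum_congr rfl fun i _ => ?_
      have h5 := rotDeriv_eq_fderiv hgs (hdtwist hz θ) (fun θ' => htw (hZO (hmemZ hz θ'))) i
      have h6 := fderiv_time_mul (q := q) (x := x) ht (hdψ hz θ) (rot i x.2)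
      rw [hx1] at h6
      have h7 : rotDeriv i g (z, θ) = T * fderiv ℝ ψ x (0, rot i x.2) := h5.trans h6
      rw [show f = fun p => p.1.2 * g p from rfl, rotDeriv_radial_mul hgs, h7]
      ring
    have h5 : along (1, 1) f (z, θ) = z.2 * along (1, 0) g (z, θ) + along (0, 1) f (z, θ) := by
      have e : along (1, 1) f (z, θ) = along (1, 0) f (z, θ) + along (0, 1) f (z, θ) := by
        simp only [along, ← map_add]
        simp
      rw [e, show f = fun p => p.1.2 * g p from rfl, along_radial_mul hgs (1, 0)]
      simp
    have h6 : along (0, 1) f (z, θ) = z.2 * along (0, 1) g (z, θ) + g (z, θ) := by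
      rw [show f = fun p => p.1.2 * g p from rfl, along_radial_mul hgs]
      simp
    have h7 : f (z, θ) / z.2 = along (0, 1) f (z, θ) - z.2 * along (0, 1) g (z, θ) := by
      rw [h6, hgf]
      field_simp
      ring
    have hang : 0 ≤ angularSq ψ x := by
      unfold angularSq
      positivity
    have hw : 0 < cosmicTime q z.1 ^ (-mu q) := Real.rpow_pos_of_pos ht _
    rw [energyDensityS, hx1, hxr, hT2, h4, h7, h5, h3, h1, h2]
    set a := dt (twist q ψ) x
    set b := dr ψ x
    set d := dr (fun w => radius w * ψ w) x
    have hrest : 0 ≤ z.2 ^ 2 * (cosmicTime q z.1 ^ (2 * q - 2) * ψ x ^ 2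
        + ψ x ^ 2 / (1 + z.2 ^ 2)) := by positivity
    have e1 : z.2 ^ 2 * (cosmicTime q z.1 ^ (-mu q) * T ^ 2 * (a ^ 2 + b ^ 2 + d ^ 2 / z.2 ^ 2
        + angularSq ψ x / z.2 ^ 2 + cosmicTime q z.1 ^ (2 * q - 2) * ψ x ^ 2
        + ψ x ^ 2 / (1 + z.2 ^ 2)))
        = cosmicTime q z.1 ^ (-mu q) * (T ^ 2 * (z.2 ^ 2 * a ^ 2 + z.2 ^ 2 * b ^ 2 + d ^ 2
          + angularSq ψ x + z.2 ^ 2 * (cosmicTime q z.1 ^ (2 * q - 2) * ψ x ^ 2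
          + ψ x ^ 2 / (1 + z.2 ^ 2)))) := by
      field_simp
      ring
    rw [e1, mul_left_comm 4]
    refine mul_le_mul_of_nonneg_left ?_ hw.le
    have e2 : z.2 ^ 2 * (T ^ 2 * angularSq ψ x) / z.2 ^ 2 = T ^ 2 * angularSq ψ x := by
      field_simp
    rw [e2]
    have e3 := mul_nonneg (sq_nonneg T) hrest
    have e4 := mul_nonneg (sq_nonneg T) hang
    nlinarith [sq_nonneg (T * (z.2 * a - d)), sq_nonneg (T * (z.2 * b + d)), sq_nonneg (T * d),
      sq_nonneg (T * (z.2 * a)), sq_nonneg (T * (z.2 * b))]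

/-! ### Integrals with values in `[0, ∞]` -/

theorem lintegral_Ioc_ofReal {f : ℝ → ℝ} {a b : ℝ} (hab : a ≤ b)
    (hf : IntervalIntegrable f volume a b) (h0 : ∀ x ∈ Ioc a b, 0 ≤ f x) :
    ∫⁻ x in Ioc a b, ENNReal.ofReal (f x) = ENNReal.ofReal (∫ x in a..b, f x) := by
  rw [intervalIntegral.integral_of_le hab, ofReal_integral_eq_lintegral_ofReal
    ((intervalIntegrable_iff_integrableOn_Ioc_of_le hab).1 hf)
    ((ae_restrict_iff' measurableSet_Ioc).2 (.of_forall h0))]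

/-- Exhaustion of a half-line by bounded intervals. -/
theorem lintegral_Ici_le {k : ℝ → ℝ≥0∞} {a V₀ : ℝ} {R : ℝ≥0∞}
    (h : ∀ V ≥ V₀, ∫⁻ v in Ioc a V, k v ≤ R) : ∫⁻ v in Ici a, k v ≤ R := by
  rw [setLIntegral_congr Ioi_ae_eq_Ici.symm]
  have hU : Ioi a = ⋃ n : ℕ, Ioc a (n : ℝ) := by
    ext v
    simp only [mem_Ioi, mem_iUnion, mem_Ioc, exists_and_left, iff_self_and]
    exact fun _ => exists_nat_ge v
  have hmono : Monotone fun n : ℕ => Ioc a (n : ℝ) :=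
    fun m n hmn => Ioc_subset_Ioc_right (by exact_mod_cast hmn)
  rw [hU, setLIntegral_iUnion_of_directed k hmono.directed_le]
  refine iSup_le fun n => ?_
  refine (lintegral_mono_set (Ioc_subset_Ioc_right (le_max_left (n : ℝ) V₀))).trans ?_
  exact h _ (le_max_right _ _)

/-- Exhaustion of the far region `v > u + ρ` by trapezoids `u + ρ < v ≤ V`. -/
theorem lintegral_lintegral_Ioi_le {k : ℝ → ℝ → ℝ≥0∞} (hk : Measurable (Function.uncurry k))
    {I : Set ℝ} {ρ V₀ : ℝ} {R : ℝ≥0∞}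
    (h : ∀ V ≥ V₀, ∫⁻ u in I, ∫⁻ v in Ioc (u + ρ) V, k u v ≤ R) :
    ∫⁻ u in I, ∫⁻ v in Ioi (u + ρ), k u v ≤ R := by
  have hset : MeasurableSet {p : ℝ × ℝ | p.1 + ρ < p.2} :=
    measurableSet_lt (by fun_prop) (by fun_prop)
  have hinner (u : ℝ) : ∫⁻ v in Ioi (u + ρ), k u v
      = ⨆ n : ℕ, ∫⁻ v in Ioc (u + ρ) (n : ℝ), k u v := by
    have hU : Ioi (u + ρ) = ⋃ n : ℕ, Ioc (u + ρ) (n : ℝ) := by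
      ext v
      simp only [mem_Ioi, mem_iUnion, mem_Ioc, exists_and_left, iff_self_and]
      exact fun _ => exists_nat_ge v
    have hmono : Monotone fun n : ℕ => Ioc (u + ρ) (n : ℝ) :=
      fun m n hmn => Ioc_subset_Ioc_right (by exact_mod_cast hmn)
    rw [hU, setLIntegral_iUnion_of_directed _ hmono.directed_le]
  simp only [hinner]
  rw [lintegral_iSup]
  · refine iSup_le fun n => ?_
    refine (lintegral_mono fun u => lintegral_mono_set
      (Ioc_subset_Ioc_right (le_max_left (n : ℝ) V₀))).trans ?_
    exact h _ (le_max_right _ _)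
  · intro n
    have hs : MeasurableSet {p : ℝ × ℝ | p.2 ∈ Ioc (p.1 + ρ) (n : ℝ)} :=
      hset.inter (measurableSet_le measurable_snd measurable_const)
    have hm := (hk.indicator hs).lintegral_prod_right' (ν := (volume : Measure ℝ))
    have he : (fun u => ∫⁻ v in Ioc (u + ρ) (n : ℝ), k u v) = fun u => ∫⁻ v,
        {p : ℝ × ℝ | p.2 ∈ Ioc (p.1 + ρ) (n : ℝ)}.indicator (Function.uncurry k) (u, v) := by
      funext u
      rw [← lintegral_indicator measurableSet_Ioc]
      rfl
    rw [he]
    exact hm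
  · intro m n hmn u
    exact lintegral_mono_set (Ioc_subset_Ioc_right (by exact_mod_cast hmn))

/-- Integration in polar coordinates on `ℝ³`. -/
theorem lintegral_polar {h : Space → ℝ≥0∞} (hh : Measurable h) :
    ∫⁻ x, h x = ∫⁻ r in Ioi (0 : ℝ), ∫⁻ θ : Sphere, ENNReal.ofReal (r ^ 2) * h (r • (θ : Space))
      ∂sphereMeasure := by
  have hmp := (volume : Measure Space).measurePreserving_homeomorphUnitSphereProd
  have hdim : Module.finrank ℝ Space - 1 = 2 := by simp
  rw [hdim] at hmp
  have hinv := hmp.symm (homeomorphUnitSphereProd Space).toMeasurableEquiv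
  have hmeas : Measurable fun p : Sphere × Ioi (0 : ℝ) => h ((p.2 : ℝ) • (p.1 : Space)) :=
    hh.comp (by fun_prop)
  have hmeas' : Measurable fun r : Ioi (0 : ℝ) =>
      ∫⁻ θ : Sphere, h ((r : ℝ) • (θ : Space)) ∂sphereMeasure := by
    unfold sphereMeasure
    exact hmeas.lintegral_prod_left'
  calc ∫⁻ x, h x = ∫⁻ x in ({(0 : Space)}ᶜ : Set Space), h x := by rw [restrict_compl_singleton]
    _ = ∫⁻ x : ({(0 : Space)}ᶜ : Set Space), h (x : Space)
          ∂((volume : Measure Space).comap Subtype.val) :=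
        (lintegral_subtype_comap (measurableSet_singleton (0 : Space)).compl h).symm
    _ = ∫⁻ p : Sphere × Ioi (0 : ℝ), h ((p.2 : ℝ) • (p.1 : Space))
          ∂((volume : Measure Space).toSphere.prod (Measure.volumeIoiPow 2)) := by
        rw [← hinv.lintegral_comp_emb
          (homeomorphUnitSphereProd Space).toMeasurableEquiv.symm.measurableEmbedding]
        rfl
    _ = ∫⁻ r : Ioi (0 : ℝ), ∫⁻ θ : Sphere, h ((r : ℝ) • (θ : Space)) ∂sphereMeasure
          ∂(Measure.volumeIoiPow 2) := lintegral_prod_symm _ hmeas.aemeasurable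
    _ = ∫⁻ r : Ioi (0 : ℝ), ENNReal.ofReal ((r : ℝ) ^ 2) *
          ∫⁻ θ : Sphere, h ((r : ℝ) • (θ : Space)) ∂sphereMeasure ∂(volume.comap Subtype.val) := by
        rw [Measure.volumeIoiPow, lintegral_withDensity_eq_lintegral_mul _ (by fun_prop) hmeas']
        rfl
    _ = ∫⁻ r in Ioi (0 : ℝ), ENNReal.ofReal (r ^ 2) *
          ∫⁻ θ : Sphere, h (r • (θ : Space)) ∂sphereMeasure :=
        lintegral_subtype_comap measurableSet_Ioi fun r : ℝ => ENNReal.ofReal (r ^ 2) *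
          ∫⁻ θ : Sphere, h (r • (θ : Space)) ∂sphereMeasure
    _ = _ := by
        refine lintegral_congr fun r => ?_
        rw [lintegral_const_mul]
        exact hh.comp (by fun_prop)

theorem lintegral_sphere_ofReal {G : Polar → ℝ} (hG : Continuous G) (z : ℝ × ℝ)
    (h0 : ∀ θ : Sphere, 0 ≤ G (z, θ)) :
    ∫⁻ θ : Sphere, ENNReal.ofReal (G (z, θ)) ∂sphereMeasure = ENNReal.ofReal (sphereInt G z) := by
  rw [sphereInt, ofReal_integral_eq_lintegral_ofReal
    (integrable_sphere (continuous_sphere_slice hG z)) (.of_forall h0)]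

/-- The integrand, in polar coordinates, through which the energy on the initial time slice enters:
up to the weight it is `|∂_v f|² + |∇̊ f|² / r² + f² / r²`. -/
noncomputable def sliceDensity (f : Polar → ℝ) (p : Polar) : ℝ :=
  along (1, 1) f p * along (1, 1) f p + (∑ i, rotDeriv i f p * rotDeriv i f p) / p.1.2 ^ 2
    + (f p / p.1.2) ^ 2

/-- The energy on the initial slice bounds the integral of `sliceDensity` in polar coordinates. -/
theorem Represents.lintegral_slice_le {q ρ τ₀ : ℝ} {ψ : Spacetime → ℝ} {g f : Polar → ℝ}
    (h : Represents q ρ τ₀ ψ g f) {τ : ℝ} (hτ : τ₀ ≤ τ) :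
    ∫⁻ r in Ioc 0 ρ, ∫⁻ θ : Sphere, ENNReal.ofReal (cosmicTime q (2 * τ) ^ (-mu q) *
      sliceDensity f ((2 * τ, r), θ)) ∂sphereMeasure
      ≤ 4 * integralS q ρ τ (energyDensityS q ψ) := by
  have hf := h.solution.contDiff
  set w := cosmicTime q (2 * τ) ^ (-mu q)
  set Q : Polar → ℝ := sliceDensity f with hQ
  have hQm : Measurable Q := by
    have h1 := (hf.along (1, 1)).continuous.measurable
    have h2 (i : Fin 3) := (hf.rotDeriv i).continuous.measurable
    have h3 := hf.continuous.measurable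
    have h4 : Measurable fun p : Polar => ∑ i, rotDeriv i f p * rotDeriv i f p :=
      Finset.measurable_sum _ fun i _ => (h2 i).mul (h2 i)
    have h5 : Measurable fun p : Polar => p.1.2 := by fun_prop
    exact ((h1.mul h1).add (h4.div (h5.pow_const 2))).add ((h3.div h5).pow_const 2)
  -- the density as a function on `ℝ³`
  set H : Space → ℝ≥0∞ := (Metric.closedBall (0 : Space) ρ).indicator fun x =>
    ENNReal.ofReal ((4 * ‖x‖ ^ 2)⁻¹ * (w * Q ((2 * τ, ‖x‖), ‖x‖⁻¹ • x))) with hH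
  have hHm : Measurable H := by
    refine Measurable.indicator ?_ Metric.isClosed_closedBall.measurableSet
    have : Measurable fun x : Space => (((2 * τ, ‖x‖), ‖x‖⁻¹ • x) : Polar) := by fun_prop
    have := hQm.comp this
    simp only [Function.comp_def] at this
    fun_prop
  have hle : ∫⁻ x, H x ≤ integralS q ρ τ (energyDensityS q ψ) := by
    rw [hH, lintegral_indicator Metric.isClosed_closedBall.measurableSet, integralS]
    have hne : ∀ᵐ x : Space, x ≠ 0 := by
      simp [ae_iff]
    refine lintegral_mono_ae ((ae_restrict_iff' Metric.isClosed_closedBall.measurableSet).2 ?_)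
    filter_upwards [hne] with x hx hxρ
    refine ENNReal.ofReal_le_ofReal ?_
    have hn : 0 < ‖x‖ := norm_pos_iff.2 hx
    have hxρ' : ‖x‖ ≤ ρ := by simpa using hxρ
    set θ : Sphere := ⟨‖x‖⁻¹ • x, by simp [norm_smul, hn.ne']⟩
    have hz : ((2 * τ, ‖x‖) : ℝ × ℝ) ∈ polarFuture ρ τ₀ :=
      ⟨hn, by show 2 * τ₀ ≤ 2 * τ; linarith, by show 2 * τ₀ - ρ + ‖x‖ ≤ 2 * τ; linarith⟩
    have hb := h.energy_bound _ hz θ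
    have hpt : polarPoint q (2 * τ, ‖x‖) θ = ((2 * (1 - q) * τ) ^ (1 / (1 - q)), x) := by
      refine Prod.ext ?_ ?_
      · simp only [polarPoint, cosmicTime]
        ring_nf
      · simp [polarPoint, θ, smul_smul, hn.ne']
    rw [hpt] at hb
    rw [inv_mul_le_iff₀ (by positivity)]
    refine hb.trans_eq ?_
    ring
  have hpolar : ∫⁻ x, H x = 4⁻¹ * ∫⁻ r in Ioc 0 ρ, ∫⁻ θ : Sphere, ENNReal.ofReal (w *
      Q ((2 * τ, r), θ)) ∂sphereMeasure := by
    rw [lintegral_polar hHm]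
    have hmeas : Measurable fun r : ℝ =>
        ∫⁻ θ : Sphere, ENNReal.ofReal (w * Q ((2 * τ, r), θ)) ∂sphereMeasure := by
      have h1 : Measurable fun p : ℝ × Sphere => (((2 * τ, p.1), (p.2 : Space)) : Polar) := by
        fun_prop
      have h2 := hQm.comp h1
      simp only [Function.comp_def] at h2
      have h3 : Measurable fun p : ℝ × Sphere =>
        ENNReal.ofReal (w * Q ((2 * τ, p.1), (p.2 : Space))) := by fun_prop
      exact h3.lintegral_prod_right'
    rw [← lintegral_const_mul _ hmeas, ← lintegral_indicator measurableSet_Ioi,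
      ← lintegral_indicator measurableSet_Ioc]
    refine lintegral_congr fun r => ?_
    by_cases hr : 0 < r
    · rw [indicator_of_mem (show r ∈ Ioi (0 : ℝ) from hr)]
      by_cases hrρ : r ≤ ρ
      · rw [indicator_of_mem (show r ∈ Ioc 0 ρ from ⟨hr, hrρ⟩)]
        rw [← lintegral_const_mul' _ _ (by simp)]
        refine lintegral_congr fun θ => ?_
        have hn : ‖r • (θ : Space)‖ = r := by simp [norm_smul, abs_of_pos hr]
        rw [hH, indicator_of_mem (by simpa [hn] using hrρ)]
        simp only [hn, smul_smul, inv_mul_cancel₀ hr.ne', one_smul]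
        rw [← ENNReal.ofReal_mul (by positivity),
          show (4 : ℝ≥0∞)⁻¹ = ENNReal.ofReal (4⁻¹) by
            rw [ENNReal.ofReal_inv_of_pos (by norm_num)]; norm_num,
          ← ENNReal.ofReal_mul (by norm_num)]
        congr 1
        field_simp
      · rw [indicator_of_notMem (fun hh => hrρ hh.2)]
        have : ∀ θ : Sphere, ENNReal.ofReal (r ^ 2) * H (r • (θ : Space)) = 0 := fun θ => by
          rw [hH, indicator_of_notMem, mul_zero]
          simpa [norm_smul, abs_of_pos hr] using hrρ
        simp [this]
    · rw [indicator_of_notMem (show r ∉ Ioi (0 : ℝ) from hr),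
        indicator_of_notMem (show r ∉ Ioc 0 ρ from fun hh => hr hh.1)]
  rw [hpolar] at hle
  calc _ = 4 * (4⁻¹ * ∫⁻ r in Ioc 0 ρ, ∫⁻ θ : Sphere, ENNReal.ofReal (w *
      Q ((2 * τ, r), θ)) ∂sphereMeasure) := by
        rw [← mul_assoc, ENNReal.mul_inv_cancel (by norm_num) (by norm_num), one_mul]
    _ ≤ _ := by gcongr

/-! ### The weighted estimate on spacetime -/

theorem null_mem_polarFuture {ρ τ₀ u v : ℝ} (hρ : 0 < ρ) (hu : τ₀ - ρ / 2 ≤ u) (hv : u + ρ ≤ v) :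
    (u + v, v - u) ∈ polarFuture ρ τ₀ :=
  ⟨by show 0 < v - u; linarith, by show 2 * τ₀ ≤ u + v; linarith,
    by show 2 * τ₀ - ρ + (v - u) ≤ u + v; linarith⟩

/-- The exponent `m` for which `t^(-μ_q) = ((1 - q) s)^(-2m)`. -/
noncomputable def weightExponent (q : ℝ) : ℝ := mu q / (2 * (1 - q))

theorem cosmicTime_rpow_neg_mu {q s : ℝ} (hq : q < 1) (hs : 0 < s) :
    cosmicTime q s ^ (-mu q) = ((1 - q) * s) ^ (-(2 * weightExponent q)) := by
  rw [cosmicTime_rpow hq hs, weightExponent]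
  congr 1
  have : 1 - q ≠ 0 := by linarith
  field_simp

theorem radius_polarPoint {q : ℝ} {z : ℝ × ℝ} (hz : 0 < z.2) (θ : Sphere) :
    radius (polarPoint q z θ) = z.2 := by
  simp [radius, polarPoint, norm_smul, abs_of_pos hz]

/-- Sphere integrals of the quadratic densities to which all integrands of the estimate reduce. -/
theorem lintegral_sphere_quadratic {f : Polar → ℝ} (hf : ContDiff ℝ ∞ f) {a b d : ℝ} (ha : 0 ≤ a)
    (hb : 0 ≤ b) (hd : 0 ≤ d) (z : ℝ × ℝ) :
    ∫⁻ θ : Sphere, ENNReal.ofReal (a * (along (1, 1) f (z, θ) * along (1, 1) f (z, θ))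
      + b * (∑ i, rotDeriv i f (z, θ) * rotDeriv i f (z, θ)) + d * (f (z, θ) * f (z, θ)))
      ∂sphereMeasure
      = ENNReal.ofReal (a * outgoingSq f z + b * angularInt f z + d * massInt f z) := by
  have h1 := (hf.along (1, 1)).continuous
  have h2 (i : Fin 3) := (hf.rotDeriv i).continuous
  have h3 := hf.continuous
  have hP : Continuous fun p : Polar => a * (along (1, 1) f p * along (1, 1) f p) := by fun_prop
  have hN : Continuous fun p : Polar => b * (∑ i, rotDeriv i f p * rotDeriv i f p) := by fun_prop
  have hM : Continuous fun p : Polar => d * (f p * f p) := by fun_prop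
  have hPN : Continuous fun p : Polar => a * (along (1, 1) f p * along (1, 1) f p)
      + b * (∑ i, rotDeriv i f p * rotDeriv i f p) := hP.add hN
  rw [lintegral_sphere_ofReal (G := fun p : Polar => a * (along (1, 1) f p * along (1, 1) f p)
      + b * (∑ i, rotDeriv i f p * rotDeriv i f p) + d * (f p * f p)) (hPN.add hM),
    sphereInt_add hPN hM, sphereInt_add hP hN, sphereInt_const_mul, sphereInt_const_mul,
    sphereInt_const_mul]
  · rfl
  · intro θ
    have := Finset.sum_nonneg fun i (_ : i ∈ Finset.univ) => mul_self_nonneg (rotDeriv i f (z, θ))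
    have := mul_self_nonneg (along (1, 1) f (z, θ))
    have := mul_self_nonneg (f (z, θ))
    positivity

section
variable {q ρ τ₀ p : ℝ} {ψ : Spacetime → ℝ} {g f : Polar → ℝ}

theorem Represents.rpFlux_eq (h : Represents q ρ τ₀ ψ g f) (hq : q < 1) (hρ : 0 < ρ) (hτ₀ : 0 < τ₀)
    {τ : ℝ} (hτ : τ₀ ≤ τ) :
    rpFlux q ρ p ψ τ = ∫⁻ v in Ici (τ - ρ / 2 + ρ), ENNReal.ofReal (currentU (1 - q)
      (weightExponent q) p (outgoingSq f) (τ - ρ / 2 + v, v - (τ - ρ / 2))) := by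
  refine setLIntegral_congr_fun measurableSet_Ici fun v hv => ?_
  have hz := null_mem_polarFuture (τ₀ := τ₀) hρ (by linarith : τ₀ - ρ / 2 ≤ τ - ρ / 2) hv
  generalize hze : (τ - ρ / 2 + v, v - (τ - ρ / 2)) = z at hz ⊢
  have hs : 0 < (1 - q) * z.1 := mul_pos (by linarith) (polarFuture_subset hτ₀ hz).1
  have hr := hz.1
  have key := lintegral_sphere_quadratic h.solution.contDiff
    (a := ((1 - q) * z.1) ^ (-(2 * weightExponent q)) * z.2 ^ p) (by positivity) le_rfl le_rfl z
  simp only [zero_mul, add_zero] at key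
  simp only [currentU]
  rw [← key]
  refine lintegral_congr fun θ => ?_
  rw [nullPoint_eq, hze, radius_polarPoint hr, h.dv_phi z hz,
    ← cosmicTime_rpow_neg_mu hq (polarFuture_subset hτ₀ hz).1, sq]
  rfl

/-- The flux through the initial time slice is controlled by the energy. Finiteness of the energy is
needed for `toReal` not to be a junk value. -/
theorem Represents.slice_flux_le (h : Represents q ρ τ₀ ψ g f) (hq : q < 1) (hρ : 0 < ρ)
    (hτ₀ : 0 < τ₀) (hp : 0 < p) {α β γ : ℝ} (hα : 0 ≤ α) (hβ : 0 ≤ β) (hγ : 0 ≤ γ) {τ : ℝ}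
    (hτ : τ₀ ≤ τ) (hE : integralS q ρ τ (energyDensityS q ψ) ≠ ⊤) {ε : ℝ} (hε : ε ∈ Ioc 0 ρ) :
    ∫ r in ε..ρ, (currentU (1 - q) (weightExponent q) p (outgoingSq f) (2 * τ, r)
      + currentV (1 - q) (weightExponent q) p α β γ (angularInt f) (massInt f) (2 * τ, r))
      ≤ ρ ^ p * (1 + hardyWeight α β γ (1 + ρ / (2 * τ₀))) *
        (4 * (integralS q ρ τ (energyDensityS q ψ)).toReal) := by
  have hf := h.solution.contDiff
  have hc : 0 < 1 - q := by linarith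
  set m := weightExponent q
  set H := hardyWeight α β γ (1 + ρ / (2 * τ₀)) with hH
  have hH0 : 0 ≤ H := by
    simp only [hH, hardyWeight]
    positivity
  set K := ρ ^ p * (1 + H) with hK
  have hK0 : 0 ≤ K := by positivity
  set F : ℝ × ℝ → ℝ := fun z => currentU (1 - q) m p (outgoingSq f) z
      + currentV (1 - q) m p α β γ (angularInt f) (massInt f) z with hF
  have hFc : ContinuousOn F quadrant :=
    (contDiffOn_currentU hc (contDiff_outgoingSq hf)).continuousOn.add
      (contDiffOn_currentV hc (contDiff_angularInt hf) (contDiff_massInt hf)).continuousOn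
  have hmem {r : ℝ} (hr : r ∈ Ioc 0 ρ) : (2 * τ, r) ∈ polarFuture ρ τ₀ :=
    ⟨hr.1, by show 2 * τ₀ ≤ 2 * τ; linarith, by show 2 * τ₀ - ρ + r ≤ 2 * τ; linarith [hr.2]⟩
  have hsub : Ioc ε ρ ⊆ Ioc 0 ρ := Ioc_subset_Ioc_left hε.1.le
  have hint : IntervalIntegrable (fun r => F (2 * τ, r)) volume ε ρ := by
    refine ContinuousOn.intervalIntegrable ?_
    rw [uIcc_of_le hε.2]
    exact hFc.comp (by fun_prop) fun r hr =>
      polarFuture_subset hτ₀ (hmem ⟨hε.1.trans_le hr.1, hr.2⟩)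
  have hnonneg : ∀ r ∈ Ioc ε ρ, 0 ≤ F (2 * τ, r) := fun r hr => by
    have hz := polarFuture_subset hτ₀ (hmem (hsub hr))
    exact add_nonneg (currentU_nonneg hc hz) (currentV_nonneg hc hα hβ hγ hz)
  have hpt : ∀ r ∈ Ioc 0 ρ, ENNReal.ofReal (F (2 * τ, r)) ≤ ENNReal.ofReal K *
      ∫⁻ θ : Sphere, ENNReal.ofReal (cosmicTime q (2 * τ) ^ (-mu q) *
        sliceDensity f ((2 * τ, r), θ)) ∂sphereMeasure := by
    intro r hr
    have hz := hmem hr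
    have hr0 := hr.1
    have hs := (polarFuture_subset hτ₀ hz).1
    have hx := div_mem_of_mem_polarFuture hρ hτ₀ hz
    simp only [mem_Ioi] at hs
    rw [cosmicTime_rpow_neg_mu hq hs]
    set w := ((1 - q) * (2 * τ)) ^ (-(2 * m)) with hw
    have hw0 : 0 ≤ w := by positivity
    have key := lintegral_sphere_quadratic hf (a := w) (b := w / r ^ 2) (d := w / r ^ 2) hw0
      (by positivity) (by positivity) (2 * τ, r)
    have hcongr (θ : Sphere) : w * sliceDensity f ((2 * τ, r), θ)
        = w * (along (1, 1) f ((2 * τ, r), θ) * along (1, 1) f ((2 * τ, r), θ))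
          + w / r ^ 2 * (∑ i, rotDeriv i f ((2 * τ, r), θ) * rotDeriv i f ((2 * τ, r), θ))
          + w / r ^ 2 * (f ((2 * τ, r), θ) * f ((2 * τ, r), θ)) := by
      simp only [sliceDensity]
      field_simp
    simp only [hcongr]
    rw [key, ← ENNReal.ofReal_mul hK0]
    refine ENNReal.ofReal_le_ofReal ?_
    have hP := outgoingSq_nonneg f (2 * τ, r)
    have hN := angularInt_nonneg f (2 * τ, r)
    have hM := massInt_nonneg f (2 * τ, r)
    simp only [hF, currentU, currentV]
    rw [show p - 2 = p - (2 : ℕ) by norm_num, Real.rpow_sub_natCast hr0.ne', ← hw]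
    simp only at hx
    have hHx : hardyWeight α β γ (r / (2 * τ)) ≤ H := by
      have := hx.1
      have := hx.2
      simp only [hH, hardyWeight]
      gcongr
    have hrp : r ^ p ≤ ρ ^ p := Real.rpow_le_rpow hr0.le hr.2 hp.le
    have hrp0 : 0 ≤ r ^ p := by positivity
    calc w * r ^ p * outgoingSq f (2 * τ, r) + w * (r ^ p / r ^ 2) * (angularInt f (2 * τ, r)
          + hardyWeight α β γ (r / (2 * τ)) * massInt f (2 * τ, r))
        ≤ w * r ^ p * ((1 + H) * outgoingSq f (2 * τ, r)) + w * (r ^ p / r ^ 2) *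
          ((1 + H) * angularInt f (2 * τ, r) + (1 + H) * massInt f (2 * τ, r)) := by
          gcongr
          · nlinarith
          · nlinarith
          · linarith
      _ = r ^ p * ((1 + H) * (w * outgoingSq f (2 * τ, r) + w / r ^ 2 * angularInt f (2 * τ, r)
          + w / r ^ 2 * massInt f (2 * τ, r))) := by ring
      _ ≤ ρ ^ p * ((1 + H) * (w * outgoingSq f (2 * τ, r) + w / r ^ 2 * angularInt f (2 * τ, r)
          + w / r ^ 2 * massInt f (2 * τ, r))) := by gcongr
      _ = _ := by rw [hK]; ring
  have hfinal : ENNReal.ofReal (∫ r in ε..ρ, F (2 * τ, r))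
      ≤ ENNReal.ofReal (K * (4 * (integralS q ρ τ (energyDensityS q ψ)).toReal)) := by
    rw [← lintegral_Ioc_ofReal hε.2 hint hnonneg]
    calc _ ≤ ∫⁻ r in Ioc 0 ρ, ENNReal.ofReal (F (2 * τ, r)) := lintegral_mono_set hsub
      _ ≤ ∫⁻ r in Ioc 0 ρ, ENNReal.ofReal K *
          ∫⁻ θ : Sphere, ENNReal.ofReal (cosmicTime q (2 * τ) ^ (-mu q) *
            sliceDensity f ((2 * τ, r), θ)) ∂sphereMeasure :=
          setLIntegral_mono' measurableSet_Ioc hpt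
      _ ≤ ENNReal.ofReal K * (4 * integralS q ρ τ (energyDensityS q ψ)) := by
          rw [lintegral_const_mul' _ _ ENNReal.ofReal_ne_top]
          gcongr
          exact h.lintegral_slice_le hτ
      _ = _ := by
          rw [ENNReal.ofReal_mul (p := K) hK0, ENNReal.ofReal_mul (p := 4) (by norm_num), ENNReal.ofReal_toReal hE]
          norm_num
  exact (ENNReal.ofReal_le_ofReal_iff (by positivity)).1 hfinal

/-- The estimate for a bulk integrand `FB` and an integrand `FS` at null infinity which, integrated
over spheres, are controlled by the bulk density and by the current through the cones `v = V`. -/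
theorem Represents.estimate (h : Represents q ρ τ₀ ψ g f) (hq : q < 1) (hρ : 0 < ρ) (hτ₀ : 0 < τ₀)
    (hm : 0 ≤ weightExponent q) (hp : 0 < p) (hp2 : p ≤ 2) {α β γ c₀ c₁ : ℝ}
    (hα : 0 ≤ α) (hβ : 0 ≤ β) (hγ : 0 ≤ γ) (h₀ : 0 ≤ c₀) (h₁ : 0 ≤ c₁)
    (hco : Coercive (weightExponent q) (potentialConst q) p α β γ (1 + ρ / (2 * τ₀)) c₀ c₁)
    {CB CS : ℝ} (hCB : 0 ≤ CB) (hCS : 0 ≤ CS) {FB FS : Spacetime → ℝ}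
    (hFB : ∀ z ∈ polarFuture ρ τ₀, ∫⁻ θ : Sphere, ENNReal.ofReal (FB (polarPoint q z θ))
      ∂sphereMeasure ≤ ENNReal.ofReal (CB * bulkDensity (1 - q) (weightExponent q) p c₀ c₁ f z))
    (hFS : ∀ z ∈ polarFuture ρ τ₀, ∫⁻ θ : Sphere, ENNReal.ofReal (FS (polarPoint q z θ))
      ∂sphereMeasure ≤ ENNReal.ofReal (CS * currentV (1 - q) (weightExponent q) p α β γ
        (angularInt f) (massInt f) z))
    {τ₁ τ₂ : ℝ} (hτ₁ : τ₀ ≤ τ₁) (hτ : τ₁ ≤ τ₂) :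
    integralD q ρ τ₁ τ₂ FB + rpFlux q ρ p ψ τ₂ + integralScri q ρ τ₁ τ₂ FS
      ≤ ENNReal.ofReal (CB + 1 + CS) * (rpFlux q ρ p ψ τ₁
        + ENNReal.ofReal (2 * (ρ ^ p * (1 + hardyWeight α β γ (1 + ρ / (2 * τ₀)))))
          * integralS q ρ τ₁ (energyDensityS q ψ)) := by
  have hf := h.solution.contDiff
  have hc : 0 < 1 - q := by linarith
  have hflux₁ := h.rpFlux_eq (p := p) hq hρ hτ₀ hτ₁
  have hflux₂ := h.rpFlux_eq (p := p) hq hρ hτ₀ (hτ₁.trans hτ)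
  set m := weightExponent q
  set K := ρ ^ p * (1 + hardyWeight α β γ (1 + ρ / (2 * τ₀))) with hK
  have hKpos : 0 < K := by
    simp only [hK, hardyWeight]
    positivity
  set E := integralS q ρ τ₁ (energyDensityS q ψ) with hEdef
  -- for infinite energy there is nothing to prove, as `K > 0`
  by_cases hE : E = ⊤
  · rw [hE, ENNReal.mul_top (by simpa using hKpos), add_top, ENNReal.mul_top]
    · exact le_top
    · simp only [ne_eq, ENNReal.ofReal_eq_zero, not_le]
      linarith
  set R := rpFlux q ρ p ψ τ₁ + ENNReal.ofReal (2 * K) * E with hR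
  have hD := fun ε (hε : ε ∈ Ioc 0 ρ) =>
    h.slice_flux_le hq hρ hτ₀ hp hα hβ hγ hτ₁ hE hε
  set u₁ := τ₁ - ρ / 2 with hu₁
  set u₂ := τ₂ - ρ / 2 with hu₂
  have hu : u₁ ≤ u₂ := by linarith
  have hu₁0 : 0 < 2 * u₁ + ρ := by linarith
  have hnull {u v : ℝ} (hu' : u₁ ≤ u) (hv : u + ρ ≤ v) : (u + v, v - u) ∈ polarFuture ρ τ₀ :=
    null_mem_polarFuture hρ (by linarith) hv
  have hquad {u v : ℝ} (hu' : u₁ ≤ u) (hv : u + ρ ≤ v) : (u + v, v - u) ∈ quadrant :=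
    polarFuture_subset hτ₀ (hnull hu' hv)
  set A := currentU (1 - q) m p (outgoingSq f)
  set B := currentV (1 - q) m p α β γ (angularInt f) (massInt f)
  set b := bulkDensity (1 - q) m p c₀ c₁ f with hb
  have hA0 {z : ℝ × ℝ} (hz : z ∈ quadrant) : 0 ≤ A z := currentU_nonneg hc hz
  have hB0 {z : ℝ × ℝ} (hz : z ∈ quadrant) : 0 ≤ B z := currentV_nonneg hc hα hβ hγ hz
  have hb0 {z : ℝ × ℝ} (hz : z ∈ quadrant) : 0 ≤ b z := bulkDensity_nonneg hc hp2 h₀ h₁ hz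
  have hAc : ContinuousOn A quadrant :=
    (contDiffOn_currentU hc (contDiff_outgoingSq hf)).continuousOn
  have hBc : ContinuousOn B quadrant :=
    (contDiffOn_currentV hc (contDiff_angularInt hf) (contDiff_massInt hf)).continuousOn
  have hbc : ContinuousOn b quadrant := continuousOn_bulkDensity hc hf
  have hcone {F : ℝ × ℝ → ℝ} (hF : ContinuousOn F quadrant) {u V : ℝ} (hu' : u₁ ≤ u)
      (hV : u + ρ ≤ V) : IntervalIntegrable (fun v => F (u + v, v - u)) volume (u + ρ) V := by
    refine ContinuousOn.intervalIntegrable ?_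
    rw [uIcc_of_le hV]
    exact continuousOn_cone_slice hF hρ (by linarith)
  -- the three terms on the left for the region truncated at `v = V`
  have htrunc (V : ℝ) (hV : u₂ + ρ ≤ V) :
      ∫⁻ u in Icc u₁ u₂, ∫⁻ v in Ioc (u + ρ) V, ENNReal.ofReal (b (u + v, v - u)) ≤ R ∧
      ∫⁻ v in Ioc (u₂ + ρ) V, ENNReal.ofReal (A (u₂ + v, v - u₂)) ≤ R ∧
      ∫⁻ u in Icc u₁ u₂, ENNReal.ofReal (B (u + V, V - u)) ≤ R := by
    have hest := h.solution.truncated_estimate hc hm hρ hτ₀ hp hp2 hα hβ hγ h₀ h₁ hco hτ₁ hτ hV hD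
    set X := ∫ u in u₁..u₂, ∫ v in (u + ρ)..V, b (u + v, v - u)
    set Y := ∫ v in (u₂ + ρ)..V, A (u₂ + v, v - u₂)
    set Z := ∫ u in u₁..u₂, B (u + V, V - u)
    set W := ∫ v in (u₁ + ρ)..V, A (u₁ + v, v - u₁)
    have hinner {u : ℝ} (hu' : u ∈ Icc u₁ u₂) :
        0 ≤ ∫ v in (u + ρ)..V, b (u + v, v - u) :=
      intervalIntegral.integral_nonneg (by linarith [hu'.2]) fun v hv => hb0 (hquad hu'.1 hv.1)
    have hX0 : 0 ≤ X := intervalIntegral.integral_nonneg hu fun u hu' => hinner hu'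
    have hY0 : 0 ≤ Y := intervalIntegral.integral_nonneg hV fun v hv => hA0 (hquad hu hv.1)
    have hZ0 : 0 ≤ Z := intervalIntegral.integral_nonneg hu fun u hu' =>
      hB0 (hquad hu'.1 (by linarith [hu'.2]))
    have hXe : ∫⁻ u in Icc u₁ u₂, ∫⁻ v in Ioc (u + ρ) V, ENNReal.ofReal (b (u + v, v - u))
        = ENNReal.ofReal X := by
      rw [setLIntegral_congr Ioc_ae_eq_Icc.symm, ← lintegral_Ioc_ofReal hu
        (intervalIntegrable_trapezoid hbc hρ hu hu₁0 hV) fun u hu' => hinner (Ioc_subset_Icc_self hu')]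
      refine setLIntegral_congr_fun measurableSet_Ioc fun u hu' => ?_
      have huV : u + ρ ≤ V := by linarith [hu'.2]
      exact lintegral_Ioc_ofReal huV (hcone hbc hu'.1.le huV) fun v hv =>
        hb0 (hquad hu'.1.le hv.1.le)
    have hYe : ∫⁻ v in Ioc (u₂ + ρ) V, ENNReal.ofReal (A (u₂ + v, v - u₂)) = ENNReal.ofReal Y :=
      lintegral_Ioc_ofReal hV (hcone hAc hu hV) fun v hv => hA0 (hquad hu hv.1.le)
    have hZe : ∫⁻ u in Icc u₁ u₂, ENNReal.ofReal (B (u + V, V - u)) = ENNReal.ofReal Z := by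
      rw [setLIntegral_congr Ioc_ae_eq_Icc.symm]
      refine lintegral_Ioc_ofReal hu ?_ fun u hu' => hB0 (hquad hu'.1.le (by linarith [hu'.2]))
      refine ContinuousOn.intervalIntegrable ?_
      rw [uIcc_of_le hu]
      exact hBc.comp (f := fun u => (u + V, V - u)) (by fun_prop) fun u hu' =>
        hquad hu'.1 (by linarith [hu'.2])
    have hWe : ENNReal.ofReal W ≤ rpFlux q ρ p ψ τ₁ := by
      have huV : u₁ + ρ ≤ V := by linarith
      rw [hflux₁, ← lintegral_Ioc_ofReal huV (hcone hAc le_rfl huV)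
        fun v hv => hA0 (hquad le_rfl hv.1.le)]
      exact lintegral_mono_set fun v hv => hv.1.le
    have hbound : ENNReal.ofReal (W + K * (4 * E.toReal) / 2) ≤ R := by
      refine ENNReal.ofReal_add_le.trans (add_le_add hWe ?_)
      rw [show K * (4 * E.toReal) / 2 = 2 * K * E.toReal by ring,
        ENNReal.ofReal_mul (by positivity), ENNReal.ofReal_toReal hE]
    rw [hXe, hYe, hZe]
    exact ⟨(ENNReal.ofReal_le_ofReal (by linarith)).trans hbound,
      (ENNReal.ofReal_le_ofReal (by linarith)).trans hbound,
      (ENNReal.ofReal_le_ofReal (by linarith)).trans hbound⟩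
  have hbulk : integralD q ρ τ₁ τ₂ FB ≤ ENNReal.ofReal CB * R := by
    have hmeas : Measurable (Function.uncurry fun u v : ℝ => ENNReal.ofReal (b (u + v, v - u))) := by
      have h1 := (contDiff_outgoingSq hf).continuous.measurable
      have h2 := (contDiff_massInt hf).continuous.measurable
      have h3 := (contDiff_angularInt hf).continuous.measurable
      have h4 : Measurable b := by
        rw [hb]
        unfold bulkDensity
        fun_prop
      have h5 : Measurable fun y : ℝ × ℝ => (y.1 + y.2, y.2 - y.1) := by fun_prop
      exact (h4.comp h5).ennreal_ofReal
    calc integralD q ρ τ₁ τ₂ FB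
        ≤ ∫⁻ u in Icc u₁ u₂, ∫⁻ v in Ioi (u + ρ), ENNReal.ofReal CB *
            ENNReal.ofReal (b (u + v, v - u)) := by
          refine setLIntegral_mono' measurableSet_Icc fun u hu' =>
            setLIntegral_mono' measurableSet_Ioi fun v hv => ?_
          rw [← ENNReal.ofReal_mul hCB]
          simp only [nullPoint_eq]
          exact hFB _ (hnull hu'.1 (le_of_lt hv))
      _ = ENNReal.ofReal CB * ∫⁻ u in Icc u₁ u₂, ∫⁻ v in Ioi (u + ρ),
            ENNReal.ofReal (b (u + v, v - u)) := by
          simp only [lintegral_const_mul' _ _ ENNReal.ofReal_ne_top]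
      _ ≤ ENNReal.ofReal CB * R := by
          gcongr
          exact lintegral_lintegral_Ioi_le hmeas fun V hV => (htrunc V hV).1
  have hcone₂ : rpFlux q ρ p ψ τ₂ ≤ R := by
    rw [hflux₂]
    exact lintegral_Ici_le fun V hV => (htrunc V hV).2.1
  have hscri : integralScri q ρ τ₁ τ₂ FS ≤ ENNReal.ofReal CS * R := by
    refine limsup_le_of_le (by isBoundedDefault) ?_
    filter_upwards [eventually_ge_atTop (u₂ + ρ)] with V hV
    calc _ ≤ ∫⁻ u in Icc u₁ u₂, ENNReal.ofReal CS * ENNReal.ofReal (B (u + V, V - u)) := by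
          refine setLIntegral_mono' measurableSet_Icc fun u hu' => ?_
          rw [← ENNReal.ofReal_mul hCS]
          simp only [nullPoint_eq]
          exact hFS _ (hnull hu'.1 (by linarith [hu'.2]))
      _ = ENNReal.ofReal CS * ∫⁻ u in Icc u₁ u₂, ENNReal.ofReal (B (u + V, V - u)) :=
          lintegral_const_mul' _ _ ENNReal.ofReal_ne_top
      _ ≤ _ := by
          gcongr
          exact (htrunc V hV).2.2
  calc _ ≤ ENNReal.ofReal CB * R + R + ENNReal.ofReal CS * R := by gcongr
    _ = _ := by
        rw [ENNReal.ofReal_add (by linarith) hCS, ENNReal.ofReal_add hCB zero_le_one,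
          ENNReal.ofReal_one]
        ring

end

/-- Passage from the energy on `𝒮_τ` to the full energy, with a single constant. -/
theorem le_toNNReal_mul_energy {q ρ τ S K : ℝ} {ψ : Spacetime → ℝ} {L F : ℝ≥0∞} (hS : 0 ≤ S)
    (hK : 0 ≤ K)
    (h : L ≤ ENNReal.ofReal S * (F + ENNReal.ofReal K * integralS q ρ τ (energyDensityS q ψ))) :
    L ≤ ((S * (1 + K)).toNNReal : ℝ≥0∞) * (F + energy q ρ ψ τ) := by
  refine h.trans ?_
  have e : ((S * (1 + K)).toNNReal : ℝ≥0∞) = ENNReal.ofReal S * ENNReal.ofReal (1 + K) :=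
    ENNReal.ofReal_mul hS
  have h1 : ENNReal.ofReal K ≤ ENNReal.ofReal (1 + K) := ENNReal.ofReal_le_ofReal (by linarith)
  have h2 : 1 ≤ ENNReal.ofReal (1 + K) := by
    rw [ENNReal.one_le_ofReal]
    linarith
  have h3 : integralS q ρ τ (energyDensityS q ψ) ≤ energy q ρ ψ τ := le_self_add
  rw [e, mul_assoc, mul_add (ENNReal.ofReal (1 + K))]
  gcongr
  exact le_mul_of_one_le_left (zero_le) h2

/-- The weighted estimate for exponents `p < 2` at which the divergence is coercive. -/
theorem exists_estimate_of_coercive {q ρ τ₀ p : ℝ} (hq : q < 1) (hρ : 0 < ρ) (hτ₀ : 0 < τ₀)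
    (hm : 0 ≤ weightExponent q) (hp : 0 < p) (hp2 : p < 2) {α β γ c₀ : ℝ} (hα : 0 ≤ α)
    (hβ : 0 ≤ β) (hγ : 0 < γ) (h₀ : 0 < c₀)
    (hco : Coercive (weightExponent q) (potentialConst q) p α β γ (1 + ρ / (2 * τ₀)) c₀ c₀) :
    ∃ C : ℝ≥0, ∀ ψ : Spacetime → ℝ, IsSolution q ρ τ₀ ψ → ∀ τ₁ τ₂ : ℝ, τ₀ ≤ τ₁ → τ₁ < τ₂ →
      rpBulk q ρ p ψ τ₁ τ₂ + rpFlux q ρ p ψ τ₂ + rpScri q ρ p ψ τ₁ τ₂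
        ≤ C * (rpFlux q ρ p ψ τ₁ + energy q ρ ψ τ₁) := by
  have h2p : 0 < 2 - p := by linarith
  set CB := 3 / c₀ + 1 / (2 - p) with hCB
  set CS := 1 + 1 / γ with hCS
  have hCB0 : 0 ≤ CB := by positivity
  have hCS0 : 0 ≤ CS := by positivity
  refine ⟨((CB + 1 + CS) * (1 + 2 * (ρ ^ p * (1 + hardyWeight α β γ (1 + ρ / (2 * τ₀)))))).toNNReal,
    fun ψ hψ τ₁ τ₂ hτ₁ hτ => ?_⟩
  obtain ⟨g, f, h⟩ := exists_represents hq hτ₀ hψ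
  have hf := h.solution.contDiff
  refine le_toNNReal_mul_energy (by linarith)
    (by simp only [hardyWeight]; positivity)
    (h.estimate hq hρ hτ₀ hm hp hp2.le hα hβ hγ.le h₀.le h₀.le hco hCB0 hCS0 ?_ ?_ hτ₁ hτ.le)
  · intro z hz
    have hr := hz.1
    have hs := (polarFuture_subset hτ₀ hz).1
    have hc : 0 < (1 - q) * z.1 := mul_pos (by linarith) hs
    set w := ((1 - q) * z.1) ^ (-(2 * weightExponent q)) with hw
    set W := w * z.2 ^ (p - 1) with hW
    have hW0 : 0 ≤ W := by positivity
    refine (lintegral_mono fun θ => ENNReal.ofReal_le_ofReal ?_).trans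
      ((lintegral_sphere_quadratic hf (a := W * 3) (b := W / z.2 ^ 2) (d := W * (3 / z.2 ^ 2))
        (by positivity) (by positivity) (by positivity) z).trans_le
        (ENNReal.ofReal_le_ofReal ?_))
    · have htw := h.dv_twist z hz θ
      have e : radius (polarPoint q z θ) ^ 2 * dv q (twist q ψ) (polarPoint q z θ) ^ 2
          = (along (1, 1) f (z, θ) - f (z, θ) / z.2) ^ 2 := by
        rw [radius_polarPoint hr, ← htw]
        ring
      rw [e, radius_polarPoint hr, h.dv_phi z hz, h.angularSq_phi z hz, h.phi_eq z hz,
        show (polarPoint q z θ).1 = cosmicTime q z.1 from rfl, cosmicTime_rpow_neg_mu hq hs, ← hw,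
        ← hW]
      -- `r ∂_v (t^q ψ) = ∂_v φ - φ / r`
      have hsq : (along (1, 1) f (z, θ) - f (z, θ) / z.2) ^ 2
          ≤ 2 * along (1, 1) f (z, θ) ^ 2 + 2 * (f (z, θ) / z.2) ^ 2 := by
        nlinarith [sq_nonneg (along (1, 1) f (z, θ) + f (z, θ) / z.2)]
      rw [div_pow] at hsq
      refine (mul_le_mul_of_nonneg_left (show _ ≤ 3 * along (1, 1) f (z, θ) ^ 2
        + (∑ i, rotDeriv i f (z, θ) * rotDeriv i f (z, θ)) / z.2 ^ 2
        + 3 * (f (z, θ) ^ 2 / z.2 ^ 2) by linarith) hW0).trans_eq ?_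
      ring
    · have hP := outgoingSq_nonneg f z
      have hN := angularInt_nonneg f z
      have hM := massInt_nonneg f z
      rw [bulkDensity, ← hw, ← hW]
      set N := angularInt f z / z.2 ^ 2 with hNdef
      set M := massInt f z / z.2 ^ 2 with hMdef
      have hN0 : 0 ≤ N := by positivity
      have hM0 : 0 ≤ M := by positivity
      have e1 : W * 3 * outgoingSq f z + W / z.2 ^ 2 * angularInt f z
          + W * (3 / z.2 ^ 2) * massInt f z = W * (3 * outgoingSq f z + N + 3 * M) := by
        rw [hNdef, hMdef]
        ring
      have e2 : CB * (W * (c₀ * outgoingSq f z + c₀ * M + (2 - p) * N))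
          = W * (3 * outgoingSq f z + N + 3 * M) + W * (3 / c₀ * (2 - p) * N
            + 1 / (2 - p) * c₀ * (outgoingSq f z + M)) := by
        rw [hCB]
        field_simp
        ring
      rw [e1, e2]
      refine le_add_of_nonneg_right ?_
      positivity
  · intro z hz
    have hr := hz.1
    have hs := (polarFuture_subset hτ₀ hz).1
    have hc : 0 < (1 - q) * z.1 := mul_pos (by linarith) hs
    set w := ((1 - q) * z.1) ^ (-(2 * weightExponent q)) with hw
    set W := w * z.2 ^ (p - 2) with hW
    have hW0 : 0 ≤ W := by positivity
    refine (lintegral_mono fun θ => ENNReal.ofReal_le_ofReal ?_).trans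
      ((lintegral_sphere_quadratic hf (a := 0) (b := W) (d := W) le_rfl hW0 hW0 z).trans_le
        (ENNReal.ofReal_le_ofReal ?_))
    · rw [radius_polarPoint hr, h.angularSq_phi z hz, h.phi_eq z hz,
        show (polarPoint q z θ).1 = cosmicTime q z.1 from rfl, cosmicTime_rpow_neg_mu hq hs, ← hw,
        ← hW]
      exact le_of_eq (by ring)
    · have hN := angularInt_nonneg f z
      have hM := massInt_nonneg f z
      have hx := (div_mem_of_mem_polarFuture hρ hτ₀ hz).1
      have hH : γ ≤ hardyWeight α β γ (z.2 / z.1) := by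
        rw [hardyWeight]
        have : 0 ≤ α * (z.2 / z.1) ^ 2 + β * (z.2 / z.1) := by positivity
        linarith
      rw [currentV, ← hw, ← hW]
      have h1 : massInt f z ≤ CS * (hardyWeight α β γ (z.2 / z.1) * massInt f z) := by
        have h2 : 1 ≤ CS * hardyWeight α β γ (z.2 / z.1) := by
          calc 1 ≤ CS * γ := by
                rw [hCS]
                field_simp
                linarith
            _ ≤ _ := by gcongr
        rw [← mul_assoc]
        exact le_mul_of_one_le_left hM h2
      have h3 : angularInt f z ≤ CS * angularInt f z := by
        refine le_mul_of_one_le_left hN ?_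
        have : 0 < 1 / γ := by positivity
        linarith
      calc _ = W * (angularInt f z + massInt f z) := by ring
        _ ≤ W * (CS * angularInt f z + CS * (hardyWeight α β γ (z.2 / z.1) * massInt f z)) := by
            gcongr
        _ = _ := by ring

/-- The estimate with `p = 2` when `q = 1/2`. -/
theorem exists_estimate_endpoint {ρ τ₀ : ℝ} (hρ : 0 < ρ) (hτ₀ : 0 < τ₀) :
    ∃ C : ℝ≥0, ∀ ψ : Spacetime → ℝ, IsSolution (1 / 2) ρ τ₀ ψ → ∀ τ₁ τ₂ : ℝ, τ₀ ≤ τ₁ → τ₁ < τ₂ →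
      integralD (1 / 2) ρ τ₁ τ₂ (fun z => radius z * dv (1 / 2) (phi (1 / 2) ψ) z ^ 2)
          + rpFlux (1 / 2) ρ 2 ψ τ₂
          + integralScri (1 / 2) ρ τ₁ τ₂ (fun z => angularSq (phi (1 / 2) ψ) z)
        ≤ C * (rpFlux (1 / 2) ρ 2 ψ τ₁ + energy (1 / 2) ρ ψ τ₁) := by
  have hm : weightExponent (1 / 2) = 0 := by norm_num [weightExponent, mu]
  have hκ : potentialConst (1 / 2) = 0 := by norm_num [potentialConst]
  have hq : (1 / 2 : ℝ) < 1 := by norm_num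
  refine ⟨((1 + 1 + 1) * (1 + 2 * (ρ ^ (2 : ℝ) * (1 + hardyWeight 0 0 0 (1 + ρ / (2 * τ₀)))))).toNNReal,
    fun ψ hψ τ₁ τ₂ hτ₁ hτ => ?_⟩
  obtain ⟨g, f, h⟩ := exists_represents hq hτ₀ hψ
  have hf := h.solution.contDiff
  refine le_toNNReal_mul_energy (by norm_num) (by simp only [hardyWeight]; positivity)
    (h.estimate hq hρ hτ₀ hm.ge two_pos le_rfl le_rfl le_rfl le_rfl zero_le_two le_rfl
      (by rw [hm, hκ]; exact coercive_endpoint _) zero_le_one zero_le_one ?_ ?_ hτ₁ hτ.le)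
  · intro z hz
    have hr := hz.1
    have hP := outgoingSq_nonneg f z
    refine (lintegral_mono fun θ => ENNReal.ofReal_le_ofReal ?_).trans
      ((lintegral_sphere_quadratic hf (a := z.2) (b := 0) (d := 0) hr.le le_rfl le_rfl z).trans_le
        (ENNReal.ofReal_le_ofReal ?_))
    · rw [radius_polarPoint hr, h.dv_phi z hz]
      exact le_of_eq (by ring)
    · have e : (2 : ℝ) - 1 = 1 := by norm_num
      simp only [bulkDensity, hm, e, mul_zero, neg_zero, Real.rpow_zero, Real.rpow_one]
      nlinarith [mul_nonneg hr.le hP]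
  · intro z hz
    have hr := hz.1
    refine (lintegral_mono fun θ => ENNReal.ofReal_le_ofReal ?_).trans
      ((lintegral_sphere_quadratic hf (a := 0) (b := 1) (d := 0) le_rfl zero_le_one le_rfl
        z).trans_le (ENNReal.ofReal_le_ofReal ?_))
    · rw [h.angularSq_phi z hz]
      exact le_of_eq (by ring)
    · simp only [currentV, hardyWeight, hm]
      norm_num

end FLRW

theorem theorem1p3 (q ρ τ₀ : ℝ) (hq₀ : 0 < q) (hq₁ : q < 1) (hρ : 0 < ρ) (hτ₀ : 0 < τ₀) :
    (∀ p : ℝ, 0 < p → p < max 1 (2 - FLRW.sigma q) →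
      ∃ C : ℝ≥0, ∀ ψ : FLRW.Spacetime → ℝ, FLRW.IsSolution q ρ τ₀ ψ →
        ∀ τ₁ τ₂ : ℝ, τ₀ ≤ τ₁ → τ₁ < τ₂ →
          FLRW.rpBulk q ρ p ψ τ₁ τ₂ + FLRW.rpFlux q ρ p ψ τ₂ + FLRW.rpScri q ρ p ψ τ₁ τ₂
            ≤ C * (FLRW.rpFlux q ρ p ψ τ₁ + FLRW.energy q ρ ψ τ₁)) ∧
    (q = 1 / 2 →
      ∃ C : ℝ≥0, ∀ ψ : FLRW.Spacetime → ℝ, FLRW.IsSolution q ρ τ₀ ψ →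
        ∀ τ₁ τ₂ : ℝ, τ₀ ≤ τ₁ → τ₁ < τ₂ →
          FLRW.integralD q ρ τ₁ τ₂ (fun z => FLRW.radius z * FLRW.dv q (FLRW.phi q ψ) z ^ 2)
              + FLRW.rpFlux q ρ 2 ψ τ₂
              + FLRW.integralScri q ρ τ₁ τ₂ (fun z => FLRW.angularSq (FLRW.phi q ψ) z)
            ≤ C * (FLRW.rpFlux q ρ 2 ψ τ₁ + FLRW.energy q ρ ψ τ₁)) := by
  refine ⟨fun p hp hpq => ?_, fun hq => ?_⟩
  · have h1q : 0 < 1 - q := by linarith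
    have hX : 0 ≤ 1 + ρ / (2 * τ₀) := by positivity
    set A := q * |1 - 2 * q| / (1 - q) ^ 2 with hA
    have hA0 : 0 ≤ A := by positivity
    have hσ0 : 0 ≤ FLRW.sigma q := by
      rw [FLRW.sigma]
      positivity
    have hσ : FLRW.sigma q ^ 2 = 4 * A := by
      rw [FLRW.sigma, mul_pow, Real.sq_sqrt hA0]
      norm_num
    have hp2 : p < 2 := hpq.trans_le (max_le (by norm_num) (by linarith))
    have hAp (h : p < 2 - FLRW.sigma q) : 4 * A < (2 - p) ^ 2 := by
      rw [← hσ]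
      exact pow_lt_pow_left₀ (by linarith) hσ0 two_ne_zero
    rcases le_or_gt q (1 / 2) with hq | hq
    · have hm : FLRW.weightExponent q = 0 := by
        rw [FLRW.weightExponent, FLRW.mu, if_pos hq, zero_div]
      have habs : |1 - 2 * q| = 1 - 2 * q := abs_of_nonneg (by linarith)
      have hκ : FLRW.potentialConst q = -A := by
        rw [hA, habs, FLRW.potentialConst]
        ring
      have hlp : 4 * A < (2 - p) ^ 2 := by
        rcases lt_max_iff.1 hpq with h | h
        -- here `1 - 4 A` is a multiple of the square `(3 q - 1)²`
        · have h4 : 4 * A ≤ 1 := by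
            rw [hA, habs, ← mul_div_assoc, div_le_one (by positivity)]
            nlinarith [sq_nonneg (3 * q - 1)]
          nlinarith
        · exact hAp h
      obtain ⟨c₀, hc₀, hco⟩ := FLRW.exists_coercive_of_nonpos hA0 hp hp2 hX hlp
      refine FLRW.exists_estimate_of_coercive hq₁ hρ hτ₀ hm.ge hp hp2 hA0 le_rfl
        (γ := p * (2 - p) / 2) ?_ hc₀ ?_
      · have : 0 < 2 - p := by linarith
        positivity
      · rw [hm, hκ]
        exact hco
    · have hmu : FLRW.mu q = 4 * q - 2 := by rw [FLRW.mu, if_neg (not_le.2 hq)]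
      have habs : |1 - 2 * q| = 2 * q - 1 := by
        rw [abs_of_nonpos (by linarith)]
        ring
      have hκ : FLRW.potentialConst q
          = FLRW.weightExponent q * (FLRW.weightExponent q + 1) := by
        rw [FLRW.potentialConst, FLRW.weightExponent, hmu]
        field_simp
        ring
      have hAκ : A = FLRW.weightExponent q * (FLRW.weightExponent q + 1) := by
        rw [← hκ, hA, habs, FLRW.potentialConst]
      have hm : 0 < FLRW.weightExponent q := by
        rw [FLRW.weightExponent, hmu]
        exact div_pos (by linarith) (by linarith)
      rw [hAκ] at hAp
      rcases lt_or_ge p 1 with hp1 | hp1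
      · obtain ⟨γ, hγ, c₀, hc₀, hco⟩ := FLRW.exists_coercive_of_lt_one hm hp hp1 hX
        refine FLRW.exists_estimate_of_coercive hq₁ hρ hτ₀ hm.le hp hp2
          (by positivity : 0 ≤ FLRW.weightExponent q * (FLRW.weightExponent q + 1))
          (by positivity : 0 ≤ FLRW.weightExponent q * p) hγ hc₀ ?_
        rw [hκ]
        exact hco
      · have hlp := hAp ((lt_max_iff.1 hpq).resolve_left hp1.not_gt)
        obtain ⟨c₀, hc₀, hco⟩ := FLRW.exists_coercive_of_one_le hm hp1 hp2 hX hlp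
        refine FLRW.exists_estimate_of_coercive hq₁ hρ hτ₀ hm.le hp hp2
          (by positivity : 0 ≤ FLRW.weightExponent q * (FLRW.weightExponent q + 1)) le_rfl
          (γ := p * (2 - p) / 2) ?_ hc₀ ?_
        · have : 0 < 2 - p := by linarith
          positivity
        · rw [hκ]
          exact hco
  · subst hq
    exact FLRW.exists_estimate_endpoint hρ hτ₀
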